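/- Let $k$ be a commutative ring of characteristic $0$. A (multiplicative) hom-associative algebra $(A,\mu,\alpha)$ is a $k$-module $A$ with a bilinear product $\mu(a,b)=a\cdot b$ and a linear map $\alpha$ such that $(a\cdot b)\cdot\alpha(c)=\alpha(a)\cdot(b\cdot c)$ and $\alpha(a\cdot b)=\alpha(a)\cdot\alpha(b)$. It is regular if $\alpha$ is invertible, and unital if there is $1\in A$ with $\alpha(1)=1$ and $a\cdot 1=1\cdot a=\alpha(a)$ for all $a$. A bimodule $(M,\beta)$ is a $k$-module $M$ with a linear map $\beta$ and bilinear left and right actions of $A$ such that $\beta(am)=\alpha(a)\beta(m)$, $\beta(ma)=\beta(m)\alpha(a)$, $(a\cdot b)\beta(m)=\alpha(a)(bm)$, $(am)\alpha(b)=\alpha(a)(mb)$, $(ma)\alpha(b)=\beta(m)(a\cdot b)$. A hom-bimodule isomorphism is a linear isomorphism that commutes with the structure maps $\beta$ and with both actions. Let $(A,\mu,\alpha)$ be regular and unital. For a bimodule $(M,\beta)$ and $n\ge 0$ put $C^n_\alpha(A,M)=\{f:A^{\otimes n}\to M \mid \beta\circ f=f\circ\alpha^{\otimes n}\}$ with $$(\delta_\alpha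 f)(a_1,\dots,a_{n+1})=\alpha^{n-1}(a_1)f(a_2,\dots,a_{n+1})+\sum_{i=1}^n(-1)^i f(\alpha(a_1),\dots,a_i\cdot a_{i+1},\dots,\alpha(a_{n+1}))+(-1)^{n+1}f(a_1,\dots,a_n)\alpha^{n-1}(a_{n+1}),$$ let $H^n_\alpha(A,M)$ be the cohomology, and let $H^\bullet_\alpha(A)=H^\bullet_\alpha(A,A)$ for the bimodule $(A,\alpha)$ with both actions given by $\mu$. For $f\in C^p_\alpha(A,A)$, $g\in C^q_\alpha(A,A)$ put $$(f\circ_i g)(a_1,\dots,a_{p+q-1})=f(\alpha^{q-1}(a_1),\dots,\alpha^{q-1}(a_{i-1}),g(a_i,\dots,a_{i+q-1}),\alpha^{q-1}(a_{i+q}),\dots,\alpha^{q-1}(a_{p+q-1})),$$ $f\cup g=(\mu\circ_2 f)\circ_1 g$ and $[f,g]=\sum_{i=1}^p(-1)^{(q-1)(i-1)}f\circ_i g-(-1)^{(p-1)(q-1)}\sum_{i=1}^q(-1)^{(p-1)(i-1)}g\circ_i f$ (with $[f,g]=0$ if $p=q=0$). The dual $A^*=\mathrm{Hom}_k(A,k)$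 is a bimodule with structure map $(\alpha^{-1})^*$ and actions $(a\theta)(b)=\theta(\alpha^{-2}(b\cdot a))$, $(\theta a)(b)=\theta(\alpha^{-2}(a\cdot b))$. On chains $A\otimes A^{\otimes n}$ let $t(a_0\otimes\cdots\otimes a_n)=a_n\otimes a_0\otimes\cdots\otimes a_{n-1}$, let $e\bullet_{n+1}(a_0\otimes\cdots\otimes a_n)=\alpha^{-1}(a_0)\otimes\cdots\otimes\alpha^{-1}(a_n)\otimes 1$, and let $B(x)=\sum_{i=0}^n(-1)^{in}(\mathrm{id}-t)\,t\,(e\bullet_{n+1}t^i(x))$ be the Connes operator. Identify $m\in\mathrm{Hom}(A^{\otimes n},A^*)$ with the functional $a_0\otimes a_1\otimes\cdots\otimes a_n\mapsto m(a_1,\dots,a_n)(\alpha^{n-2}(a_0))$, and let $B^*:C^{n+1}_\alpha(A,A^*)\to C^n_\alpha(A,A^*)$ be the dual operator $B^*(m)=(-1)^{n+1}\,m\circ B$ (and $B^*=0$ on $C^0_\alpha(A,A^*)$). **Theorem.** Let $(A,\mu,\alpha)$ be a regular unital hom-associative algebra that is symmetric, i.e. there is a hom-bimodule isomorphism $\Theta:A\to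 A^*$. Then $\cup$ and $[\ ,\ ]$ induce on $H^\bullet_\alpha(A)$ the structure of a Gerstenhaber algebra: $\cup$ is associative and graded commutative, $[\ ,\ ]$ is a graded Lie bracket of degree $-1$, and $[f,g\cup h]=[f,g]\cup h+(-1)^{(p-1)q}g\cup[f,h]$ for $f,g$ of degrees $p,q$. Moreover $B^*$ induces a map on $H^\bullet_\alpha(A,A^*)$, $f\mapsto\Theta\circ f$ induces an isomorphism $\Theta_*:H^\bullet_\alpha(A)\to H^\bullet_\alpha(A,A^*)$, and the transported operator $\triangle=\Theta_*^{-1}B^*\Theta_*:H^\bullet_\alpha(A)\to H^{\bullet-1}_\alpha(A)$ is a BV-generator of this Gerstenhaber algebra: $\triangle^2=0$ and $$[f,g]=-(-1)^p\big(\triangle(f\cup g)-\triangle(f)\cup g-(-1)^p f\cup\triangle(g)\big)\qquad\text{for } f\in H^p_\alpha(A),\ g\in H^\bullet_\alpha(A).$$ -/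

import Mathlib

open scoped TensorProduct DirectSum

noncomputable section

namespace HomAssoc

/-! ### Hom-associative algebras and hom-bimodules -/

/-- A (multiplicative) hom-associative algebra `(A, μ, α)` over `k`. -/
structure HomAssocAlgebra (k : Type*) (A : Type*) [CommRing k] [AddCommGroup A] [Module k A] where
  mul : A →ₗ[k] A →ₗ[k] A
  α : A →ₗ[k] A
  hom_assoc : ∀ a b c : A, mul (mul a b) (α c) = mul (α a) (mul b c)
  α_mul : ∀ a b : A, α (mul a b) = mul (α a) (α b)

/-- A regular (`α` is invertible) unital (`α 1 = 1` and `a · 1 = 1 · a = α a`)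
hom-associative algebra. -/
structure RegularUnitalHomAssocAlgebra (k : Type*) (A : Type*) [CommRing k] [AddCommGroup A]
    [Module k A] extends HomAssocAlgebra k A where
  one : A
  α_one : α one = one
  mul_one : ∀ a : A, mul a one = α a
  one_mul : ∀ a : A, mul one a = α a
  bijective : Function.Bijective α

/-- A bimodule `(M, β)` over a hom-associative algebra, with left action `l a m = a m` and right
action `r m a = m a`. -/
structure HomBimodule {k A : Type*} [CommRing k] [AddCommGroup A] [Module k A]
    (R : HomAssocAlgebra k A) (M : Type*) [AddCommGroup M] [Module k M] where
  β : M →ₗ[k] M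
  l : A →ₗ[k] M →ₗ[k] M
  r : M →ₗ[k] A →ₗ[k] M
  β_l : ∀ a m, β (l a m) = l (R.α a) (β m)
  β_r : ∀ m a, β (r m a) = r (β m) (R.α a)
  l_l : ∀ a b m, l (R.mul a b) (β m) = l (R.α a) (l b m)
  l_r : ∀ a m b, r (l a m) (R.α b) = l (R.α a) (r m b)
  r_r : ∀ m a b, r (r m a) (R.α b) = r (β m) (R.mul a b)

/-- An isomorphism of hom-bimodules: a linear isomorphism that commutes with the structure maps
and with both actions. -/
structure HomBimodule.Iso {k A M N : Type*} [CommRing k] [AddCommGroup A] [Module k A]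
    [AddCommGroup M] [Module k M] [AddCommGroup N] [Module k N] {R : HomAssocAlgebra k A}
    (X : HomBimodule R M) (Y : HomBimodule R N) where
  toEquiv : M ≃ₗ[k] N
  map_β : ∀ m, toEquiv (X.β m) = Y.β (toEquiv m)
  map_l : ∀ a m, toEquiv (X.l a m) = Y.l a (toEquiv m)
  map_r : ∀ m a, toEquiv (X.r m a) = Y.r (toEquiv m) a

variable {k A : Type*} [CommRing k] [AddCommGroup A] [Module k A]

/-- `(A, α)` as a bimodule over itself. -/
def HomAssocAlgebra.self (R : HomAssocAlgebra k A) : HomBimodule R A where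
  β := R.α
  l := R.mul
  r := R.mul
  β_l := R.α_mul
  β_r := R.α_mul
  l_l := R.hom_assoc
  l_r := R.hom_assoc
  r_r := R.hom_assoc

namespace RegularUnitalHomAssocAlgebra

variable (R : RegularUnitalHomAssocAlgebra k A)

/-- The structure map `α` as a linear automorphism; its integer powers are `R.tw ^ z`. -/
def tw : A ≃ₗ[k] A := LinearEquiv.ofBijective R.α R.bijective

@[simp] lemma tw_apply (a : A) : R.tw a = R.α a := rfl

lemma tw_mul (a b : A) : R.tw (R.mul a b) = R.mul (R.tw a) (R.tw b) := R.α_mul a b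

lemma tw_zpow_mul (z : ℤ) (a b : A) :
    (R.tw ^ z) (R.mul a b) = R.mul ((R.tw ^ z) a) ((R.tw ^ z) b) := by
  induction z generalizing a b with
  | zero => simp
  | succ n ih => rw [zpow_add_one]; simp only [LinearEquiv.mul_apply, tw_mul, ih]
  | pred n ih =>
    rw [zpow_sub_one]
    simp only [LinearEquiv.mul_apply]
    rw [← ih]
    congr 1
    apply R.tw.injective
    rw [tw_mul]
    simp only [← LinearEquiv.mul_apply, mul_inv_cancel, LinearEquiv.coe_one, id_eq]

lemma tw_zpow_α (z : ℤ) (a : A) : (R.tw ^ z) (R.α a) = R.α ((R.tw ^ z) a) := by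
  rw [← tw_apply, ← tw_apply, ← LinearEquiv.mul_apply, ← LinearEquiv.mul_apply,
    ← zpow_add_one, ← zpow_one_add, add_comm]

lemma tw_zpow_add (y z : ℤ) (a : A) : (R.tw ^ y) ((R.tw ^ z) a) = (R.tw ^ (y + z)) a := by
  rw [zpow_add, LinearEquiv.mul_apply]

lemma tw_zpow_α_add (z : ℤ) (a : A) : (R.tw ^ z) (R.α a) = (R.tw ^ (z + 1)) a := by
  rw [zpow_add_one, LinearEquiv.mul_apply, tw_apply]

/-- The dual bimodule `(A^*, (α⁻¹)^*)`, with `(a θ)(b) = θ(α⁻²(b · a))` and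
`(θ a)(b) = θ(α⁻²(a · b))`. -/
def dual : HomBimodule R.toHomAssocAlgebra (Module.Dual k A) where
  β := Module.Dual.transpose (R.tw ^ (-1 : ℤ)).toLinearMap
  l := LinearMap.mk₂ k (fun a θ => θ ∘ₗ (R.tw ^ (-2 : ℤ)).toLinearMap ∘ₗ R.mul.flip a)
    (by intros; ext; simp) (by intros; ext; simp) (by intros; ext; simp) (by intros; ext; simp)
  r := LinearMap.mk₂ k (fun θ a => θ ∘ₗ (R.tw ^ (-2 : ℤ)).toLinearMap ∘ₗ R.mul a)
    (by intros; ext; simp) (by intros; ext; simp) (by intros; ext; simp) (by intros; ext; simp)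
  β_l a θ := by
    ext b
    simp only [Module.Dual.transpose_apply, LinearMap.mk₂_apply, LinearMap.comp_apply,
      LinearEquiv.coe_coe, LinearMap.flip_apply, tw_zpow_mul, tw_zpow_add, tw_zpow_α_add]
    norm_num
  β_r θ a := by
    ext b
    simp only [Module.Dual.transpose_apply, LinearMap.mk₂_apply, LinearMap.comp_apply,
      LinearEquiv.coe_coe, tw_zpow_mul, tw_zpow_add, tw_zpow_α_add]
    norm_num
  l_l a b θ := by
    ext c
    obtain ⟨c, rfl⟩ := R.bijective.2 c
    simp only [Module.Dual.transpose_apply, LinearMap.mk₂_apply, LinearMap.comp_apply,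
      LinearEquiv.coe_coe, LinearMap.flip_apply, ← R.hom_assoc]
    simp only [tw_zpow_mul, tw_zpow_add, tw_zpow_α_add]
    norm_num
  l_r a θ b := by
    ext c
    simp only [LinearMap.mk₂_apply, LinearMap.comp_apply,
      LinearEquiv.coe_coe, LinearMap.flip_apply]
    simp only [tw_zpow_mul, tw_zpow_add, tw_zpow_α_add]
    congr 1
    have h := R.hom_assoc ((R.tw ^ (-3 : ℤ)) b) ((R.tw ^ (-4 : ℤ)) c) ((R.tw ^ (-3 : ℤ)) a)
    simp only [← tw_apply] at h
    simp only [← zpow_one_add, ← LinearEquiv.mul_apply] at h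
    norm_num at h ⊢
    exact h
  r_r θ a b := by
    ext c
    obtain ⟨c, rfl⟩ := R.bijective.2 c
    simp only [Module.Dual.transpose_apply, LinearMap.mk₂_apply, LinearMap.comp_apply,
      LinearEquiv.coe_coe, R.hom_assoc]
    simp only [tw_zpow_mul, tw_zpow_add, tw_zpow_α_add]
    norm_num

/-! ### Partial compositions -/

variable {M : Type*} [AddCommGroup M] [Module k M]

/-- The arguments `α^{q-1} a_1, …, α^{q-1} a_{i-1}, g(a_i, …, a_{i+q-1}), α^{q-1} a_{i+q}, …`
(here `i` is counted from `0`). -/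
def compArgs {p q r : ℕ} (h : p + q = r + 1) (i : Fin p)
    (g : MultilinearMap k (fun _ : Fin q => A) A) (a : Fin r → A) : Fin p → A := fun j =>
  if _ : (j : ℕ) < i then (R.tw ^ ((q : ℤ) - 1)) (a ⟨j, by omega⟩)
  else if _ : j = i then g (fun s : Fin q => a ⟨i + s, by omega⟩)
  else (R.tw ^ ((q : ℤ) - 1)) (a ⟨j + q - 1, by omega⟩)

lemma compArgs_update {p q r : ℕ} (h : p + q = r + 1) (i : Fin p)
    (g : MultilinearMap k (fun _ : Fin q => A) A) (a : Fin r → A) (s : Fin r) :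
    ∃ (j : Fin p) (φ : A →ₗ[k] A), ∀ x,
      R.compArgs h i g (Function.update a s x) =
        Function.update (R.compArgs h i g a) j (φ x) := by
  rcases lt_or_ge (s : ℕ) i with h1 | h1
  · refine ⟨⟨s, by omega⟩, (R.tw ^ ((q : ℤ) - 1)).toLinearMap, fun x => ?_⟩
    funext j
    simp only [compArgs, Function.update_apply, Fin.ext_iff]
    split_ifs <;> first
      | rfl
      | omega
      | (congr 1; funext t
         rw [if_neg]; omega)
  · rcases lt_or_ge (s : ℕ) (i + q) with h2 | h2
    · refine ⟨i, g.toLinearMap (fun t => a ⟨i + t, by omega⟩) ⟨s - i, by omega⟩, fun x => ?_⟩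
      funext j
      simp only [compArgs, Function.update_apply, Fin.ext_iff]
      split_ifs <;> first
        | rfl
        | omega
        | (simp only [MultilinearMap.toLinearMap_apply]
           congr 1; funext t
           simp only [Function.update_apply, Fin.ext_iff]
           have : (i : ℕ) + t = s ↔ (t : ℕ) = s - i := by omega
           simp only [this])
    · refine ⟨⟨s + 1 - q, by omega⟩, (R.tw ^ ((q : ℤ) - 1)).toLinearMap, fun x => ?_⟩
      funext j
      simp only [compArgs, Function.update_apply, Fin.ext_iff]
      split_ifs <;> first
        | rfl
        | omega
        | (congr 1; funext t
           rw [if_neg]; omega)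

/-- The partial composition
`(f ∘_i g)(a_1, …, a_{p+q-1}) = f(α^{q-1} a_1, …, g(a_i, …, a_{i+q-1}), …, α^{q-1} a_{p+q-1})`
of multilinear maps with `p` and `q` arguments, where `r = p + q - 1` and `i` is counted
from `0`. -/
def comp {p q r : ℕ} (h : p + q = r + 1) (f : MultilinearMap k (fun _ : Fin p => A) M)
    (i : Fin p) (g : MultilinearMap k (fun _ : Fin q => A) A) :
    MultilinearMap k (fun _ : Fin r => A) M where
  toFun a := f (R.compArgs h i g a)
  map_update_add' {inst} a s x y := by
    rw [Subsingleton.elim inst (instDecidableEqFin r)]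
    obtain ⟨j, φ, hφ⟩ := R.compArgs_update h i g a s
    simp only [hφ, map_add, MultilinearMap.map_update_add]
  map_update_smul' {inst} a s c x := by
    rw [Subsingleton.elim inst (instDecidableEqFin r)]
    obtain ⟨j, φ, hφ⟩ := R.compArgs_update h i g a s
    simp only [hφ, map_smul, MultilinearMap.map_update_smul]

/-- The multiplication as a multilinear map in two arguments. -/
def mulMap : MultilinearMap k (fun _ : Fin 2 => A) A where
  toFun a := R.mul (a 0) (a 1)
  map_update_add' {inst} a s x y := by
    rw [Subsingleton.elim inst (instDecidableEqFin 2)]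
    fin_cases s <;> simp
  map_update_smul' {inst} a s c x := by
    rw [Subsingleton.elim inst (instDecidableEqFin 2)]
    fin_cases s <;> simp

lemma comp_equivariant {p q r : ℕ} (h : p + q = r + 1) (β : M →ₗ[k] M)
    (f : MultilinearMap k (fun _ : Fin p => A) M) (i : Fin p)
    (g : MultilinearMap k (fun _ : Fin q => A) A)
    (hf : ∀ a, β (f a) = f (fun j => R.α (a j))) (hg : ∀ a, R.α (g a) = g (fun j => R.α (a j)))
    (a : Fin r → A) : β (R.comp h f i g a) = R.comp h f i g (fun j => R.α (a j)) := by
  change β (f _) = f _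
  rw [hf]
  congr 1
  funext j
  simp only [compArgs]
  split_ifs
  · rw [tw_zpow_α]
  · rw [hg]
  · rw [tw_zpow_α]

/-! ### Hochschild cochains and cohomology -/

variable (X : HomBimodule R.toHomAssocAlgebra M)

/-- The multilinear maps `f : A^n → M` with `β ∘ f = f ∘ α^{⊗ n}`. -/
def cochainSubmodule (n : ℕ) : Submodule k (MultilinearMap k (fun _ : Fin n => A) M) where
  carrier := {f | ∀ a, X.β (f a) = f (fun i => R.α (a i))}
  add_mem' hf hg a := by simp [hf a, hg a]
  zero_mem' a := by simp
  smul_mem' c f hf a := by simp [hf a]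

/-- The module of cochains `C^n_α(A, M)`: multilinear maps `f : A^n → M` with
`β ∘ f = f ∘ α^{⊗ n}`. For `n = 0` these are the elements `m` of `M` with `β m = m`. -/
def Cochain (n : ℕ) : Type _ := R.cochainSubmodule X n

instance (n : ℕ) : AddCommGroup (R.Cochain X n) :=
  inferInstanceAs (AddCommGroup (R.cochainSubmodule X n))

instance (n : ℕ) : Module k (R.Cochain X n) :=
  inferInstanceAs (Module k (R.cochainSubmodule X n))

lemma mem_cochainSubmodule {n : ℕ} {f : MultilinearMap k (fun _ : Fin n => A) M} :
    f ∈ R.cochainSubmodule X n ↔ ∀ a, X.β (f a) = f (fun i => R.α (a i)) := Iff.rfl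

/-- `(a_1, …, a_{n+1}) ↦ α^{n-1}(a_1) f(a_2, …, a_{n+1})`. -/
def leftTerm {n : ℕ} (f : MultilinearMap k (fun _ : Fin n => A) M) :
    MultilinearMap k (fun _ : Fin (n + 1) => A) M :=
  LinearMap.uncurryLeft (M := fun _ : Fin (n + 1) => A)
    { toFun := fun a => (X.l ((R.tw ^ ((n : ℤ) - 1)) a)).compMultilinearMap f
      map_add' := by intros; ext; simp
      map_smul' := by intros; ext; simp }

/-- `(a_1, …, a_{n+1}) ↦ f(a_1, …, a_n) α^{n-1}(a_{n+1})`. -/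
def rightTerm {n : ℕ} (f : MultilinearMap k (fun _ : Fin n => A) M) :
    MultilinearMap k (fun _ : Fin (n + 1) => A) M :=
  MultilinearMap.uncurryRight (M := fun _ : Fin (n + 1) => A)
    ((X.r.compl₂ (R.tw ^ ((n : ℤ) - 1)).toLinearMap).compMultilinearMap f)

lemma leftTerm_apply {n : ℕ} (f : MultilinearMap k (fun _ : Fin n => A) M)
    (a : Fin (n + 1) → A) :
    R.leftTerm X f a = X.l ((R.tw ^ ((n : ℤ) - 1)) (a 0)) (f (Fin.tail a)) := rfl

lemma rightTerm_apply {n : ℕ} (f : MultilinearMap k (fun _ : Fin n => A) M)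
    (a : Fin (n + 1) → A) :
    R.rightTerm X f a = X.r (f (Fin.init a)) ((R.tw ^ ((n : ℤ) - 1)) (a (Fin.last n))) := rfl

lemma comp_apply {p q r : ℕ} (h : p + q = r + 1) (f : MultilinearMap k (fun _ : Fin p => A) M)
    (i : Fin p) (g : MultilinearMap k (fun _ : Fin q => A) A) (a : Fin r → A) :
    R.comp h f i g a = f (R.compArgs h i g a) := rfl

/-- The coboundary
`(δ_α f)(a_1, …, a_{n+1}) = α^{n-1}(a_1) f(a_2, …, a_{n+1})
  + ∑_{i=1}^n (-1)^i f(α a_1, …, α a_{i-1}, a_i · a_{i+1}, α a_{i+2}, …, α a_{n+1})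
  + (-1)^{n+1} f(a_1, …, a_n) α^{n-1}(a_{n+1})`
on all multilinear maps. -/
def coboundaryAux (n : ℕ) :
    MultilinearMap k (fun _ : Fin n => A) M →ₗ[k] MultilinearMap k (fun _ : Fin (n + 1) => A) M where
  toFun f := R.leftTerm X f
    + ∑ i : Fin n, ((i : ℤ) + 1).negOnePow • R.comp (rfl : n + 2 = (n + 1) + 1) f i R.mulMap
    + ((n : ℤ) + 1).negOnePow • R.rightTerm X f
  map_add' f g := by
    ext a
    simp only [add_apply, sum_apply, smul_apply,
      leftTerm_apply, rightTerm_apply, comp_apply, map_add, LinearMap.add_apply, smul_add,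
      Finset.sum_add_distrib]
    abel
  map_smul' c f := by
    ext a
    simp only [add_apply, sum_apply, smul_apply,
      leftTerm_apply, rightTerm_apply, comp_apply, map_smul, LinearMap.smul_apply, smul_add,
      Finset.smul_sum, RingHom.id_apply, smul_comm c]

lemma mulMap_equivariant (a : Fin 2 → A) : R.α (R.mulMap a) = R.mulMap (fun j => R.α (a j)) :=
  R.α_mul _ _

/-- The Hochschild coboundary `δ_α : C^n_α(A, M) → C^{n+1}_α(A, M)`. -/
def coboundary (n : ℕ) : R.Cochain X n →ₗ[k] R.Cochain X (n + 1) :=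
  (R.coboundaryAux X n).restrict (p := R.cochainSubmodule X n)
    (q := R.cochainSubmodule X (n + 1)) fun f hf a => by
    have hc : ∀ i : Fin n, X.β (R.comp (rfl : n + 2 = (n + 1) + 1) f i R.mulMap a) = _ :=
      fun i => R.comp_equivariant (rfl : n + 2 = (n + 1) + 1) X.β f i R.mulMap hf R.mulMap_equivariant a
    simp only [coboundaryAux, LinearMap.coe_mk, AddHom.coe_mk, add_apply,
      sum_apply, smul_apply, map_add, map_sum, Units.smul_def,
      map_zsmul, hc, leftTerm_apply, rightTerm_apply, X.β_l, X.β_r, hf _, tw_zpow_α]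
    rfl

/-- The `n`-cocycles. -/
def cocycles (n : ℕ) : Submodule k (R.Cochain X n) := LinearMap.ker (R.coboundary X n)

/-- The `n`-coboundaries; there are none in degree `0`. -/
def coboundaries : (n : ℕ) → Submodule k (R.Cochain X n)
  | 0 => ⊥
  | n + 1 => LinearMap.range (R.coboundary X n)

/-- The Hochschild cohomology `H^n_α(A, M)`: cocycles modulo coboundaries. -/
def Cohomology (n : ℕ) : Type _ :=
  R.cocycles X n ⧸ (R.coboundaries X n).submoduleOf (R.cocycles X n)

instance (n : ℕ) : AddCommGroup (R.Cohomology X n) :=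
  inferInstanceAs (AddCommGroup (R.cocycles X n ⧸
    (R.coboundaries X n).submoduleOf (R.cocycles X n)))

instance (n : ℕ) : Module k (R.Cohomology X n) :=
  inferInstanceAs (Module k (R.cocycles X n ⧸
    (R.coboundaries X n).submoduleOf (R.cocycles X n)))

/-- The class of a cocycle. -/
def classOf (n : ℕ) : R.cocycles X n →ₗ[k] R.Cohomology X n :=
  ((R.coboundaries X n).submoduleOf (R.cocycles X n)).mkQ

/-- The graded module `H^•_α(A, M) = ⨁_{n ≥ 0} H^n_α(A, M)`. -/
def TotalCohomology : Type _ := ⨁ n : ℕ, R.Cohomology X n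

instance : AddCommGroup (R.TotalCohomology X) :=
  inferInstanceAs (AddCommGroup (⨁ n : ℕ, R.Cohomology X n))

instance : Module k (R.TotalCohomology X) :=
  inferInstanceAs (Module k (⨁ n : ℕ, R.Cohomology X n))

/-- The inclusion of `H^n_α(A, M)` in `H^•_α(A, M)`. -/
def incl (n : ℕ) : R.Cohomology X n →ₗ[k] R.TotalCohomology X :=
  DirectSum.lof k ℕ (fun n => R.Cohomology X n) n

/-- The grading of `H^•_α(A, M)` by the integers, which is zero in negative degrees. -/
def grading (i : ℤ) : Submodule k (R.TotalCohomology X) :=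
  ⨆ (n : ℕ) (_ : (n : ℤ) = i), LinearMap.range (R.incl X n)

/-- `f` is a cocycle of degree `n` and `x` is its class in `H^•_α(A, M)`. -/
def IsClassOf (n : ℕ) (x : R.TotalCohomology X) (f : R.Cochain X n) : Prop :=
  ∃ hf : f ∈ R.cocycles X n, x = R.incl X n (R.classOf X n ⟨f, hf⟩)

/-! ### Cup product and Gerstenhaber bracket on `C^•_α(A) = C^•_α(A, A)` -/

/-- Partial composition of cochains with values in `A`. -/
def circ {p q r : ℕ} (h : p + q = r + 1) (f : R.Cochain R.self p) (i : Fin p)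
    (g : R.Cochain R.self q) : R.Cochain R.self r :=
  ⟨R.comp h f.1 i g.1, R.comp_equivariant h R.α f.1 i g.1 f.2 g.2⟩

/-- The multiplication `μ` as an element of `C^2_α(A)`. -/
def mulCochain : R.Cochain R.self 2 := ⟨R.mulMap, R.mulMap_equivariant⟩

/-- The product `f ∪ g = (μ ∘_2 f) ∘_1 g`. -/
def cup {p q : ℕ} (f : R.Cochain R.self p) (g : R.Cochain R.self q) : R.Cochain R.self (p + q) :=
  R.circ (by omega : (p + 1) + q = (p + q) + 1)
    (R.circ (by omega : 2 + p = (p + 1) + 1) R.mulCochain 1 f) 0 g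

/-- The bracket `[f, g] = ∑_{i=1}^p (-1)^{(q-1)(i-1)} f ∘_i g
  - (-1)^{(p-1)(q-1)} ∑_{i=1}^q (-1)^{(p-1)(i-1)} g ∘_i f`, where `r = p + q - 1`. -/
def bracket {p q r : ℕ} (h : p + q = r + 1) (f : R.Cochain R.self p) (g : R.Cochain R.self q) :
    R.Cochain R.self r :=
  ∑ i : Fin p, (((q : ℤ) - 1) * i).negOnePow • R.circ h f i g
    - (((p : ℤ) - 1) * ((q : ℤ) - 1)).negOnePow •
      ∑ i : Fin q, (((p : ℤ) - 1) * i).negOnePow • R.circ (by omega : q + p = r + 1) g i f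

/-! ### The Connes operator on chains and its dual -/

variable (k A) in
/-- The Hochschild chains `C_n^α(A) = A ⊗ A^{⊗ n}`. -/
abbrev Chain (n : ℕ) : Type _ := ⨂[k] _ : Fin (n + 1), A

variable (k A) in
/-- The cyclic operator `t(a_0 ⊗ a_1 ⋯ a_n) = a_n ⊗ a_0 ⋯ a_{n-1}`. -/
def cyc (n : ℕ) : Chain k A n →ₗ[k] Chain k A n :=
  (PiTensorProduct.reindex k (fun _ : Fin (n + 1) => A) (finRotate (n + 1))).toLinearMap

/-- The map `e •_{n+1} (a_0 ⊗ a_1 ⋯ a_n) = α⁻¹(a_0) ⊗ α⁻¹(a_1) ⋯ α⁻¹(a_n) ⊗ 1`. -/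
def appendOne (n : ℕ) : Chain k A n →ₗ[k] Chain k A (n + 1) :=
  PiTensorProduct.lift
    (((LinearMap.applyₗ R.one).compMultilinearMap
      (PiTensorProduct.tprod k (s := fun _ : Fin (n + 2) => A)).curryRight).compLinearMap
        fun _ => (R.tw ^ (-1 : ℤ)).toLinearMap)

/-- The Connes boundary operator
`B(x) = ∑_{i=0}^n (-1)^{i n} (id - t) t (e •_{n+1} t^i(x))`. -/
def connes (n : ℕ) : Chain k A n →ₗ[k] Chain k A (n + 1) :=
  ∑ i ∈ Finset.range (n + 1), (-1 : k) ^ (i * n) •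
    ((LinearMap.id - cyc k A (n + 1)) ∘ₗ cyc k A (n + 1) ∘ₗ R.appendOne n ∘ₗ ((cyc k A n) ^ i))

/-- The linear functional `a_0 ⊗ a_1 ⋯ a_n ↦ m(a_1, …, a_n)(α^{n-2}(a_0))` on chains that is
defined by a multilinear map `m : A^n → A^*`. -/
def toFunctional (n : ℕ) (m : MultilinearMap k (fun _ : Fin n => A) (Module.Dual k A)) :
    Module.Dual k (Chain k A n) :=
  PiTensorProduct.lift (LinearMap.uncurryLeft (M := fun _ : Fin (n + 1) => A)
    { toFun := fun a => (LinearMap.applyₗ ((R.tw ^ ((n : ℤ) - 2)) a)).compMultilinearMap m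
      map_add' := by intros; ext; simp
      map_smul' := by intros; ext; simp })

@[simp] lemma toFunctional_tprod (n : ℕ)
    (m : MultilinearMap k (fun _ : Fin n => A) (Module.Dual k A)) (a : Fin (n + 1) → A) :
    R.toFunctional n m (PiTensorProduct.tprod k a) =
      m (Fin.tail a) ((R.tw ^ ((n : ℤ) - 2)) (a 0)) := by
  simp [toFunctional, LinearMap.uncurryLeft_apply]

/-- The multilinear map `A^n → A^*` that is defined by a functional on chains. -/
def ofFunctional (n : ℕ) (φ : Module.Dual k (Chain k A n)) :
    MultilinearMap k (fun _ : Fin n => A) (Module.Dual k A) where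
  toFun a :=
    { toFun := fun b => (φ.compMultilinearMap
        (PiTensorProduct.tprod k (s := fun _ : Fin (n + 1) => A))).curryLeft
          ((R.tw ^ (2 - (n : ℤ))) b) a
      map_add' := fun x y => by rw [map_add, map_add]; rfl
      map_smul' := fun c x => by rw [map_smul, map_smul]; rfl }
  map_update_add' a s x y := by
    ext b
    exact MultilinearMap.map_update_add ((φ.compMultilinearMap
      (PiTensorProduct.tprod k (s := fun _ : Fin (n + 1) => A))).curryLeft
        ((R.tw ^ (2 - (n : ℤ))) b)) a s x y
  map_update_smul' a s c x := by
    ext b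
    exact MultilinearMap.map_update_smul ((φ.compMultilinearMap
      (PiTensorProduct.tprod k (s := fun _ : Fin (n + 1) => A))).curryLeft
        ((R.tw ^ (2 - (n : ℤ))) b)) a s c x

@[simp] lemma ofFunctional_apply (n : ℕ) (φ : Module.Dual k (Chain k A n)) (a : Fin n → A)
    (b : A) : R.ofFunctional n φ a b =
      φ (PiTensorProduct.tprod k (Fin.cons ((R.tw ^ (2 - (n : ℤ))) b) a : Fin (n + 1) → A)) := rfl

/-- The identification `Hom(A^{⊗ n}, A^*) ≃ (C_n^α(A))^*`, under which `m` corresponds to the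
functional `a_0 ⊗ a_1 ⋯ a_n ↦ m(a_1, …, a_n)(α^{n-2}(a_0))`. -/
def functionalEquiv (n : ℕ) :
    MultilinearMap k (fun _ : Fin n => A) (Module.Dual k A) ≃ₗ[k] Module.Dual k (Chain k A n) where
  toFun := R.toFunctional n
  invFun := R.ofFunctional n
  map_add' m m' := by
    ext a
    simp
  map_smul' c m := by
    ext a
    simp
  left_inv m := by
    ext a b
    simp [tw_zpow_add]
  right_inv φ := by
    ext a
    simp [tw_zpow_add]

lemma functionalEquiv_tprod (n : ℕ)
    (m : MultilinearMap k (fun _ : Fin n => A) (Module.Dual k A)) (a : Fin (n + 1) → A) :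
    R.functionalEquiv n m (PiTensorProduct.tprod k a) =
      m (Fin.tail a) ((R.tw ^ ((n : ℤ) - 2)) (a 0)) := R.toFunctional_tprod n m a

lemma functionalEquiv_symm_apply (n : ℕ) (φ : Module.Dual k (Chain k A n)) (a : Fin n → A)
    (b : A) : (R.functionalEquiv n).symm φ a b =
      φ (PiTensorProduct.tprod k (Fin.cons ((R.tw ^ (2 - (n : ℤ))) b) a : Fin (n + 1) → A)) := rfl

/-- The action of `α` on chains. -/
def chainMap (n : ℕ) : Chain k A n →ₗ[k] Chain k A n := PiTensorProduct.map fun _ => R.α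

lemma chainMap_tprod (n : ℕ) (a : Fin (n + 1) → A) :
    R.chainMap n (PiTensorProduct.tprod k a) = PiTensorProduct.tprod k (fun i => R.α (a i)) := by
  simp [chainMap]

lemma cyc_tprod (n : ℕ) (a : Fin (n + 1) → A) :
    cyc k A n (PiTensorProduct.tprod k a) =
      PiTensorProduct.tprod k (fun i => a ((finRotate (n + 1)).symm i)) := by
  simp [cyc]

lemma appendOne_tprod (n : ℕ) (a : Fin (n + 1) → A) :
    R.appendOne n (PiTensorProduct.tprod k a) =
      PiTensorProduct.tprod k
        (Fin.snoc (fun i => (R.tw ^ (-1 : ℤ)) (a i)) R.one : Fin (n + 2) → A) := by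
  simp [appendOne]

lemma chainMap_cyc (n : ℕ) : R.chainMap n ∘ₗ cyc k A n = cyc k A n ∘ₗ R.chainMap n := by
  ext a
  simp [chainMap_tprod, cyc_tprod]

lemma chainMap_cyc_pow (n i : ℕ) :
    R.chainMap n ∘ₗ ((cyc k A n) ^ i) = ((cyc k A n) ^ i) ∘ₗ R.chainMap n :=
  ((show Commute (R.chainMap n) (cyc k A n) from R.chainMap_cyc n).pow_right i).eq

lemma chainMap_appendOne (n : ℕ) :
    R.chainMap (n + 1) ∘ₗ R.appendOne n = R.appendOne n ∘ₗ R.chainMap n := by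
  ext a
  simp only [LinearMap.compMultilinearMap_apply, LinearMap.comp_apply, chainMap_tprod,
    appendOne_tprod]
  congr 1
  funext i
  refine Fin.lastCases ?_ (fun j => ?_) i
  · simp [R.α_one]
  · simp only [Fin.snoc_castSucc, tw_zpow_α]

lemma chainMap_connes (n : ℕ) :
    R.chainMap (n + 1) ∘ₗ R.connes n = R.connes n ∘ₗ R.chainMap n := by
  have h1 := fun x => LinearMap.congr_fun (R.chainMap_cyc (n + 1)) x
  have h2 := fun x => LinearMap.congr_fun (R.chainMap_appendOne n) x
  have h3 := fun i x => LinearMap.congr_fun (R.chainMap_cyc_pow n i) x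
  simp only [LinearMap.comp_apply] at h1 h2 h3
  refine LinearMap.ext fun x => ?_
  simp only [connes, LinearMap.comp_apply, LinearMap.sum_apply, LinearMap.smul_apply, map_sum,
    map_smul, LinearMap.sub_apply, LinearMap.id_apply, map_sub, h1, h2, h3]

lemma mem_cochain_dual_iff (n : ℕ)
    (m : MultilinearMap k (fun _ : Fin n => A) (Module.Dual k A)) :
    m ∈ R.cochainSubmodule R.dual n ↔
      R.functionalEquiv n m ∘ₗ R.chainMap n = R.functionalEquiv n m := by
  have hβ : ∀ (θ : Module.Dual k A) (b : A), R.dual.β θ (R.α b) = θ b := fun θ b => by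
    change θ ((R.tw ^ (-1 : ℤ)) (R.α b)) = θ b
    rw [tw_zpow_α_add]
    simp
  rw [mem_cochainSubmodule]
  constructor
  · intro h
    ext a
    simp only [LinearMap.compMultilinearMap_apply, LinearMap.comp_apply, chainMap_tprod,
      functionalEquiv_tprod, tw_zpow_α]
    change m (fun i => R.α (Fin.tail a i)) _ = _
    rw [← h, hβ]
  · intro h a
    refine LinearMap.ext fun b => ?_
    obtain ⟨b, rfl⟩ := R.bijective.2 b
    have := LinearMap.congr_fun h
      (PiTensorProduct.tprod k (Fin.cons ((R.tw ^ (2 - (n : ℤ))) b) a : Fin (n + 1) → A))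
    simp only [LinearMap.comp_apply, chainMap_tprod, functionalEquiv_tprod, tw_zpow_α] at this
    rw [hβ]
    simp only [Fin.cons_zero, Fin.tail_cons, tw_zpow_add] at this
    norm_num at this
    exact this.symm

/-- The dual of the Connes operator, `B^*(m) = (-1)^{|m|} m ∘ B`, on multilinear maps. -/
def dualConnesAux (n : ℕ) :
    MultilinearMap k (fun _ : Fin (n + 1) => A) (Module.Dual k A) →ₗ[k]
      MultilinearMap k (fun _ : Fin n => A) (Module.Dual k A) :=
  (-1 : k) ^ (n + 1) •
    ((R.functionalEquiv n).symm.toLinearMap ∘ₗ Module.Dual.transpose (R.connes n) ∘ₗ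
      (R.functionalEquiv (n + 1)).toLinearMap)

/-- The dual Connes operator `B^* : C^{n+1}_α(A, A^*) → C^n_α(A, A^*)`. -/
def dualConnes (n : ℕ) : R.Cochain R.dual (n + 1) →ₗ[k] R.Cochain R.dual n :=
  (R.dualConnesAux n).restrict (p := R.cochainSubmodule R.dual (n + 1))
    (q := R.cochainSubmodule R.dual n) fun m hm => by
      rw [mem_cochain_dual_iff] at hm
      have key : (R.functionalEquiv n).symm
          (R.functionalEquiv (n + 1) m ∘ₗ R.connes n) ∈ R.cochainSubmodule R.dual n := by
        rw [mem_cochain_dual_iff, LinearEquiv.apply_symm_apply, LinearMap.comp_assoc,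
          ← chainMap_connes, ← LinearMap.comp_assoc, hm]
      exact Submodule.smul_mem _ _ key

/-- Composition with a hom-bimodule isomorphism `Θ`, as a map `C^n_α(A, M) → C^n_α(A, N)`. -/
def mapCochain {N : Type*} [AddCommGroup N] [Module k N] {X : HomBimodule R.toHomAssocAlgebra M}
    {Y : HomBimodule R.toHomAssocAlgebra N} (Θ : X.Iso Y) {n : ℕ} (f : R.Cochain X n) :
    R.Cochain Y n :=
  ⟨Θ.toEquiv.toLinearMap.compMultilinearMap f.1, fun a => by
    simp only [LinearMap.compMultilinearMap_apply, LinearEquiv.coe_coe, ← Θ.map_β, f.2 a]⟩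

/-! ### The induced operations on cohomology -/

/-- `cupH` is the operation on `H^•_α(A)` that is induced by the product of cochains. -/
def InducesCup (cupH : R.TotalCohomology R.self →ₗ[k] R.TotalCohomology R.self →ₗ[k]
    R.TotalCohomology R.self) : Prop :=
  ∀ (p q : ℕ) (x y : R.TotalCohomology R.self) (f : R.Cochain R.self p) (g : R.Cochain R.self q),
    R.IsClassOf R.self p x f → R.IsClassOf R.self q y g →
      R.IsClassOf R.self (p + q) (cupH x y) (R.cup f g)

/-- `brH` is the operation on `H^•_α(A)` that is induced by the bracket of cochains. (The bracket
of two classes of degree `0` has degree `-1`, so it is zero.) -/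
def InducesBracket (brH : R.TotalCohomology R.self →ₗ[k] R.TotalCohomology R.self →ₗ[k]
    R.TotalCohomology R.self) : Prop :=
  (∀ (p q r : ℕ) (h : p + q = r + 1) (x y : R.TotalCohomology R.self)
    (f : R.Cochain R.self p) (g : R.Cochain R.self q),
    R.IsClassOf R.self p x f → R.IsClassOf R.self q y g →
      R.IsClassOf R.self r (brH x y) (R.bracket h f g)) ∧
  ∀ (x y : R.TotalCohomology R.self) (f g : R.Cochain R.self 0),
    R.IsClassOf R.self 0 x f → R.IsClassOf R.self 0 y g → brH x y = 0

/-- `BH` is the operation on `H^•_α(A, A^*)` that is induced by the dual Connes operator `B^*`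
(which is zero in degree `0`). -/
def InducesDualConnes
    (BH : R.TotalCohomology R.dual →ₗ[k] R.TotalCohomology R.dual) : Prop :=
  (∀ (n : ℕ) (x : R.TotalCohomology R.dual) (m : R.Cochain R.dual (n + 1)),
    R.IsClassOf R.dual (n + 1) x m → R.IsClassOf R.dual n (BH x) (R.dualConnes n m)) ∧
  ∀ (x : R.TotalCohomology R.dual) (m : R.Cochain R.dual 0), R.IsClassOf R.dual 0 x m → BH x = 0

/-- `ΘH` is the isomorphism `H^•_α(A) ≃ H^•_α(A, A^*)` that is induced by the hom-bimodule
isomorphism `Θ`. -/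
def InducesIso (Θ : R.self.Iso R.dual)
    (ΘH : R.TotalCohomology R.self ≃ₗ[k] R.TotalCohomology R.dual) : Prop :=
  ∀ (n : ℕ) (x : R.TotalCohomology R.self) (f : R.Cochain R.self n),
    R.IsClassOf R.self n x f → R.IsClassOf R.dual n (ΘH x) (R.mapCochain Θ f)

end RegularUnitalHomAssocAlgebra

/-! ### Gerstenhaber and Batalin-Vilkovisky algebras -/

/-- `V = ⨁_{i ∈ ℤ} V^i` with the product `cup` and the bracket `br` is a Gerstenhaber algebra. -/
structure IsGerstenhaberAlgebra {V : Type*} [AddCommGroup V] [Module k V]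
    (𝒢 : ℤ → Submodule k V) (cup br : V →ₗ[k] V →ₗ[k] V) : Prop where
  isInternal : DirectSum.IsInternal 𝒢
  cup_mem : ∀ {p q : ℤ} {f g : V}, f ∈ 𝒢 p → g ∈ 𝒢 q → cup f g ∈ 𝒢 (p + q)
  br_mem : ∀ {p q : ℤ} {f g : V}, f ∈ 𝒢 p → g ∈ 𝒢 q → br f g ∈ 𝒢 (p + q - 1)
  cup_assoc : ∀ f g h : V, cup (cup f g) h = cup f (cup g h)
  cup_comm : ∀ {p q : ℤ} {f g : V}, f ∈ 𝒢 p → g ∈ 𝒢 q →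
    cup f g = (p * q).negOnePow • cup g f
  br_skew : ∀ {p q : ℤ} {f g : V}, f ∈ 𝒢 p → g ∈ 𝒢 q →
    br f g = -(((p - 1) * (q - 1)).negOnePow • br g f)
  jacobi : ∀ {p q : ℤ} {f g : V} (h : V), f ∈ 𝒢 p → g ∈ 𝒢 q →
    br f (br g h) = br (br f g) h + ((p - 1) * (q - 1)).negOnePow • br g (br f h)
  leibniz : ∀ {p q : ℤ} {f g : V} (h : V), f ∈ 𝒢 p → g ∈ 𝒢 q →
    br f (cup g h) = cup (br f g) h + ((p - 1) * q).negOnePow • cup g (br f h)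

/-- `Δ` is a BV-generator: `Δ` has degree `-1`, `Δ² = 0`, and
`[f, g] = -(-1)^p (Δ(f ∪ g) - Δ(f) ∪ g - (-1)^p f ∪ Δ(g))` for `f` of degree `p`. -/
structure IsBVGenerator {V : Type*} [AddCommGroup V] [Module k V]
    (𝒢 : ℤ → Submodule k V) (cup br : V →ₗ[k] V →ₗ[k] V) (Δ : V →ₗ[k] V) : Prop where
  mem : ∀ {p : ℤ} {f : V}, f ∈ 𝒢 p → Δ f ∈ 𝒢 (p - 1)
  sq_zero : ∀ f : V, Δ (Δ f) = 0
  br_eq : ∀ {p : ℤ} {f : V} (g : V), f ∈ 𝒢 p →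
    br f g = -(p.negOnePow • (Δ (cup f g) - cup (Δ f) g - p.negOnePow • cup f (Δ g)))

end HomAssoc

end

/-!
The product `a * b = α⁻¹(a · b)` makes a regular unital hom-associative algebra `A` an associative
unital algebra `B`, of which `σ = α` is an automorphism (`Untwisting`). When the values of a
cochain of degree `n` are twisted by `α^(1-n)`, the powers of `α` in the coboundary, the partial
compositions and the cup product disappear: `Untwisting.word` turns a cochain into a
`σ`-equivariant multilinear function on words in `B`, that is, on lists of elements of `B`, and
the operations into the ordinary Hochschild operations of `B` (`word_coboundary`, `word_cup`,
`word_circ`, `word_bracket`). Thus `cohEquiv` identifies `H_α(A)` with the cohomology `Coh σ` of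
such functions. In the same way the isomorphism `Θ` becomes a `σ`-invariant symmetrizing form on
`B` (`Untwisting.form`), with trace `τ` say, and the theorem becomes the equivariant version of
the one for symmetric associative algebras.

*The operations on words.* A function on words is evaluated by recursion on the word. A sum over
positions, or over rotations, is a sum over the decompositions of a word (`splits`), and all
boundary formulas follow by induction on the word. The coboundary of the insertion of a cocycle
`g` in a cocycle `F` is the graded commutator of their products (`cob_ins`), whence graded
commutativity of the cup product (`cupCoh_comm`). The coboundary of the double insertion shows
that insertion in a cocycle is a derivation of the product up to coboundaries (`cob_ins₂`), which
gives the Leibniz rule of the bracket in one argument (`cls_gerst_conc`).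

*The operator `Δ`.* On words `B^*` has two parts, from the two terms of `id - t` (`connesWord`). On
cocycles the contribution of `t` is a coboundary (`rot_unitTr`), so that in cohomology only that of
`id` remains. It is the operator `bv`, up to sign: `bv F` at a word `l` is dual to the sum of
`τ ∘ F` over the rotations of `a₀ :: l`, with signs. For the same reason `bv` agrees in cohomology
with `bvConnes`, in which the two parts are combined with the signs of Connes' boundary operator;
the square of `bvConnes` vanishes already on functions, since a sum over rotations is invariant
under signed rotations and hence killed by `1 - t` (`bvConnes_bvConnes`).

*The BV formula.* The rotations of the trace of a product of `g` and `F` fall into two halves,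
according to the factor which contains the distinguished letter (`rot_tr_conc`). The insertions of
`g` in `τ ∘ F` behind that letter have a coboundary which compares one half with the insertion of
`g` in `F` and with the product of `g` and `Δ F` (`dualCob_insBehind`); the other half is the same
with `F` and `g` exchanged. The difference of the two insertions is the Gerstenhaber bracket
(`cls_gerst`, `brCoh_eq`).

*The remaining axioms.* Given `Δ² = 0`, the BV formula, an associative and graded commutative
product and the Leibniz rule, skew-symmetry and the Jacobi identity of the bracket are formal
consequences: `Δ` is a derivation of the bracket, and applying it to the Leibniz rule gives the
Jacobi identity (`IsBVGenerator.isGerstenhaberAlgebra`).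
-/

set_option linter.unusedSectionVars false

namespace HomAssoc

namespace Word

/-! ### Decompositions of words -/

section Splits

variable {X V W : Type*} [AddCommGroup V] [AddCommGroup W]

/-- The sum of `Ψ x y` over all decompositions `l = x ++ y` of a word. -/
def splits : (List X → List X → V) → List X → V
  | Ψ, [] => Ψ [] []
  | Ψ, a :: l => Ψ [] (a :: l) + splits (fun x y => Ψ (a :: x) y) l

@[simp] lemma splits_nil (Ψ : List X → List X → V) : splits Ψ [] = Ψ [] [] := rfl

lemma splits_cons (Ψ : List X → List X → V) (a : X) (l : List X) :
    splits Ψ (a :: l) = Ψ [] (a :: l) + splits (fun x y => Ψ (a :: x) y) l := rfl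

lemma splits_congr {Ψ Φ : List X → List X → V} {l : List X}
    (h : ∀ x y, x ++ y = l → Ψ x y = Φ x y) : splits Ψ l = splits Φ l := by
  induction l generalizing Ψ Φ with
  | nil => exact h _ _ rfl
  | cons a l ih =>
    rw [splits_cons, splits_cons, h _ _ rfl, ih]
    intro x y hxy
    exact h _ _ (by simp [hxy])

lemma splits_add (Ψ Φ : List X → List X → V) (l : List X) :
    splits (fun x y => Ψ x y + Φ x y) l = splits Ψ l + splits Φ l := by
  induction l generalizing Ψ Φ with
  | nil => rfl
  | cons a l ih => simp only [splits_cons, ih]; abel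

lemma map_splits {G : Type*} [FunLike G V W] [AddMonoidHomClass G V W] (f : G)
    (Ψ : List X → List X → V) (l : List X) :
    f (splits Ψ l) = splits (fun x y => f (Ψ x y)) l := by
  induction l generalizing Ψ with
  | nil => rfl
  | cons a l ih => simp only [splits_cons, ih, map_add]

lemma splits_neg (Ψ : List X → List X → V) (l : List X) :
    splits (fun x y => -Ψ x y) l = -splits Ψ l :=
  (map_splits (-(AddMonoidHom.id V)) Ψ l).symm

lemma splits_sub (Ψ Φ : List X → List X → V) (l : List X) :
    splits (fun x y => Ψ x y - Φ x y) l = splits Ψ l - splits Φ l := by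
  simp only [sub_eq_add_neg, splits_add, splits_neg]

lemma splits_smul (c : ℤ) (Ψ : List X → List X → V) (l : List X) :
    splits (fun x y => c • Ψ x y) l = c • splits Ψ l :=
  (map_splits (DistribSMul.toAddMonoidHom V c) Ψ l).symm

lemma splits_zero (l : List X) : splits (fun _ _ => (0 : V)) l = 0 := by
  induction l with
  | nil => rfl
  | cons a l ih => simp [splits_cons, ih]

lemma splits_eq_zero {Ψ : List X → List X → V} {l : List X}
    (h : ∀ x y, x ++ y = l → Ψ x y = 0) : splits Ψ l = 0 := by
  rw [splits_congr h, splits_zero]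

lemma splits_assoc (Ψ : List X → List X → List X → V) (l : List X) :
    splits (fun x w => splits (fun y z => Ψ x y z) w) l =
      splits (fun u z => splits (fun x y => Ψ x y z) u) l := by
  induction l generalizing Ψ with
  | nil => rfl
  | cons a l ih =>
    have h := ih (fun x y z => Ψ (a :: x) y z)
    simp only [splits_cons, splits_nil, splits_add, h]
    abel

/-- Telescoping over the decompositions of a word. -/
lemma splits_telescope {P Q : List X → List X → V} (h : ∀ x d y, P x (d :: y) = Q (x ++ [d]) y)
    (l : List X) : splits (fun x y => P x y - Q x y) l = P l [] - Q [] l := by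
  induction l generalizing P Q with
  | nil => rfl
  | cons a l ih =>
    rw [splits_cons, ih (P := fun x y => P (a :: x) y) (Q := fun x y => Q (a :: x) y)
      (fun x d y => h (a :: x) d y), h [] a l]
    simp

lemma splits_append (Ψ : List X → List X → V) (u w : List X) (a : X) :
    splits Ψ (u ++ a :: w) = splits (fun x y => Ψ x (y ++ a :: w)) u +
      splits (fun x y => Ψ (u ++ a :: x) y) w := by
  induction u generalizing Ψ with
  | nil => simp [splits_cons]
  | cons b u ih => simp [splits_cons, ih, add_assoc]

lemma splits_map {Y : Type*} (s : X → Y) (Ψ : List Y → List Y → V) (l : List X) :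
    splits Ψ (l.map s) = splits (fun x y => Ψ (x.map s) (y.map s)) l := by
  induction l generalizing Ψ with
  | nil => rfl
  | cons a l ih => simp [splits_cons, ih]

lemma splits_eq_sum (Ψ : List X → List X → V) (l : List X) :
    splits Ψ l = ∑ i ∈ Finset.range (l.length + 1), Ψ (l.take i) (l.drop i) := by
  induction l generalizing Ψ with
  | nil => simp
  | cons a l ih =>
    rw [splits_cons, ih, List.length_cons, Finset.sum_range_succ' _ (l.length + 1)]
    simp [add_comm]

end Splits

/-! ### Multilinear functions on words and the bar differential -/

/-- The sign `(-1)^n`, as an integer. -/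
abbrev sgn (n : ℕ) : ℤ := (-1) ^ n

lemma sgn_succ (n : ℕ) : sgn (n + 1) = -sgn n := by simp [sgn, pow_succ]

section Bar

variable {k B M N : Type*} [CommRing k] [Ring B] [Algebra k B] [AddCommGroup M] [Module k M]
  [AddCommGroup N] [Module k N]

variable (k) in
/-- A function on words that is linear in every letter. -/
def MultiLin {B : Type*} [AddCommGroup B] [Module k B] (F : List B → M) : Prop :=
  ∀ x y : List B, IsLinearMap k fun u => F (x ++ u :: y)

lemma MultiLin.cons {F : List B → M} (hF : MultiLin k F) (a : B) :
    MultiLin k fun l => F (a :: l) := fun x y => hF (a :: x) y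

lemma MultiLin.map_add {F : List B → M} (hF : MultiLin k F) (u v : B) (y : List B) :
    F ((u + v) :: y) = F (u :: y) + F (v :: y) := (hF [] y).map_add u v

lemma MultiLin.map_neg {F : List B → M} (hF : MultiLin k F) (u : B) (y : List B) :
    F (-u :: y) = -F (u :: y) := (hF [] y).map_neg u

lemma MultiLin.map_sub {F : List B → M} (hF : MultiLin k F) (u v : B) (y : List B) :
    F ((u - v) :: y) = F (u :: y) - F (v :: y) := (hF [] y).map_sub u v

lemma MultiLin.map_smul {F : List B → M} (hF : MultiLin k F) (c : k) (u : B) (y : List B) :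
    F (c • u :: y) = c • F (u :: y) := (hF [] y).map_smul c u

lemma MultiLin.map_zero {F : List B → M} (hF : MultiLin k F) (y : List B) :
    F (0 :: y) = 0 := (hF [] y).map_zero

/-- The Hochschild coboundary of `F` without its leftmost term, with respect to a right action `ρ`.
For `ρ = 0` it is the alternating sum of all mergings of neighbouring letters. -/
def bar (ρ : M →ₗ[k] B →ₗ[k] M) : (List B → M) → List B → M
  | _, [] => 0
  | F, [a] => -ρ (F []) a
  | F, a :: b :: l => -F (a * b :: l) - bar ρ (fun l => F (a :: l)) (b :: l)

variable (ρ : M →ₗ[k] B →ₗ[k] M)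

@[simp] lemma bar_nil (F : List B → M) : bar ρ F [] = 0 := rfl

@[simp] lemma bar_one (F : List B → M) (a : B) : bar ρ F [a] = -ρ (F []) a := rfl

lemma bar_cons (F : List B → M) (a b : B) (l : List B) :
    bar ρ F (a :: b :: l) = -F (a * b :: l) - bar ρ (fun l => F (a :: l)) (b :: l) := rfl

lemma bar_add (F G : List B → M) (l : List B) :
    bar ρ (fun l => F l + G l) l = bar ρ F l + bar ρ G l := by
  induction l generalizing F G with
  | nil => simp
  | cons a l ih =>
    cases l with
    | nil => simp; abel
    | cons b l => simp only [bar_cons, ih]; abel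

lemma bar_map {ρ : M →ₗ[k] B →ₗ[k] M} {ρ' : N →ₗ[k] B →ₗ[k] N} (f : M →+ N)
    (hf : ∀ m a, f (ρ m a) = ρ' (f m) a) (F : List B → M) (l : List B) :
    bar ρ' (fun l => f (F l)) l = f (bar ρ F l) := by
  induction l generalizing F with
  | nil => simp
  | cons a l ih =>
    cases l with
    | nil => simp [hf]
    | cons b l => simp only [bar_cons, ih, map_sub, map_neg]

lemma bar_neg (F : List B → M) (l : List B) :
    bar ρ (fun l => -F l) l = -bar ρ F l :=
  bar_map (-(AddMonoidHom.id M)) (by simp) F l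

lemma bar_sub (F G : List B → M) (l : List B) :
    bar ρ (fun l => F l - G l) l = bar ρ F l - bar ρ G l := by
  simp only [sub_eq_add_neg, bar_add, bar_neg]

lemma bar_zsmul (c : ℤ) (F : List B → M) (l : List B) :
    bar ρ (fun l => c • F l) l = c • bar ρ F l :=
  bar_map (DistribSMul.toAddMonoidHom M c) (by simp) F l

lemma bar_zero (l : List B) : bar ρ (fun _ => (0 : M)) l = 0 := by
  simpa using bar_zsmul ρ 0 (fun _ => (0 : M)) l

lemma bar_congr {F G : List B → M} {n : ℕ} (h : ∀ l, l.length = n → F l = G l) {l : List B}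
    (hl : l.length = n + 1) : bar ρ F l = bar ρ G l := by
  induction l generalizing F G n with
  | nil => simp at hl
  | cons a l ih =>
    cases l with
    | nil => simp_all
    | cons b l =>
      obtain ⟨n, rfl⟩ : ∃ m, n = m + 1 := ⟨l.length, by simpa using hl.symm⟩
      rw [bar_cons, bar_cons, h _ (by simpa using hl),
        ih (n := n) (fun l hl => h _ (by simpa using hl)) (by simpa using hl)]

lemma bar_length_smul (s : ℕ → ℤ) (F : List B → M) (l : List B) :
    bar ρ (fun l => s l.length • F l) l = s (l.length - 1) • bar ρ F l := by
  cases l with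
  | nil => simp
  | cons a l =>
    rw [← bar_zsmul]
    exact bar_congr ρ (n := l.length) (fun l' h => by simp [h]) rfl

lemma isLinearMap_add {P Q : N → M} (hP : IsLinearMap k P) (hQ : IsLinearMap k Q) :
    IsLinearMap k fun u => P u + Q u :=
  ((hP.mk' P) + (hQ.mk' Q)).isLinear

lemma isLinearMap_neg {P : N → M} (hP : IsLinearMap k P) : IsLinearMap k fun u => -P u :=
  (-(hP.mk' P)).isLinear

lemma isLinearMap_sub {P Q : N → M} (hP : IsLinearMap k P) (hQ : IsLinearMap k Q) :
    IsLinearMap k fun u => P u - Q u :=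
  ((hP.mk' P) - (hQ.mk' Q)).isLinear

lemma isLinearMap_comp {L : Type*} [AddCommGroup L] [Module k L] {P : N → M} {Q : L → N}
    (hP : IsLinearMap k P) (hQ : IsLinearMap k Q) : IsLinearMap k fun u => P (Q u) :=
  ((hP.mk' P) ∘ₗ (hQ.mk' Q)).isLinear

lemma isLinearMap_zsmul (c : ℤ) {P : N → M} (hP : IsLinearMap k P) :
    IsLinearMap k fun u => c • P u := (c • (hP.mk' P)).isLinear

lemma MultiLin.bar {F : List B → M} (hF : MultiLin k F) : MultiLin k (bar ρ F) := by
  intro x y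
  induction x generalizing F with
  | nil =>
    cases y with
    | nil => exact isLinearMap_neg (ρ (F [])).isLinear
    | cons b y =>
      have h1 : IsLinearMap k fun u => F (u * b :: y) :=
        isLinearMap_comp (P := fun u => F (u :: y)) (hF [] y) ((LinearMap.mul k B).flip b).isLinear
      have h2 : IsLinearMap k fun u => Word.bar ρ (fun l => F (u :: l)) (b :: y) := by
        refine ⟨fun u v => ?_, fun c u => ?_⟩
        · simp only [hF.map_add, bar_add]
        · simp only [hF.map_smul]
          exact bar_map (DistribSMul.toAddMonoidHom M c) (by simp) _ _
      exact isLinearMap_sub (isLinearMap_neg h1) h2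
  | cons a x ih =>
    cases x with
    | nil =>
      have h1 : IsLinearMap k fun u => F (a * u :: y) :=
        isLinearMap_comp (P := fun u => F (u :: y)) (hF [] y) ((LinearMap.mul k B) a).isLinear
      exact isLinearMap_sub (isLinearMap_neg h1) (ih (hF.cons a))
    | cons b x =>
      exact isLinearMap_sub (isLinearMap_neg (hF (a * b :: x) y)) (ih (hF.cons a))

lemma isLinearMap_splits {X : Type*} {Ψ : N → List X → List X → M}
    (h : ∀ x y, IsLinearMap k fun u => Ψ u x y) (l : List X) :
    IsLinearMap k fun u => splits (Ψ u) l := by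
  induction l generalizing Ψ with
  | nil => exact h [] []
  | cons a l ih => exact isLinearMap_add (h _ _) (ih fun x y => h (a :: x) y)

lemma MultiLin.splits {Ψ : List B → List B → M} (h1 : ∀ y, MultiLin k fun x => Ψ x y)
    (h2 : ∀ x, MultiLin k (Ψ x)) : MultiLin k (splits Ψ) := by
  intro x y
  simp only [splits_append]
  exact isLinearMap_add (isLinearMap_splits (fun s t => h2 s t y) x)
    (isLinearMap_splits (fun s t => h1 t x s) y)

/-- Two neighbouring letters that are merged before a word is split lie both in the first or both in
the second part of the splitting. -/
lemma bar_splits (G : List B → List B → M) (l : List B) :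
    bar ρ (splits G) l = splits (fun v z => bar (0 : M →ₗ[k] B →ₗ[k] M) (fun v => G v z) v +
      sgn v.length • bar ρ (G v) z) l := by
  induction l generalizing G with
  | nil => simp
  | cons a l ih =>
    cases l with
    | nil => simp [splits_cons]
    | cons b l =>
      have h := ih (fun x y => G (a :: x) y)
      have h2 : bar ρ (fun l => splits G (a :: l)) (b :: l) =
          bar ρ (fun l => G [] (a :: l)) (b :: l) +
          bar ρ (splits fun x y => G (a :: x) y) (b :: l) := bar_add ρ _ _ _
      rw [bar_cons, h2, h]
      simp only [splits_cons, bar_nil, bar_one, bar_cons, List.length_cons, sgn_succ,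
        List.length_nil, neg_smul, splits_add, splits_sub, splits_neg, pow_zero, one_smul]
      simp only [LinearMap.zero_apply, neg_zero, zero_add]
      abel

/-- `(-1)^(|l|+1) g(l)`: the form that `g` takes when it moves past one letter. -/
def pr (g : List B → M) (l : List B) : M := sgn (l.length + 1) • g l

lemma pr_cons (g : List B → M) (a : B) (l : List B) :
    pr g (a :: l) = -pr (fun l => g (a :: l)) l := by
  simp [pr, pow_succ]

lemma pr_nil (g : List B → M) : pr g [] = -g [] := by simp [pr]

@[simp] lemma pr_pr (g : List B → M) : pr (pr g) = g := by
  funext l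
  simp [pr, smul_smul, ← mul_pow]

end Bar

end Word
end HomAssoc

namespace HomAssoc

namespace Word

/-! ### The Hochschild coboundary, insertions and products -/

section Insertion

variable {k B M N : Type*} [CommRing k] [Ring B] [Algebra k B] [AddCommGroup M] [Module k M]
  [AddCommGroup N] [Module k N]

/-- The Hochschild coboundary of a function on words in `B` with values in `B`. -/
def cob (k : Type*) {B : Type*} [CommRing k] [Ring B] [Algebra k B] (F : List B → B) : List B → B
  | [] => 0
  | a :: l => a * F l + bar (LinearMap.mul k B) F (a :: l)

@[simp] lemma cob_nil (F : List B → B) : cob k F [] = 0 := rfl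

lemma cob_cons (F : List B → B) (a : B) (l : List B) :
    cob k F (a :: l) = a * F l + bar (LinearMap.mul k B) F (a :: l) := rfl

/-- The part of `ins g F` in which `g` takes the first letters of the word. -/
def insHead (g : List B → B) (F : List B → M) (l : List B) : M := splits (fun v z => F (g v :: z)) l

/-- The sum of all insertions of `g` in `F`, that is, of `± F (x ++ g v :: z)` over the
decompositions `x ++ v ++ z` of a word, where `g` changes by `pr` when it passes a letter. -/
def ins : (List B → B) → (List B → M) → List B → M
  | g, F, [] => insHead g F []
  | g, F, a :: l => insHead g F (a :: l) + ins (pr g) (fun l => F (a :: l)) l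

/-- The part of `ins g F` in which `g` does not take the first letters of the word. -/
def insTail (g : List B → B) (F : List B → M) : List B → M
  | [] => 0
  | a :: l => ins (pr g) (fun l => F (a :: l)) l

lemma ins_eq (g : List B → B) (F : List B → M) (l : List B) :
    ins g F l = insHead g F l + insTail g F l := by
  cases l <;> simp [ins, insTail]

lemma insHead_nil (g : List B → B) (F : List B → M) : insHead g F [] = F [g []] := rfl

lemma insHead_cons (g : List B → B) (F : List B → M) (a : B) (l : List B) :
    insHead g F (a :: l) = F (g [] :: a :: l) + insHead (fun l => g (a :: l)) F l := rfl

lemma ins_cons (g : List B → B) (F : List B → M) (a : B) (l : List B) :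
    ins g F (a :: l) = insHead g F (a :: l) + ins (pr g) (fun l => F (a :: l)) l := rfl

lemma insHead_map (f : M →+ N) (g : List B → B) (F : List B → M) (l : List B) :
    insHead g (fun l => f (F l)) l = f (insHead g F l) := by
  simp [insHead, map_splits]

lemma ins_map (f : M →+ N) (g : List B → B) (F : List B → M) (l : List B) :
    ins g (fun l => f (F l)) l = f (ins g F l) := by
  induction l generalizing g F with
  | nil => simp [ins, insHead_map]
  | cons a l ih => rw [ins_cons, ins_cons, ih, insHead_map, map_add]

lemma insHead_add (g : List B → B) (F G : List B → M) (l : List B) :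
    insHead g (fun l => F l + G l) l = insHead g F l + insHead g G l := splits_add _ _ l

lemma ins_add (g : List B → B) (F G : List B → M) (l : List B) :
    ins g (fun l => F l + G l) l = ins g F l + ins g G l := by
  induction l generalizing g F G with
  | nil => rfl
  | cons a l ih => simp only [ins_cons, ih, insHead_add]; abel

lemma ins_neg (g : List B → B) (F : List B → M) (l : List B) :
    ins g (fun l => -F l) l = -ins g F l := ins_map (-(AddMonoidHom.id M)) g F l

lemma ins_sub (g : List B → B) (F G : List B → M) (l : List B) :
    ins g (fun l => F l - G l) l = ins g F l - ins g G l := by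
  simp only [sub_eq_add_neg, ins_add, ins_neg]

lemma ins_zsmul (c : ℤ) (g : List B → B) (F : List B → M) (l : List B) :
    ins g (fun l => c • F l) l = c • ins g F l := ins_map (DistribSMul.toAddMonoidHom M c) g F l

lemma pr_add (g h : List B → M) : pr (fun l => g l + h l) = fun l => pr g l + pr h l := by
  funext l; simp [pr]

lemma pr_neg (g : List B → M) : pr (fun l => -g l) = fun l => -pr g l := by
  funext l; simp [pr]

lemma insHead_add_left {F : List B → M} (hF : MultiLin k F) (g h : List B → B) (l : List B) :
    insHead (fun l => g l + h l) F l = insHead g F l + insHead h F l := by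
  simp only [insHead, hF.map_add, splits_add]

lemma insHead_neg_left {F : List B → M} (hF : MultiLin k F) (g : List B → B) (l : List B) :
    insHead (fun l => -g l) F l = -insHead g F l := by
  simp only [insHead, hF.map_neg, splits_neg]

lemma insHead_sub_left {F : List B → M} (hF : MultiLin k F) (g h : List B → B) (l : List B) :
    insHead (fun l => g l - h l) F l = insHead g F l - insHead h F l := by
  simp only [insHead, hF.map_sub, splits_sub]

lemma ins_add_left {F : List B → M} (hF : MultiLin k F) (g h : List B → B) (l : List B) :
    ins (fun l => g l + h l) F l = ins g F l + ins h F l := by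
  induction l generalizing g h F with
  | nil => exact insHead_add_left hF g h []
  | cons a l ih =>
    simp only [ins_cons, pr_add, ih (hF.cons a), insHead_add_left hF]; abel

lemma ins_neg_left {F : List B → M} (hF : MultiLin k F) (g : List B → B) (l : List B) :
    ins (fun l => -g l) F l = -ins g F l := by
  induction l generalizing g F with
  | nil => exact insHead_neg_left hF g []
  | cons a l ih => simp only [ins_cons, pr_neg, ih (hF.cons a), insHead_neg_left hF]; abel

lemma ins_zero_left {F : List B → M} (hF : MultiLin k F) (l : List B) :
    ins (fun _ => (0 : B)) F l = 0 := by
  have h := ins_add_left hF (fun _ => 0) (fun _ => 0) l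
  simpa using h

lemma bar_insHead (ρ : M →ₗ[k] B →ₗ[k] M) {F : List B → M} (hF : MultiLin k F) (g : List B → B)
    (l : List B) : bar ρ (insHead g F) l = insHead (bar (LinearMap.mul k B) g) F l +
      insHead (pr g) (bar ρ F) l + ρ (F []) (pr g l) := by
  induction l generalizing g with
  | nil => simp [insHead_nil, hF.map_zero]
  | cons a l ih =>
    cases l with
    | nil =>
      simp only [bar_one, insHead_nil, insHead_cons, bar_nil, hF.map_zero, pr_nil, pr_cons,
        LinearMap.mul_apply', bar_cons, map_neg, hF.map_neg, neg_mul, neg_neg, LinearMap.neg_apply]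
      abel
    | cons b l =>
      have h1 : bar ρ (fun l => insHead g F (a :: l)) (b :: l) =
          bar ρ (fun l => F (g [] :: a :: l)) (b :: l) +
          bar ρ (insHead (fun l => g (a :: l)) F) (b :: l) := bar_add ρ _ _ _
      rw [bar_cons, h1, ih]
      simp only [insHead_cons, insHead_neg_left hF, insHead_sub_left hF, bar_cons,
        pr_nil, bar_one, LinearMap.mul_apply', hF.map_zero, bar_nil, neg_mul, hF.map_neg,
        bar_neg, pr_cons]
      have h3 := insHead_neg_left (hF.bar ρ)
      simp only [h3, map_neg, neg_neg]
      abel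

/-- The product of `F` and `g` with respect to a right action `ρ`, with the sign that `g` takes when
it passes the letters of `F` and one more letter. -/
def cupR (ρ : M →ₗ[k] B →ₗ[k] M) (F : List B → M) (g : List B → B) : List B → M :=
  splits fun x y => sgn (y.length * (x.length + 1)) • ρ (F x) (g y)

lemma cupR_nil (ρ : M →ₗ[k] B →ₗ[k] M) (F : List B → M) (g : List B → B) :
    cupR ρ F g [] = -ρ (F []) (pr g []) := by simp [cupR, pr]

lemma sgn_congr {m n : ℕ} (h : Even (m + n)) : sgn m = sgn n := by
  rcases Nat.even_or_odd n with hn | hn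
  · rw [sgn, sgn, hn.neg_one_pow, ((Nat.even_add.1 h).2 hn).neg_one_pow]
  · have hm : Odd m := by
      rw [← Nat.not_even_iff_odd] at hn ⊢
      rwa [Nat.even_add.1 h]
    rw [sgn, sgn, hn.neg_one_pow, hm.neg_one_pow]

lemma sgn_neg_congr {m n : ℕ} (h : Odd (m + n)) : sgn m = -sgn n := by
  rw [← sgn_succ]
  exact sgn_congr (by rw [← add_assoc]; exact h.add_one)

lemma cupR_cons (ρ : M →ₗ[k] B →ₗ[k] M) (F : List B → M) (g : List B → B) (a : B) (l : List B) :
    cupR ρ F g (a :: l) = -ρ (F []) (pr g (a :: l)) - cupR ρ (fun l => F (a :: l)) (pr g) l := by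
  simp only [cupR, splits_cons, pr, List.length_cons, List.length_nil]
  rw [sub_eq_add_neg, ← splits_neg]
  congr 1
  · rw [sgn_succ (l.length + 1), map_zsmul, neg_smul, neg_neg]
    simp
  · refine splits_congr fun x y _ => ?_
    rw [map_zsmul, smul_smul, ← neg_smul]
    congr 1
    simp only [sgn]
    ring

/-- The result of merging `a` with the first letter of a word, or with `F` if there is none. -/
def mergeFirst (ρ : M →ₗ[k] B →ₗ[k] M) (F : List B → M) (a : B) : List B → M
  | [] => ρ (F []) a
  | b :: l => F (a * b :: l)

lemma bar_tail (ρ : M →ₗ[k] B →ₗ[k] M) (F : List B → M) (a : B) (l : List B) :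
    bar ρ F (a :: l) = -mergeFirst ρ F a l - bar ρ (fun l => F (a :: l)) l := by
  cases l <;> simp [mergeFirst, bar_cons]

lemma pr_cob (g : List B → B) : pr (cob k g) = fun l => -cob k (pr g) l := by
  funext l
  cases l with
  | nil => simp [pr]
  | cons a l =>
    have h := bar_length_smul (LinearMap.mul k B) (fun n => sgn (n + 1)) g (a :: l)
    simp only [List.length_cons, Nat.add_sub_cancel] at h
    change _ = -(a * pr g l + bar (LinearMap.mul k B) (fun l => sgn (l.length + 1) • g l) (a :: l))
    rw [h]
    simp only [pr, cob_cons, List.length_cons, sgn_succ (l.length + 1), neg_smul, smul_add,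
      mul_smul_comm, neg_add]

/-- The coboundary of an insertion: up to the coboundaries of `F` and `g`, there remain only the
terms in which `g` takes the last letters of the word and is the factor on the right. -/
lemma bar_ins (ρ : M →ₗ[k] B →ₗ[k] M) {F : List B → M} (hF : MultiLin k F) (g : List B → B)
    (l : List B) : bar ρ (ins g F) l = ins (pr g) (bar ρ F) l + ins (cob k g) F l -
      cupR ρ F g l := by
  induction l generalizing g F with
  | nil => simp [ins, insHead_nil, hF.map_zero, cupR_nil]
  | cons a l ih =>
    have h0 : bar ρ (ins g F) (a :: l) = bar ρ (insHead g F) (a :: l) +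
        bar ρ (insTail g F) (a :: l) := by
      rw [← bar_add]; congr 1; funext l; exact ins_eq g F l
    have h1 : bar ρ (insTail g F) (a :: l) = -insTail g (mergeFirst ρ F a) l -
        bar ρ (ins (pr g) (fun l => F (a :: l))) l := by
      cases l with
      | nil => simp [insTail]
      | cons b l => rfl
    have h2 : insTail g (mergeFirst ρ F a) l = ins g (mergeFirst ρ F a) l -
        insHead (fun v => a * g v) F l := by
      have h : insHead g (mergeFirst ρ F a) l = insHead (fun v => a * g v) F l := rfl
      rw [ins_eq, h]; abel
    have h3 : insHead (cob k g) F (a :: l) = insHead (fun v => a * g v) F l +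
        insHead (bar (LinearMap.mul k B) g) F (a :: l) := by
      simp only [insHead_cons, cob_nil, cob_cons, hF.map_zero, bar_nil, insHead_add_left hF]
      abel
    rw [h0, h1, h2, ih (hF.cons a), bar_insHead ρ hF, ins_cons, ins_cons, pr_cob, pr_pr, h3,
      ins_neg_left (hF.cons a), cupR_cons]
    simp only [bar_tail ρ F a, ins_sub, ins_neg]
    abel

/-- Multiplication of the value by the first letter. -/
def lmul (F : List B → B) : List B → B
  | [] => 0
  | a :: l => a * F l

lemma cob_eq (F : List B → B) (l : List B) :
    cob k F l = lmul F l + bar (LinearMap.mul k B) F l := by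
  cases l <;> simp [lmul, cob]

/-- The product of cochains, given by the concatenation of words. -/
def conc (F G : List B → B) : List B → B := splits fun x y => F x * G y

lemma conc_nil (F G : List B → B) : conc F G [] = F [] * G [] := rfl

lemma conc_cons (F G : List B → B) (a : B) (l : List B) :
    conc F G (a :: l) = F [] * G (a :: l) + conc (fun l => F (a :: l)) G l := rfl

lemma conc_add_left (F F' G : List B → B) (l : List B) :
    conc (fun l => F l + F' l) G l = conc F G l + conc F' G l := by
  simp only [conc, add_mul, splits_add]

lemma conc_neg_left (F G : List B → B) (l : List B) :
    conc (fun l => -F l) G l = -conc F G l := by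
  simp only [conc, neg_mul, splits_neg]

lemma conc_sub_left (F F' G : List B → B) (l : List B) :
    conc (fun l => F l - F' l) G l = conc F G l - conc F' G l := by
  simp only [conc, sub_mul, splits_sub]

lemma conc_mul_left (b : B) (F G : List B → B) (l : List B) :
    conc (fun l => b * F l) G l = b * conc F G l := by
  simp only [conc, mul_assoc]
  exact (map_splits (AddMonoidHom.mulLeft b) (fun x y => F x * G y) l).symm

lemma conc_assoc (F G H : List B → B) : conc (conc F G) H = conc F (conc G H) := by
  funext l
  have h1 : ∀ (x z : List B), splits (fun y w => F y * G w) x * H z =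
      splits (fun y w => F y * G w * H z) x := fun x z =>
    map_splits (AddMonoidHom.mulRight (H z)) _ x
  have h2 : ∀ (x z : List B), F x * splits (fun y w => G y * H w) z =
      splits (fun y w => F x * (G y * H w)) z := fun x z =>
    map_splits (AddMonoidHom.mulLeft (F x)) _ z
  simp only [conc, h1, h2, ← splits_assoc, mul_assoc]

lemma ins_lmul (g F : List B → B) (l : List B) :
    ins g (lmul F) l = conc g F l + lmul (ins (pr g) F) l := by
  cases l with
  | nil => simp [ins, insHead_nil, lmul, conc_nil]
  | cons a l =>
    rw [ins_cons]
    congr 1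
    exact ins_map (AddMonoidHom.mulLeft a) (pr g) F l

/-- Insertion is the homotopy for the commutativity of the product on cohomology. -/
lemma cob_ins {F : List B → B} (hF : MultiLin k F) (g : List B → B)
    (l : List B) : cob k (ins g F) l = ins (pr g) (cob k F) l + ins (cob k g) F l -
      conc (pr g) F l - cupR (LinearMap.mul k B) F g l := by
  have h : ins (pr g) (cob k F) l = ins (pr g) (lmul F) l +
      ins (pr g) (bar (LinearMap.mul k B) F) l := by
    rw [← ins_add]; congr 1; funext l; exact cob_eq F l
  rw [h, ins_lmul, pr_pr, cob_eq, bar_ins _ hF]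
  abel

lemma bar_mergeFirst {ρ : M →ₗ[k] B →ₗ[k] M} (hρ : ∀ m a b, ρ (ρ m a) b = ρ m (a * b))
    (F : List B → M) (a : B) (l : List B) :
    bar ρ (mergeFirst ρ F a) l = mergeFirst ρ (bar ρ F) a l := by
  cases l with
  | nil => simp [mergeFirst]
  | cons b l =>
    rw [bar_tail]
    change _ = bar ρ F (a * b :: l)
    rw [bar_tail]
    congr 2
    cases l with
    | nil => exact hρ _ _ _
    | cons c l => simp [mergeFirst, mul_assoc]

lemma bar_bar {ρ : M →ₗ[k] B →ₗ[k] M} (hρ : ∀ m a b, ρ (ρ m a) b = ρ m (a * b))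
    (F : List B → M) (l : List B) : bar ρ (bar ρ F) l = 0 := by
  induction l generalizing F with
  | nil => rfl
  | cons a l ih =>
    rw [bar_tail]
    simp only [bar_tail ρ F a, bar_sub, bar_neg, ih, bar_mergeFirst hρ]
    abel

lemma bar_lmul (F : List B → B) (l : List B) : bar (LinearMap.mul k B) (lmul F) l =
    -lmul (lmul F) l - lmul (bar (LinearMap.mul k B) F) l := by
  cases l with
  | nil => simp [lmul]
  | cons a l =>
    have h : bar (LinearMap.mul k B) (fun l => a * F l) l = a * bar (LinearMap.mul k B) F l :=
      bar_map (AddMonoidHom.mulLeft a) (by simp [mul_assoc]) F l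
    rw [bar_tail]
    change -_ - bar (LinearMap.mul k B) (fun l => a * F l) l = _
    rw [h]
    cases l with
    | nil => simp [lmul, mergeFirst]
    | cons b l => simp [lmul, mergeFirst, mul_assoc]

lemma cob_cob (F : List B → B) (l : List B) : cob k (cob k F) l = 0 := by
  have h : cob k F = fun l => lmul F l + bar (LinearMap.mul k B) F l := funext (cob_eq F)
  rw [cob_eq, h, bar_add, bar_bar (by simp [mul_assoc]), bar_lmul]
  cases l <;> simp [lmul, mul_add]

lemma cob_conc (F G : List B → B) (l : List B) :
    cob k (conc F G) l = conc (cob k F) G l - conc (pr F) (cob k G) l := by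
  have h : ∀ (F : List B → B), bar (LinearMap.mul k B) (conc F G) l =
      conc (bar (LinearMap.mul k B) F) G l - conc (pr F) (cob k G) l := by
    induction l with
    | nil => simp [conc_nil]
    | cons a l ih =>
      intro F
      have h1 : bar (LinearMap.mul k B) (fun l => F [] * G (a :: l)) l =
          F [] * bar (LinearMap.mul k B) (fun l => G (a :: l)) l :=
        bar_map (AddMonoidHom.mulLeft (F [])) (by simp [mul_assoc]) _ l
      have h2 : mergeFirst (LinearMap.mul k B) (conc F G) a l =
          conc (mergeFirst (LinearMap.mul k B) F a) G l - F [] * a * G l +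
            F [] * mergeFirst (LinearMap.mul k B) G a l := by
        cases l with
        | nil => simp [mergeFirst, conc_nil, mul_assoc]
        | cons b l => simp [mergeFirst, conc_cons]; abel
      simp only [bar_tail _ _ a, conc_cons, bar_add, h1, ih, h2, conc_sub_left, conc_neg_left,
        pr_nil, pr_cons, cob_cons, bar_nil]
      noncomm_ring
  have h2 : lmul (conc F G) l = conc (lmul F) G l := by
    cases l with
    | nil => simp [lmul, conc_nil]
    | cons a l =>
      rw [conc_cons]
      simp [lmul, conc_mul_left]
  have h3 : cob k F = fun l => lmul F l + bar (LinearMap.mul k B) F l := funext (cob_eq F)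
  rw [cob_eq, h, h2, h3, conc_add_left]
  abel

/-- The form that `g` takes when it moves past `n` letters. -/
def prn (n : ℕ) (g : List B → M) (l : List B) : M := sgn (n * (l.length + 1)) • g l

@[simp] lemma prn_zero (g : List B → M) : prn 0 g = g := by funext l; simp [prn]

lemma prn_succ (n : ℕ) (g : List B → M) : prn (n + 1) g = prn n (pr g) := by
  funext l
  simp only [prn, pr, smul_smul]
  congr 1
  simp only [sgn]; ring

lemma pr_prn (n : ℕ) (g : List B → M) : pr (prn n g) = prn (n + 1) g := by
  funext l
  simp only [prn, pr, smul_smul]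
  congr 1
  simp only [sgn]; ring

/-- Insertion in a product is insertion in one of the two factors. -/
lemma ins_conc (h F G : List B → B) (l : List B) :
    ins h (conc F G) l = conc (ins h F) G l +
      splits (fun x y => F x * ins (prn x.length h) G y) l := by
  have head : ∀ (h F : List B → B) (l : List B),
      insHead h (conc F G) l = F [] * insHead h G l + conc (insHead h F) G l := by
    intro h F l
    have h1 : ∀ (x z : List B), splits (fun y w => F (h y :: w)) x * G z =
        splits (fun y w => F (h y :: w) * G z) x := fun x z =>
      map_splits (AddMonoidHom.mulRight (G z)) _ x
    have h2 : F [] * insHead h G l = splits (fun v z => F [] * G (h v :: z)) l :=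
      map_splits (AddMonoidHom.mulLeft (F [])) _ l
    rw [h2]
    simp only [conc, insHead, h1, ← splits_assoc, ← splits_add]
    rfl
  induction l generalizing h F with
  | nil => simp [ins, head, conc_nil]; abel
  | cons a l ih =>
    have h1 : conc (ins h F) G (a :: l) = conc (insHead h F) G (a :: l) +
        conc (ins (pr h) fun l => F (a :: l)) G l := by
      have : ins h F = fun l => insHead h F l + insTail h F l := funext (ins_eq h F)
      rw [this, conc_add_left]
      congr 1
      rw [conc_cons]
      simp [insTail]
    have h2 : ins (pr h) (fun l => F [] * G (a :: l)) l =
        F [] * ins (pr h) (fun l => G (a :: l)) l :=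
      ins_map (AddMonoidHom.mulLeft (F [])) _ _ l
    simp only [ins_cons, conc_cons, ins_add, h1, h2, ih, head, splits_cons, List.length_nil,
      prn_zero, List.length_cons, prn_succ, mul_add]
    abel

end Insertion
end Word
end HomAssoc

namespace HomAssoc

namespace Word

/-! ### Double insertions -/

section Brace

variable {k B M N : Type*} [CommRing k] [Ring B] [Algebra k B] [AddCommGroup M] [Module k M]
  [AddCommGroup N] [Module k N]

lemma MultiLin.add {F G : List B → M} (hF : MultiLin k F) (hG : MultiLin k G) :
    MultiLin k fun l => F l + G l := fun x y => isLinearMap_add (hF x y) (hG x y)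

lemma MultiLin.neg {F : List B → M} (hF : MultiLin k F) : MultiLin k fun l => -F l :=
  fun x y => isLinearMap_neg (hF x y)

lemma MultiLin.sub {F G : List B → M} (hF : MultiLin k F) (hG : MultiLin k G) :
    MultiLin k fun l => F l - G l := fun x y => isLinearMap_sub (hF x y) (hG x y)

lemma MultiLin.comp {F : List B → M} (hF : MultiLin k F) (f : M →ₗ[k] N) :
    MultiLin k fun l => f (F l) := fun x y => isLinearMap_comp f.isLinear (hF x y)

lemma MultiLin.length_smul {F : List B → M} (hF : MultiLin k F) (s : ℕ → ℤ) :
    MultiLin k fun l => s l.length • F l := fun x y => by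
  simpa using isLinearMap_zsmul (s (x.length + (y.length + 1))) (hF x y)

lemma MultiLin.pr {F : List B → M} (hF : MultiLin k F) : MultiLin k (pr F) :=
  hF.length_smul fun n => sgn (n + 1)

lemma MultiLin.conc {F G : List B → B} (hF : MultiLin k F) (hG : MultiLin k G) :
    MultiLin k (conc F G) :=
  MultiLin.splits (fun y => hF.comp (LinearMap.mulRight k (G y)))
    fun x => hG.comp (LinearMap.mulLeft k (F x))

lemma MultiLin.insHead {F : List B → M} (hF : MultiLin k F) {g : List B → B}
    (hg : MultiLin k g) : MultiLin k (insHead g F) :=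
  MultiLin.splits (fun z x y => isLinearMap_comp (P := fun u => F (u :: z)) (hF [] z) (hg x y))
    fun _ => hF.cons _

lemma isLinearMap_ins {Y : N → List B → M} (g : List B → B)
    (h : ∀ l, IsLinearMap k fun u => Y u l) (l : List B) :
    IsLinearMap k fun u => ins g (Y u) l := by
  induction l generalizing g Y with
  | nil => exact h _
  | cons a l ih =>
    exact isLinearMap_add (isLinearMap_splits (fun v z => h (g v :: z)) _)
      (ih (pr g) fun l => h (a :: l))

lemma MultiLin.ins {F : List B → M} (hF : MultiLin k F) {g : List B → B}
    (hg : MultiLin k g) : MultiLin k (ins g F) := by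
  intro x y
  induction x generalizing F g with
  | nil =>
    exact isLinearMap_add (hF.insHead hg [] y)
      (isLinearMap_ins (Word.pr g) (Y := fun u l => F (u :: l)) (fun l => hF [] l) y)
  | cons a x ih =>
    exact isLinearMap_add (hF.insHead hg (a :: x) y) (ih (hF.cons a) hg.pr)

lemma MultiLin.insTail {F : List B → M} (hF : MultiLin k F) {g : List B → B}
    (hg : MultiLin k g) : MultiLin k (insTail g F) := by
  intro x y
  cases x with
  | nil => exact isLinearMap_ins (Word.pr g) (Y := fun u l => F (u :: l)) (fun l => hF [] l) y
  | cons a x => exact (hF.cons a).ins hg.pr x y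

/-- The sum of all `± F (x ++ g v :: y ++ h w :: z)`, with `g` in front of `h`, over the
decompositions of a word into `x ++ v ++ y ++ w ++ z`. The sign of `h` does not take account of
the letters of `v`. -/
def ins₂ : (List B → B) → (List B → B) → (List B → M) → List B → M
  | g, h, F, [] => insHead g (insTail (pr h) F) []
  | g, h, F, a :: l => insHead g (insTail (pr h) F) (a :: l) +
      ins₂ (pr g) (pr h) (fun l => F (a :: l)) l

lemma ins₂_cons (g h : List B → B) (F : List B → M) (a : B) (l : List B) :
    ins₂ g h F (a :: l) = insHead g (insTail (pr h) F) (a :: l) +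
      ins₂ (pr g) (pr h) (fun l => F (a :: l)) l := rfl

/-- The part of `ins₂ g h F` in which `g` does not take the first letters of the word. -/
def insTail₂ (g h : List B → B) (F : List B → M) : List B → M
  | [] => 0
  | a :: l => ins₂ (pr g) (pr h) (fun l => F (a :: l)) l

lemma ins₂_eq (g h : List B → B) (F : List B → M) (l : List B) :
    ins₂ g h F l = insHead g (insTail (pr h) F) l + insTail₂ g h F l := by
  cases l <;> simp [ins₂, insTail₂]

lemma insTail_map (f : M →+ N) (g : List B → B) (F : List B → M) (l : List B) :
    insTail g (fun l => f (F l)) l = f (insTail g F l) := by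
  cases l with
  | nil => simp [insTail]
  | cons a l => exact ins_map f _ _ _

lemma insTail_add (g : List B → B) (F G : List B → M) (l : List B) :
    insTail g (fun l => F l + G l) l = insTail g F l + insTail g G l := by
  cases l with
  | nil => simp [insTail]
  | cons a l => exact ins_add _ _ _ _

lemma ins₂_add (g h : List B → B) (F G : List B → M) (l : List B) :
    ins₂ g h (fun l => F l + G l) l = ins₂ g h F l + ins₂ g h G l := by
  induction l generalizing g h F G with
  | nil => exact insTail_add (pr h) F G [g []]
  | cons a l ih =>
    have : insTail (pr h) (fun l => F l + G l) = fun l => insTail (pr h) F l + insTail (pr h) G l :=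
      funext (insTail_add _ _ _)
    simp only [ins₂_cons, ih, this, insHead_add]; abel

lemma ins₂_map (f : M →+ N) (g h : List B → B) (F : List B → M) (l : List B) :
    ins₂ g h (fun l => f (F l)) l = f (ins₂ g h F l) := by
  induction l generalizing g h F with
  | nil => exact insTail_map f (pr h) F [g []]
  | cons a l ih =>
    have : insTail (pr h) (fun l => f (F l)) = fun l => f (insTail (pr h) F l) :=
      funext (insTail_map _ _ _)
    simp only [ins₂_cons, ih, this, insHead_map, map_add]

lemma ins₂_neg (g h : List B → B) (F : List B → M) (l : List B) :
    ins₂ g h (fun l => -F l) l = -ins₂ g h F l := ins₂_map (-(AddMonoidHom.id M)) g h F l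

lemma ins₂_sub (g h : List B → B) (F G : List B → M) (l : List B) :
    ins₂ g h (fun l => F l - G l) l = ins₂ g h F l - ins₂ g h G l := by
  simp only [sub_eq_add_neg, ins₂_add, ins₂_neg]

lemma isLinearMap_ins₂ {Y : N → List B → M} (g h : List B → B)
    (hY : ∀ l, IsLinearMap k fun u => Y u l) (l : List B) :
    IsLinearMap k fun u => ins₂ g h (Y u) l := by
  have key : ∀ (h : List B → B) (l : List B), IsLinearMap k fun u => insTail h (Y u) l := by
    intro h l
    cases l with
    | nil => exact (0 : N →ₗ[k] M).isLinear
    | cons a l => exact isLinearMap_ins _ (fun l => hY (a :: l)) l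
  induction l generalizing g h Y with
  | nil => exact key (pr h) [g []]
  | cons a l ih =>
    refine isLinearMap_add (isLinearMap_splits (fun v z => key _ (g v :: z)) _)
      (ih (pr g) (pr h) (fun l => hY (a :: l)) fun h l => ?_)
    cases l with
    | nil => exact (0 : N →ₗ[k] M).isLinear
    | cons b l => exact isLinearMap_ins _ (fun l => hY (a :: b :: l)) l

lemma MultiLin.ins₂ {F : List B → M} (hF : MultiLin k F) {g h : List B → B}
    (hg : MultiLin k g) (hh : MultiLin k h) : MultiLin k (ins₂ g h F) := by
  intro x y
  induction x generalizing F g h with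
  | nil =>
    exact isLinearMap_add ((hF.insTail hh.pr).insHead hg [] y)
      (isLinearMap_ins₂ (Word.pr g) (Word.pr h) (Y := fun u l => F (u :: l)) (fun l => hF [] l) y)
  | cons a x ih =>
    exact isLinearMap_add ((hF.insTail hh.pr).insHead hg (a :: x) y) (ih (hF.cons a) hg.pr hh.pr)

lemma bar_insTail (ρ : M →ₗ[k] B →ₗ[k] M) (F : List B → M) (g : List B → B) (a : B) (l : List B) :
    bar ρ (insTail g F) (a :: l) = -(ins g (mergeFirst ρ F a) l - insHead (fun v => a * g v) F l) -
        bar ρ (ins (pr g) (fun l => F (a :: l))) l := by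
  have h : insHead g (mergeFirst ρ F a) l = insHead (fun v => a * g v) F l := rfl
  rw [ins_eq, h]
  cases l with
  | nil => simp [insTail]
  | cons b l => rw [bar_tail]; simp [mergeFirst, insTail]

/-- The terms of the coboundary of `ins₂ g h F` in which `h` is at the end of the word. -/
def insR (ρ : M →ₗ[k] B →ₗ[k] M) : (List B → B) → (List B → B) → (List B → M) → List B → M
  | g, h, F, [] => splits (fun v z => cupR ρ (fun l => F (pr g v :: l)) h z) []
  | g, h, F, a :: l => splits (fun v z => cupR ρ (fun l => F (pr g v :: l)) h z) (a :: l) -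
      insR ρ (pr g) (pr h) (fun l => F (a :: l)) l

lemma insR_cons (ρ : M →ₗ[k] B →ₗ[k] M) (g h : List B → B) (F : List B → M) (a : B) (l : List B) :
    insR ρ g h F (a :: l) =
      splits (fun v z => cupR ρ (fun l => F (pr g v :: l)) h z) (a :: l) -
      insR ρ (pr g) (pr h) (fun l => F (a :: l)) l := rfl

lemma cob_pr_eq_zero {h : List B → B} (hh : ∀ l, cob k h l = 0) (l : List B) :
    cob k (pr h) l = 0 := by
  have := congrFun (pr_cob (k := k) h) l
  simpa [pr, hh] using this.symm

lemma pr_conc (g h : List B → B) : pr (conc g h) = fun l => -conc (pr g) (pr h) l := by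
  funext l
  rw [pr, conc, ← splits_smul, conc, ← splits_neg]
  refine splits_congr fun x y hl => ?_
  subst hl
  rw [pr, pr, smul_mul_smul_comm, ← neg_smul, sgn, sgn, sgn, List.length_append, ← pow_add, pow_add,
    pow_add, pow_add]
  congr 1; ring

lemma insHead_conc {F : List B → M} (hF : MultiLin k F) (g h : List B → B) (l : List B) :
    insHead (conc g h) F l = splits (fun v z => insHead (fun w => g v * h w) F z) l := by
  have h1 : ∀ u z, F (conc g h u :: z) = splits (fun v w => F (g v * h w :: z)) u := fun u z =>
    map_splits ((hF [] z).mk') (fun v w => g v * h w) u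
  simp only [insHead, h1, ← splits_assoc]

lemma insHead_cob {F : List B → M} (hF : MultiLin k F) (g : List B → B) (a : B) (l : List B) :
    insHead (cob k g) F (a :: l) = insHead (fun v => a * g v) F l +
      insHead (bar (LinearMap.mul k B) g) F (a :: l) := by
  simp only [insHead_cons, cob_nil, cob_cons, hF.map_zero, bar_nil, insHead_add_left hF]
  abel

lemma insHead_zero_left {F : List B → M} (hF : MultiLin k F) {g : List B → B} (hg : ∀ l, g l = 0)
    (l : List B) : insHead g F l = 0 := by
  simp only [insHead, hg, hF.map_zero, splits_zero]

/-- The coboundary of a double insertion of cocycles. -/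
lemma bar_ins₂ (ρ : M →ₗ[k] B →ₗ[k] M) {F : List B → M} (hF : MultiLin k F) {g h : List B → B}
    (hh : MultiLin k h) (hg0 : ∀ l, cob k g l = 0) (hh0 : ∀ l, cob k h l = 0) (l : List B) :
    bar ρ (ins₂ g h F) l = ins₂ (pr g) (pr h) (bar ρ F) l + ins (conc (pr g) (pr h)) F l +
      insR ρ g h F l := by
  have zero : ∀ (g : List B → B) (F : List B → M), MultiLin k F → (∀ l, cob k g l = 0) →
      ∀ l, ins (cob k g) F l = 0 := fun g F hF hg l => by
    rw [show cob k g = fun _ => 0 from funext hg, ins_zero_left hF]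
  -- The first letter of the word is an argument of `F`, and only `h` remains to be inserted.
  have bY : ∀ (h : List B → B) (F : List B → M), MultiLin k F → (∀ l, cob k h l = 0) → ∀ b z,
      bar ρ (insTail (pr h) F) (b :: z) = insTail h (bar ρ F) (b :: z) +
        insHead (fun w => b * pr h w) F z + cupR ρ (fun l => F (b :: l)) h z := by
    intro h F hF hh b z
    rw [bar_insTail, pr_pr, bar_ins ρ (hF.cons b), zero _ _ (hF.cons b) hh]
    simp only [insTail, bar_tail ρ F b, ins_sub, ins_neg]
    abel
  -- The terms of the double insertion in which `g` stands at the head of the word.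
  have head : ∀ (g h : List B → B) (F : List B → M), MultiLin k F → MultiLin k h →
      (∀ l, cob k h l = 0) → ∀ l,
      bar ρ (insHead g (insTail (pr h) F)) l = insHead (bar (LinearMap.mul k B) g)
        (insTail (pr h) F) l + insHead (pr g) (insTail h (bar ρ F)) l +
        insHead (conc (pr g) (pr h)) F l +
        splits (fun v z => cupR ρ (fun l => F (pr g v :: l)) h z) l := by
    intro g h F hF hh hh0 l
    have h1 : insHead (pr g) (bar ρ (insTail (pr h) F)) l =
        insHead (pr g) (insTail h (bar ρ F)) l + insHead (conc (pr g) (pr h)) F l +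
        splits (fun v z => cupR ρ (fun l => F (pr g v :: l)) h z) l := by
      rw [insHead_conc hF]
      simp only [insHead, bY h F hF hh0, ← splits_add]
    rw [bar_insHead ρ (hF.insTail hh.pr), h1]
    simp only [insTail, map_zero, LinearMap.zero_apply]
    abel
  induction l generalizing g h F with
  | nil =>
    have h1 := head g h F hF hh hh0 []
    have h2 : insHead (bar (LinearMap.mul k B) g) (insTail (pr h) F) [] = 0 :=
      (hF.insTail hh.pr).map_zero _
    rw [bar_nil, h2] at h1
    simp only [bar_nil, ins₂, ins, insR, pr_pr]
    rw [h1]; abel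
  | cons a l ih =>
    have h0 : bar ρ (ins₂ g h F) (a :: l) = bar ρ (insHead g (insTail (pr h) F)) (a :: l) +
        bar ρ (insTail₂ g h F) (a :: l) := by
      rw [← bar_add]; congr 1; funext l; exact ins₂_eq g h F l
    have h1 : bar ρ (insTail₂ g h F) (a :: l) = -(ins₂ g h (mergeFirst ρ F a) l -
        insHead (fun v => a * g v) (insTail (pr h) F) l) -
        bar ρ (ins₂ (pr g) (pr h) (fun l => F (a :: l))) l := by
      have h : insHead g (insTail (pr h) (mergeFirst ρ F a)) l =
        insHead (fun v => a * g v) (insTail (pr h) F) l := rfl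
      rw [ins₂_eq, h]
      cases l with
      | nil => simp [insTail₂]
      | cons b l => rw [bar_tail]; simp [mergeFirst, insTail₂]
    -- As `g` is a cocycle, the terms in which `a` is multiplied with its value cancel.
    have h2 := insHead_cob (hF.insTail hh.pr) g a l
    rw [insHead_zero_left (hF.insTail hh.pr) hg0] at h2
    rw [h0, h1, ih (hF.cons a) hh.pr (cob_pr_eq_zero hg0) (cob_pr_eq_zero hh0),
      head g h F hF hh hh0, ins₂_cons, ins_cons, insR_cons, pr_conc, pr_pr, pr_pr,
      ins_neg_left (hF.cons a),
      eq_neg_of_add_eq_zero_right h2.symm]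
    simp only [bar_tail ρ F a, ins₂_sub, ins₂_neg]
    abel

lemma ins₂_lmul (g h F : List B → B) (l : List B) :
    ins₂ g h (lmul F) l = conc g (ins h F) l + lmul (ins₂ (pr g) (pr h) F) l := by
  have h1 : ∀ l, insHead g (insTail (pr h) (lmul F)) l = conc g (ins h F) l := by
    intro l
    refine splits_congr fun v z _ => ?_
    change ins (pr (pr h)) (fun l => g v * F l) z = _
    rw [pr_pr]
    exact ins_map (AddMonoidHom.mulLeft (g v)) h F z
  rw [ins₂_eq, h1]
  congr 1
  cases l with
  | nil => rfl
  | cons a l => exact ins₂_map (AddMonoidHom.mulLeft a) _ _ F l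

/-- The homotopy for the Leibniz rule: the coboundary of a double insertion of cocycles. -/
lemma cob_ins₂ {F : List B → B} (hF : MultiLin k F) {g h : List B → B}
    (hh : MultiLin k h) (hF0 : ∀ l, cob k F l = 0) (hg0 : ∀ l, cob k g l = 0)
    (hh0 : ∀ l, cob k h l = 0) (l : List B) :
    cob k (ins₂ g h F) l = ins (conc (pr g) (pr h)) F l - conc (pr g) (ins (pr h) F) l +
      insR (LinearMap.mul k B) g h F l := by
  have h1 : ins₂ (pr g) (pr h) (lmul F) l +
      ins₂ (pr g) (pr h) (bar (LinearMap.mul k B) F) l = 0 := by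
    rw [← ins₂_add]
    have : (fun l => lmul F l + bar (LinearMap.mul k B) F l) = fun _ => 0 := by
      funext l; rw [← cob_eq, hF0]
    rw [this]
    exact ins₂_map (0 : B →+ B) (pr g) (pr h) (fun _ => 0) l
  rw [cob_eq, bar_ins₂ _ hF hh hg0 hh0, eq_neg_of_add_eq_zero_right h1, ins₂_lmul, pr_pr, pr_pr]
  abel

/-! ### Homogeneous functions on words -/

/-- `F` vanishes on the words whose length is not `n`. -/
def Homog (n : ℕ) (F : List B → M) : Prop := ∀ l, l.length ≠ n → F l = 0

lemma Homog.sgn_smul {n : ℕ} {F : List B → M} (hF : Homog n F) (s : ℕ → ℕ) (l : List B) :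
    sgn (s l.length) • F l = sgn (s n) • F l := by
  by_cases h : l.length = n
  · rw [h]
  · rw [hF l h, smul_zero, smul_zero]

lemma Homog.pr_eq {n : ℕ} {F : List B → M} (hF : Homog n F) : pr F = fun l => sgn (n + 1) • F l :=
  funext fun l => hF.sgn_smul (fun m => m + 1) l

lemma Homog.prn_eq {n : ℕ} {F : List B → M} (hF : Homog n F) (m : ℕ) :
    prn m F = fun l => sgn (m * (n + 1)) • F l :=
  funext fun l => hF.sgn_smul (fun n => m * (n + 1)) l

lemma ins_zsmul_left {F : List B → M} (hF : MultiLin k F) (c : ℤ) (g : List B → B) (l : List B) :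
    ins (fun l => c • g l) F l = c • ins g F l := by
  induction l generalizing F g with
  | nil => exact (hF [] []).mk'.map_smul_of_tower c (g [])
  | cons a l ih =>
    have h1 : pr (fun l => c • g l) = fun l => c • pr g l := by
      funext l; simp only [pr, smul_smul, mul_comm]
    have h2 : insHead (fun l => c • g l) F (a :: l) = c • insHead g F (a :: l) := by
      rw [insHead, insHead, ← splits_smul]
      exact splits_congr fun v z _ => (hF [] z).mk'.map_smul_of_tower c (g v)
    rw [ins_cons, ins_cons, h1, ih (hF.cons a), h2, smul_add]

end Brace
end Word
end HomAssoc

namespace HomAssoc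

namespace Word

/-! ### Insertions of homogeneous cocycles -/

section Homogeneous

variable {k B M N : Type*} [CommRing k] [Ring B] [Algebra k B] [AddCommGroup M] [Module k M]
  [AddCommGroup N] [Module k N]

lemma ins_eq_splits (g : List B → B) (F : List B → M) (l : List B) :
    ins g F l = splits (fun x w => insHead (prn x.length g) (fun z => F (x ++ z)) w) l := by
  induction l generalizing g F with
  | nil => simp [ins]
  | cons a l ih => simp [ins_cons, splits_cons, ih, prn_succ]

lemma Homog.ins {p q : ℕ} {F : List B → M} (hF : Homog p F) (hF' : MultiLin k F) {g : List B → B}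
    (hg : Homog q g) (l : List B) (hl : l.length + 1 ≠ p + q) : ins g F l = 0 := by
  rw [ins_eq_splits]
  refine splits_eq_zero fun x w hxw => splits_eq_zero fun v z hvz => ?_
  by_cases h : v.length = q
  · apply hF
    subst hxw hvz
    simp only [List.length_append, List.length_cons] at hl ⊢
    omega
  · rw [prn, hg v h, smul_zero]
    exact (hF' x z).map_zero

lemma Homog.conc {p q : ℕ} {F G : List B → B} (hF : Homog p F) (hG : Homog q G) :
    Homog (p + q) (conc F G) := by
  intro l hl
  refine splits_eq_zero fun x y hxy => ?_
  subst hxy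
  by_cases h : x.length = p
  · rw [hG y (by rw [List.length_append] at hl; omega), mul_zero]
  · rw [hF x h, zero_mul]

lemma Homog.bar (ρ : M →ₗ[k] B →ₗ[k] M) {p : ℕ} {F : List B → M} (hF : Homog p F) :
    Homog (p + 1) (bar ρ F) := by
  intro l hl
  cases l with
  | nil => rfl
  | cons a l =>
    rw [bar_congr ρ (n := l.length) (G := fun _ => 0) (fun l' hl' => hF _ (by simp_all)) rfl,
      bar_zero]

lemma Homog.cob {p : ℕ} {F : List B → B} (hF : Homog p F) : Homog (p + 1) (cob k F) := by
  intro l hl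
  cases l with
  | nil => rfl
  | cons a l => rw [cob_cons, hF.bar _ _ hl, hF l (by simpa using hl), mul_zero, add_zero]

lemma cupR_eq (ρ : M →ₗ[k] B →ₗ[k] M) {p q : ℕ} {F : List B → M} (hF : Homog p F)
    {g : List B → B} (hg : Homog q g) (l : List B) :
    cupR ρ F g l = sgn (q * (p + 1)) • splits (fun x y => ρ (F x) (g y)) l := by
  rw [cupR, ← splits_smul]
  refine splits_congr fun x y _ => ?_
  by_cases hx : x.length = p
  · by_cases hy : y.length = q
    · rw [hx, hy]
    · simp [hg y hy]
  · simp [hF x hx]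

lemma insR_eq_splits (ρ : M →ₗ[k] B →ₗ[k] M) {q r : ℕ} {F : List B → M} (hF : MultiLin k F)
    {g h : List B → B} (hg : Homog q g) (hh : Homog r h) (l : List B) :
    insR ρ g h F l = splits (fun u y => sgn (q + 1 + r * (u.length + q + 1)) •
      ρ (ins g F u) (h y)) l := by
  have head : ∀ (F : List B → M), MultiLin k F → ∀ (g h : List B → B), Homog q g → Homog r h →
      ∀ l, splits (fun v z => cupR ρ (fun l => F (pr g v :: l)) h z) l =
      splits (fun u y => sgn (q + 1 + r * (u.length + q + 1)) • ρ (insHead g F u) (h y)) l := by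
    intro F hF g h hg hh l
    have h1 : ∀ u y, ρ (insHead g F u) (h y) =
        splits (fun v z => ρ (F (g v :: z)) (h y)) u := fun u y =>
      map_splits (LinearMap.flip ρ (h y)) (fun v z => F (g v :: z)) u
    simp only [cupR, h1, ← splits_smul, splits_assoc]
    refine splits_congr fun u y _ => splits_congr fun v z hu => ?_
    subst hu
    by_cases hy : y.length = r
    · by_cases hv : v.length = q
      · have h2 : F ((sgn (q + 1) • g v) :: z) = sgn (q + 1) • F (g v :: z) :=
          (hF [] z).mk'.map_smul_of_tower (sgn (q + 1)) (g v)
        rw [hg.pr_eq, h2, map_zsmul, LinearMap.smul_apply, smul_smul, sgn, sgn, ← pow_add, hy,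
          List.length_append, hv]
        congr 1
        apply sgn_congr
        have : r * (z.length + 1) + (q + 1) + (q + 1 + r * (q + z.length + q + 1)) =
            2 * (r * (z.length + 1) + (q + 1) + r * q) := by ring
        rw [this]
        exact even_two_mul _
      · simp [pr, hg v hv, hF.map_zero]
    · simp [hh y hy]
  induction l generalizing g h F with
  | nil => exact head F hF g h hg hh []
  | cons a l ih =>
    have hg' : Homog q (pr g) := fun l hl => by simp [pr, hg l hl]
    have hh' : Homog r (pr h) := fun l hl => by simp [pr, hh l hl]
    rw [insR_cons, head F hF g h hg hh, ih (hF.cons a) hg' hh']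
    simp only [ins_eq g F, map_add, LinearMap.add_apply, smul_add, splits_add]
    rw [sub_eq_add_neg, splits_cons (fun u y => _ • ρ (insTail g F u) (h y))]
    simp only [insTail, map_zero, LinearMap.zero_apply, smul_zero, zero_add, ← splits_neg]
    congr 1
    refine splits_congr fun x y _ => ?_
    rw [hh.pr_eq, map_zsmul, smul_smul, sgn, sgn, ← pow_add, ← neg_smul, List.length_cons]
    congr 1
    rw [← sgn_succ]
    apply sgn_congr
    have : q + 1 + r * (x.length + q + 1) + (r + 1) + 1 + (q + 1 + r * (x.length + 1 + q + 1)) =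
      2 * (q + 1 + r * (x.length + q + 1) + r + 1) := by ring
    rw [this]
    exact even_two_mul _

/-- The terms of the coboundary of a double insertion in which `h` is at the end of the word form
the product of `ins g F` and `h`. -/
lemma insR_eq (ρ : M →ₗ[k] B →ₗ[k] M) {p q r : ℕ} {F : List B → M} (hF : MultiLin k F)
    (hF' : Homog p F) {g h : List B → B} (hg : Homog q g) (hh : Homog r h) (l : List B) :
    insR ρ g h F l = sgn (q + 1 + r * p) • splits (fun u y => ρ (ins g F u) (h y)) l := by
  rw [insR_eq_splits ρ hF hg hh, ← splits_smul]
  refine splits_congr fun u y _ => ?_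
  by_cases hu : u.length + 1 = p + q
  · congr 1
    apply sgn_congr
    have : q + 1 + r * (u.length + q + 1) + (q + 1 + r * p) = q + 1 + (q + 1) +
      r * (u.length + 1) + r * q + r * p := by ring
    rw [this, hu]
    exact ⟨q + 1 + r * p + r * q, by ring⟩
  · rw [hF'.ins hF hg u hu]; simp

/-- On cocycles, the product is commutative up to a coboundary. -/
lemma cob_ins_cocycles {p q : ℕ} {F : List B → B} (hF : MultiLin k F)
    (hF' : Homog p F) (hF0 : ∀ l, cob k F l = 0) {g : List B → B} (hg' : Homog q g)
    (hg0 : ∀ l, cob k g l = 0) (l : List B) :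
    cob k (ins g F) l = sgn q • conc g F l - sgn (q * (p + 1)) • conc F g l := by
  have h1 : ∀ g : List B → B, ins g (cob k F) l = 0 := fun g => by
    rw [show cob k F = fun _ => 0 from funext hF0]
    exact ins_map (0 : B →+ B) g (fun _ => 0) l
  have h2 : ins (cob k g) F l = 0 := by
    rw [show cob k g = fun _ => 0 from funext hg0, ins_zero_left hF]
  rw [cob_ins hF, h1, h2, cupR_eq _ hF' hg', hg'.pr_eq, sgn_succ]
  simp only [conc, neg_smul, smul_mul_assoc, splits_neg, splits_smul, neg_mul, LinearMap.mul_apply']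
  abel

/-- Insertion of cocycles is a derivation of the product up to a coboundary. -/
lemma cob_ins₂_cocycles {p q r : ℕ} {F : List B → B} (hF : MultiLin k F)
    (hF' : Homog p F) (hF0 : ∀ l, cob k F l = 0) {g : List B → B} (hg' : Homog q g)
    (hg0 : ∀ l, cob k g l = 0) {h : List B → B} (hh : MultiLin k h) (hh' : Homog r h)
    (hh0 : ∀ l, cob k h l = 0) (l : List B) :
    sgn (q + r) • cob k (ins₂ g h F) l = ins (conc g h) F l - conc g (ins h F) l -
      sgn (r * (p + 1)) • conc (ins g F) h l := by
  rw [cob_ins₂ hF hh hF0 hg0 hh0, insR_eq _ hF hF' hg' hh']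
  have h1 : conc (pr g) (pr h) = fun l => sgn (q + r) • conc g h l := by
    funext l
    rw [hg'.pr_eq, hh'.pr_eq]
    simp only [conc, smul_mul_smul_comm, splits_smul, sgn, ← pow_add]
    congr 1
    exact sgn_congr ⟨q + r + 1, by ring⟩
  have h2 : conc (pr g) (ins (pr h) F) l = sgn (q + r) • conc g (ins h F) l := by
    rw [hg'.pr_eq, hh'.pr_eq, show (ins (fun l => sgn (r + 1) • h l) F) =
      fun l => sgn (r + 1) • ins h F l from funext (ins_zsmul_left hF _ h)]
    simp only [conc, smul_mul_smul_comm, splits_smul, sgn, ← pow_add]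
    congr 1
    exact sgn_congr ⟨q + r + 1, by ring⟩
  have h3 : sgn (q + r) * sgn (q + r) = 1 := by
    rw [sgn, ← pow_add]; exact Even.neg_one_pow ⟨_, rfl⟩
  have h4 : sgn (q + r) * sgn (q + 1 + r * p) = -sgn (r * (p + 1)) := by
    rw [sgn, sgn, ← pow_add]
    exact sgn_neg_congr ⟨q + r + r * p, by ring⟩
  rw [h1, h2, ins_zsmul_left hF, smul_add, smul_sub, smul_smul, smul_smul, smul_smul, h3, h4,
    one_smul, one_smul, neg_smul, ← sub_eq_add_neg]
  rfl

end Homogeneous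
end Word
end HomAssoc

namespace HomAssoc

namespace Word

/-! ### Rotation sums -/

section Cyclic

variable {k B V : Type*} [CommRing k] [Ring B] [Algebra k B] [AddCommGroup V] [Module k V]

lemma ins_conc_homog {p r : ℕ} {F G h : List B → B} (hG : MultiLin k G) (hF : Homog p F)
    (hh : Homog r h) (l : List B) :
    ins h (conc F G) l = conc (ins h F) G l + sgn (p * (r + 1)) • conc F (ins h G) l := by
  rw [ins_conc, conc, conc, ← splits_smul]
  congr 1
  refine splits_congr fun x y _ => ?_
  by_cases hx : x.length = p
  · rw [hx, hh.prn_eq, ins_zsmul_left hG, mul_smul_comm]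
  · simp [hF x hx]

variable (k V) in
/-- The right action of `B` on functionals: `(κ b)(x) = κ (b x)`. -/
def dualR : (B →ₗ[k] V) →ₗ[k] B →ₗ[k] (B →ₗ[k] V) :=
  LinearMap.mk₂ k (fun κ b => κ ∘ₗ LinearMap.mulLeft k b)
    (by intros; ext; simp) (by intros; ext; simp) (by intros; ext; simp [add_mul])
    (by intros; ext; simp)

@[simp] lemma dualR_apply (κ : B →ₗ[k] V) (b x : B) : dualR k V κ b x = κ (b * x) := rfl

/-- The left action of the first letter on functionals: `(b κ)(x) = κ (x b)`. -/
def lmulDual (K : List B → (B →ₗ[k] V)) : List B → (B →ₗ[k] V)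
  | [] => 0
  | a :: l => K l ∘ₗ LinearMap.mulRight k a

/-- The Hochschild coboundary of a function on words with values in functionals. -/
def dualCob (K : List B → (B →ₗ[k] V)) (l : List B) : B →ₗ[k] V :=
  lmulDual K l + bar (dualR k V) K l

/-- The signed sum of `Ψ y x` over all decompositions `l = x ++ y`, where `Ψ y x a₀` is thought
of as a function of the word `y ++ a₀ :: x`, a rotation of `a₀ :: l`. -/
def rotSum (Ψ : List B → List B → (B →ₗ[k] V)) : List B → (B →ₗ[k] V) :=
  splits fun x y => sgn (y.length * (x.length + 1)) • Ψ y x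

/-- The alternating sum of all mergings of neighbouring letters in the word `y ++ a₀ :: x`. -/
def mergings (Ψ : List B → List B → (B →ₗ[k] V)) (y x : List B) : B →ₗ[k] V :=
  -bar (dualR k V) (fun y => Ψ y x) y + sgn y.length • (lmulDual (Ψ y) x +
    bar (0 : (B →ₗ[k] V) →ₗ[k] B →ₗ[k] (B →ₗ[k] V)) (Ψ y) x)

lemma lmulDual_splits (G : List B → List B → (B →ₗ[k] V)) (l : List B) :
    lmulDual (splits G) l = splits (fun x y => lmulDual (fun x => G x y) x) l := by
  cases l with
  | nil => rfl
  | cons a l =>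
    rw [splits_cons]
    simp only [lmulDual, zero_add]
    exact map_splits (LinearMap.lcomp k V (LinearMap.mulRight k a)) G l

lemma lmulDual_length_smul (s : ℕ → ℤ) (K : List B → (B →ₗ[k] V)) (l : List B) :
    lmulDual (fun l => s l.length • K l) l = s (l.length - 1) • lmulDual K l := by
  cases l <;> simp [lmulDual, LinearMap.smul_comp]

/-- The Hochschild coboundary of a rotation sum is the rotation sum of the mergings: the left and
the right action of a letter on functionals are mergings with `a₀`. -/
lemma dualCob_rotSum (Ψ : List B → List B → (B →ₗ[k] V)) (l : List B) :
    dualCob (rotSum Ψ) l = rotSum (mergings Ψ) l := by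
  rw [dualCob, rotSum, lmulDual_splits, bar_splits, ← splits_add, rotSum]
  refine splits_congr fun x y _ => ?_
  have h1 := lmulDual_length_smul (fun n => sgn (y.length * (n + 1))) (Ψ y) x
  have h2 := bar_length_smul (0 : (B →ₗ[k] V) →ₗ[k] B →ₗ[k] (B →ₗ[k] V))
    (fun n => sgn (y.length * (n + 1))) (Ψ y) x
  have h3 := bar_length_smul (dualR k V) (fun n => sgn (n * (x.length + 1)))
    (fun y => Ψ y x) y
  have e1 : ∀ κ : B →ₗ[k] V, (x = [] → κ = 0) → sgn (y.length * (x.length - 1 + 1)) • κ =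
      sgn (y.length * (x.length + 1)) • sgn y.length • κ := by
    intro κ hκ
    cases x with
    | nil => simp [hκ rfl]
    | cons a x =>
      rw [smul_smul, sgn, sgn, ← pow_add]
      congr 1
      apply sgn_congr
      simp only [List.length_cons, Nat.add_sub_cancel]
      exact ⟨y.length * (x.length + 1) + y.length, by ring⟩
  have e2 : ∀ κ : B →ₗ[k] V, (y = [] → κ = 0) →
      sgn x.length • sgn ((y.length - 1) * (x.length + 1)) • κ =
      -(sgn (y.length * (x.length + 1)) • κ) := by
    intro κ hκ
    cases y with
    | nil => simp [hκ rfl]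
    | cons a y =>
      rw [smul_smul, sgn, sgn, ← pow_add, ← neg_smul]
      congr 1
      apply sgn_neg_congr
      simp only [List.length_cons, Nat.add_sub_cancel]
      exact ⟨x.length + y.length * (x.length + 1), by ring⟩
  rw [h1, h2, h3, e1, e1, e2, mergings]
  · simp only [smul_add, smul_neg]; abel
  · rintro rfl; rfl
  · rintro rfl; rfl
  · rintro rfl; rfl

open Classical in
/-- The functional `a₀ ↦ φ (y ++ a₀ :: x)`, and zero if this is not linear. -/
noncomputable def slot (k : Type*) {B V : Type*} [CommRing k] [Ring B] [Algebra k B]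
    [AddCommGroup V] [Module k V] (φ : List B → V) (y x : List B) : B →ₗ[k] V :=
  if h : IsLinearMap k fun u => φ (y ++ u :: x) then h.mk' else 0

lemma slot_apply {φ : List B → V} (hφ : MultiLin k φ) (y x : List B) (a : B) :
    slot k φ y x a = φ (y ++ a :: x) := by
  rw [slot, dif_pos (hφ y x)]; rfl

lemma slot_cons {φ : List B → V} (hφ : MultiLin k φ) (c : B) (y x : List B) :
    slot k φ (c :: y) x = slot k (fun l => φ (c :: l)) y x := by
  ext a
  rw [slot_apply hφ, slot_apply (hφ.cons c)]; rfl

lemma bar_apply (ρ : (B →ₗ[k] V) →ₗ[k] B →ₗ[k] (B →ₗ[k] V)) (hρ : ρ = 0)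
    (K : List B → (B →ₗ[k] V)) (l : List B) (a : B) :
    bar ρ K l a = bar (0 : V →ₗ[k] B →ₗ[k] V) (fun l => K l a) l :=
  (bar_map (ρ := ρ) (ρ' := 0) (LinearMap.applyₗ a).toAddMonoidHom (by simp [hρ]) K l).symm

/-- The mergings of a function of the whole word. -/
lemma mergings_slot {φ : List B → V} (hφ : MultiLin k φ) (y x : List B) :
    mergings (slot k φ) y x = slot k (fun l => -bar (0 : V →ₗ[k] B →ₗ[k] V) φ l) y x := by
  have hb : ∀ {φ : List B → V}, MultiLin k φ →
      MultiLin k fun l => -bar (0 : V →ₗ[k] B →ₗ[k] V) φ l := fun hφ => (hφ.bar 0).neg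
  ext a
  rw [slot_apply (hb hφ)]
  induction y generalizing φ with
  | nil =>
    simp only [mergings, bar_nil, neg_zero, zero_add, List.length_nil, pow_zero, one_smul,
      LinearMap.add_apply, bar_apply _ rfl, slot_apply hφ, List.nil_append, bar_tail _ _ a]
    cases x with
    | nil => simp [lmulDual, mergeFirst]
    | cons b x => simp [lmulDual, mergeFirst, slot_apply hφ, add_comm]
  | cons c y ih =>
    have h := ih (hφ.cons c)
    have h1 : ∀ x, slot k φ (c :: y) x = slot k (fun l => φ (c :: l)) y x := slot_cons hφ c y
    have h2 : (fun y => slot k φ (c :: y) x) = fun y => slot k (fun l => φ (c :: l)) y x :=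
      funext fun y => slot_cons hφ c y x
    have h3 : slot k φ (c :: y) = slot k (fun l => φ (c :: l)) y := funext fun x => h1 x
    have h4 : mergeFirst (dualR k V) (fun y => slot k φ y x) c y a =
        mergeFirst (0 : V →ₗ[k] B →ₗ[k] V) φ c (y ++ a :: x) := by
      cases y <;> simp [mergeFirst, slot_apply hφ]
    have h5 : mergings (slot k φ) (c :: y) x = mergeFirst (dualR k V) (fun y => slot k φ y x) c y -
        mergings (slot k fun l => φ (c :: l)) y x := by
      simp only [mergings, bar_tail _ _ c, h2, h3, List.length_cons, sgn_succ, neg_smul]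
      abel
    rw [List.cons_append, bar_tail, h5, LinearMap.sub_apply, h, h4]
    abel

/-- The signed sum of the values of `φ` on all rotations of the word `a₀ :: l`. -/
noncomputable def rot (k : Type*) {B V : Type*} [CommRing k] [Ring B] [Algebra k B]
    [AddCommGroup V] [Module k V] (φ : List B → V) : List B → (B →ₗ[k] V) := rotSum (slot k φ)

lemma rot_apply {φ : List B → V} (hφ : MultiLin k φ) (l : List B) (a : B) :
    rot k φ l a = splits (fun x y => sgn (y.length * (x.length + 1)) • φ (y ++ a :: x)) l := by
  have := map_splits (LinearMap.applyₗ (R := k) (M₂ := V) a).toAddMonoidHom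
    (fun x y => sgn (y.length * (x.length + 1)) • slot k φ y x) l
  refine this.trans (splits_congr fun x y _ => ?_)
  change (sgn (y.length * (x.length + 1)) • slot k φ y x) a = _
  rw [LinearMap.smul_apply, slot_apply hφ]

lemma rot_add {φ ψ : List B → V} (hφ : MultiLin k φ) (hψ : MultiLin k ψ) (l : List B) :
    rot k (fun l => φ l + ψ l) l = rot k φ l + rot k ψ l := by
  ext a
  rw [rot_apply (hφ.add hψ), LinearMap.add_apply, rot_apply hφ, rot_apply hψ, ← splits_add]
  simp only [smul_add]

lemma rot_neg {φ : List B → V} (hφ : MultiLin k φ) (l : List B) :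
    rot k (fun l => -φ l) l = -rot k φ l := by
  ext a
  rw [rot_apply hφ.neg, LinearMap.neg_apply, rot_apply hφ, ← splits_neg]
  simp only [smul_neg]

/-- The coboundary of a rotation sum is the rotation sum of the mergings of all neighbouring letters
of the cyclic word, except for the merging of the last letter with the first. -/
lemma dualCob_rot {φ : List B → V} (hφ : MultiLin k φ) (l : List B) :
    dualCob (rot k φ) l = rot k (fun l => -bar (0 : V →ₗ[k] B →ₗ[k] V) φ l) l := by
  rw [rot, dualCob_rotSum, rot]
  congr 1
  funext y x
  exact mergings_slot hφ y x

/-- Rotation sums do not change when the words are rotated by one letter. -/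
lemma rot_congr {η η' : List B → V} (hη : MultiLin k η) (hη' : MultiLin k η')
    (h : ∀ w d, η' (w ++ [d]) = sgn w.length • η (d :: w)) (l : List B) :
    rot k η' l = rot k η l := by
  ext a
  rw [rot_apply hη, rot_apply hη', ← sub_eq_zero, ← neg_eq_zero, neg_sub, ← splits_sub]
  rw [splits_telescope]
  · have := h l a
    simp [this, smul_smul, ← mul_pow]
  · intro x d y
    have := h (y ++ a :: x) d
    simp only [List.append_assoc, List.cons_append] at this
    rw [this, smul_smul, sgn, sgn, ← pow_add]
    simp only [List.length_cons, List.length_append, List.length_nil, List.cons_append]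
    congr 1
    apply sgn_congr
    exact ⟨y.length * (x.length + 1) + y.length + x.length + 1, by ring⟩

/-- Rotation sums are invariant under the signed rotation. -/
lemma rot_cons {ψ : List B → V} (hψ : MultiLin k ψ) (c d : B) (w : List B) :
    rot k ψ (c :: w) d = sgn (w.length + 1) • rot k ψ (w ++ [d]) c := by
  rw [rot_apply hψ, rot_apply hψ, splits_append, splits_cons, smul_add, ← splits_smul, add_comm]
  congr 1
  · refine splits_congr fun x y hxy => ?_
    subst hxy
    rw [smul_smul, sgn, sgn, sgn, ← pow_add]
    simp only [List.length_cons, List.length_append, List.length_nil, List.append_assoc,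
      List.cons_append, List.nil_append]
    congr 1
    apply sgn_congr
    exact ⟨y.length * (x.length + 1) + y.length + x.length + 1, by ring⟩
  · simp

end Cyclic

/-! ### The BV operator of a symmetrizing form -/

section Symmetric

variable {k B : Type*} [CommRing k] [Ring B] [Algebra k B]

/-- A symmetrizing form: an isomorphism of `B` with its dual that respects both actions. -/
structure SymmForm (k B : Type*) [CommRing k] [Ring B] [Algebra k B] where
  T : B ≃ₗ[k] (B →ₗ[k] k)
  mul_right : ∀ b c x, T (b * c) x = T b (c * x)
  mul_left : ∀ b c x, T (c * b) x = T b (x * c)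

variable (S : SymmForm k B)

/-- The trace of a symmetrizing form. -/
def SymmForm.τ : B →ₗ[k] k := S.T 1

lemma SymmForm.T_apply (b x : B) : S.T b x = S.τ (b * x) := by
  rw [SymmForm.τ, ← S.mul_right, one_mul]

lemma SymmForm.τ_comm (b c : B) : S.τ (b * c) = S.τ (c * b) := by
  rw [SymmForm.τ, ← S.mul_left, mul_one, ← S.mul_right, one_mul]

end Symmetric
end Word
end HomAssoc

namespace HomAssoc

namespace Word

section Symmetric

variable {k B : Type*} [CommRing k] [Ring B] [Algebra k B] (S : SymmForm k B)

lemma T_cob (F : List B → B) (l : List B) :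
    S.T (cob k F l) = dualCob (fun l => S.T (F l)) l := by
  rw [cob_eq, map_add, dualCob]
  congr 1
  · cases l with
    | nil => exact map_zero _
    | cons a l => ext x; exact S.mul_left _ _ _
  · refine (bar_map S.T.toLinearMap.toAddMonoidHom (fun m a => ?_) F l).symm
    ext x
    exact S.mul_right _ _ _

lemma bar_append_last {M : Type*} [AddCommGroup M] [Module k M] (ρ : M →ₗ[k] B →ₗ[k] M)
    (F : List B → M) (w : List B) (d : B) :
    bar ρ F (w ++ [d]) = bar (0 : M →ₗ[k] B →ₗ[k] M) F (w ++ [d]) - sgn w.length • ρ (F w) d := by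
  induction w generalizing F with
  | nil => simp
  | cons a w ih =>
    rw [List.cons_append, bar_tail, bar_tail, ih]
    have h : mergeFirst ρ F a (w ++ [d]) = mergeFirst (0 : M →ₗ[k] B →ₗ[k] M) F a (w ++ [d]) := by
      cases w <;> rfl
    rw [h, List.length_cons, sgn_succ, neg_smul]
    abel

lemma MultiLin.lmul {F : List B → B} (hF : MultiLin k F) : MultiLin k (lmul F) := by
  intro x y
  cases x with
  | nil => exact (LinearMap.mulRight k (F y)).isLinear
  | cons a x =>
    exact isLinearMap_comp (P := fun u => a * u) (LinearMap.mulLeft k a).isLinear (hF x y)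

lemma MultiLin.cob {F : List B → B} (hF : MultiLin k F) : MultiLin k (cob k F) := by
  rw [show Word.cob k F = _ from funext (cob_eq F)]
  exact hF.lmul.add (hF.bar _)

/-- The trace of the product of the first letter and the value at the other letters. -/
def firstTr (F : List B → B) (l : List B) : k := S.τ (lmul F l)

/-- The trace of the product of the value at the first letters and the last letter, with the sign
`(-1)^(|l| - 1)`: the difference between the coboundaries for the trivial action and for the right
action by multiplication, so that no last letter has to be singled out. -/
def lastTr (F : List B → B) (l : List B) : k :=
  bar (0 : k →ₗ[k] B →ₗ[k] k) (fun l => S.τ (F l)) l - S.τ (bar (LinearMap.mul k B) F l)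

variable {S} in
lemma firstTr_multiLin {F : List B → B} (hF : MultiLin k F) : MultiLin k (firstTr S F) :=
  hF.lmul.comp S.τ

variable {S} in
lemma lastTr_multiLin {F : List B → B} (hF : MultiLin k F) : MultiLin k (lastTr S F) :=
  ((hF.comp S.τ).bar _).sub ((hF.bar _).comp S.τ)

/-- By the symmetry of the trace, `firstTr` and `lastTr` differ by a rotation. -/
lemma lastTr_append (F : List B → B) (w : List B) (d : B) :
    lastTr S F (w ++ [d]) = sgn w.length • firstTr S F (d :: w) := by
  have h := bar_map (ρ := (0 : B →ₗ[k] B →ₗ[k] B)) (ρ' := (0 : k →ₗ[k] B →ₗ[k] k))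
    S.τ.toAddMonoidHom (by simp) F (w ++ [d])
  have h' : bar (0 : k →ₗ[k] B →ₗ[k] k) (fun l => S.τ (F l)) (w ++ [d]) =
      S.τ (bar (0 : B →ₗ[k] B →ₗ[k] B) F (w ++ [d])) := h
  rw [lastTr, h', bar_append_last (LinearMap.mul k B), map_sub, sub_sub_cancel, map_zsmul,
    LinearMap.mul_apply', S.τ_comm]
  rfl

lemma neg_bar_tr (F : List B → B) (l : List B) :
    -bar (0 : k →ₗ[k] B →ₗ[k] k) (fun l => S.τ (F l)) l =
      firstTr S F l + -lastTr S F l + -S.τ (cob k F l) := by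
  rw [firstTr, lastTr, cob_eq, map_add]
  abel

/-- Rotation sums of traces anticommute with the coboundary. -/
lemma dualCob_rot_tr {F : List B → B} (hF : MultiLin k F) (l : List B) :
    dualCob (rot k fun l => S.τ (F l)) l = -rot k (fun l => S.τ (cob k F l)) l := by
  have h1 := firstTr_multiLin (S := S) hF
  have h2 := lastTr_multiLin (S := S) hF
  have h3 := hF.cob.comp S.τ
  rw [dualCob_rot (hF.comp S.τ)]
  simp only [neg_bar_tr]
  rw [rot_add (h1.add h2.neg) h3.neg, rot_add h1 h2.neg, rot_neg h2, rot_neg h3,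
    rot_congr h1 h2 (lastTr_append S F)]
  abel

/-- The operator `Δ`, up to sign: the form `⟨Δ F (l), a₀⟩` is the rotation sum of the trace of `F`
on the word `a₀ :: l`. -/
noncomputable def bv (F : List B → B) (l : List B) : B := S.T.symm (rot k (fun l => S.τ (F l)) l)

lemma T_bv (F : List B → B) (l : List B) : S.T (bv S F l) = rot k (fun l => S.τ (F l)) l :=
  S.T.apply_symm_apply _

lemma cob_bv {F : List B → B} (hF : MultiLin k F) (l : List B) :
    cob k (bv S F) l = -bv S (cob k F) l := by
  apply S.T.injective
  rw [T_cob, map_neg, T_bv, ← dualCob_rot_tr S hF]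
  simp only [T_bv]

/-- The insertion of `g` in `φ` behind the letter `a₀` of the word `y ++ a₀ :: x`. -/
noncomputable def insBehind (φ : List B → k) (g : List B → B) (y : List B) :
    List B → (B →ₗ[k] k) :=
  ins (prn (y.length + 1) g) (slot k φ y)

lemma cob_prn_eq_zero {g : List B → B} (hg : ∀ l, cob k g l = 0) (n : ℕ) (l : List B) :
    cob k (prn n g) l = 0 := by
  induction n generalizing g with
  | zero => simp [hg]
  | succ n ih => rw [prn_succ]; exact ih (cob_pr_eq_zero hg)

lemma slot_multiLin {φ : List B → k} (hφ : MultiLin k φ) (y : List B) :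
    MultiLin k (slot k φ y) := by
  intro x z
  refine ⟨fun u v => ?_, fun c u => ?_⟩
  · ext a
    have := (hφ (y ++ a :: x) z).map_add u v
    simpa [slot_apply hφ] using this
  · ext a
    have := (hφ (y ++ a :: x) z).map_smul c u
    simpa [slot_apply hφ] using this

lemma ins_lmulDual (g : List B → B) (K : List B → (B →ₗ[k] k)) (l : List B) :
    ins g (lmulDual K) l = splits (fun v z => K z ∘ₗ LinearMap.mulRight k (g v)) l +
      lmulDual (ins (pr g) K) l := by
  cases l with
  | nil => simp [ins, insHead_nil, lmulDual]
  | cons a l =>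
    rw [ins_cons]
    congr 1
    exact ins_map (LinearMap.lcomp k k (LinearMap.mulRight k a)).toAddMonoidHom (pr g) K l

lemma ins_bar_comm {M : Type*} [AddCommGroup M] [Module k M] (ρ : M →ₗ[k] B →ₗ[k] M)
    (g : List B → B) (G : List B → List B → M) (x y : List B) :
    ins g (fun x => bar ρ (fun y => G y x) y) x = bar ρ (fun y => ins g (G y) x) y := by
  induction y generalizing G with
  | nil => exact ins_map (0 : M →+ M) g (fun _ => 0) x
  | cons a y ih =>
    cases y with
    | nil =>
      simp only [bar_one, ins_neg]
      exact congrArg _ (ins_map (ρ.flip a).toAddMonoidHom g (G []) x)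
    | cons b y => simp only [bar_cons, ins_sub, ins_neg, ih]

/-- Merging neighbouring letters commutes with the insertion of a cocycle `g` behind `a₀`, except
that after the insertion `a₀` may also be merged with the value of `g`. -/
lemma mergings_insBehind {φ : List B → k} (hφ : MultiLin k φ) {g : List B → B}
    (hg : ∀ l, cob k g l = 0) (y x : List B) :
    insBehind (fun l => -bar (0 : k →ₗ[k] B →ₗ[k] k) φ l) g y x =
      mergings (insBehind φ (pr g)) y x + sgn y.length •
        splits (fun v z => slot k φ y z ∘ₗ LinearMap.mulRight k (prn (y.length + 1) g v)) x := by
  set γ := prn (y.length + 1) g with hγ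
  have h0 : insBehind φ (pr g) y = ins (pr γ) (slot k φ y) := by
    rw [insBehind, hγ, pr_prn, ← prn_succ]
  have h1 : ins γ (fun x => bar (dualR k k) (fun y => slot k φ y x) y) x =
      bar (dualR k k) (fun y => insBehind φ (pr g) y x) y := by
    rw [ins_bar_comm]
    cases y with
    | nil => rfl
    | cons b y =>
      refine bar_congr _ (n := y.length) (fun y' hy' => ?_) rfl
      rw [insBehind, ← prn_succ, hy']
      rfl
  have h2 : ins γ (bar (0 : (B →ₗ[k] k) →ₗ[k] B →ₗ[k] (B →ₗ[k] k)) (slot k φ y)) x =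
      bar (0 : (B →ₗ[k] k) →ₗ[k] B →ₗ[k] (B →ₗ[k] k)) (ins (pr γ) (slot k φ y)) x := by
    have hz : ins (cob k (pr γ)) (slot k φ y) x = 0 := by
      rw [show cob k (pr γ) = fun _ => 0 from funext (cob_pr_eq_zero (cob_prn_eq_zero hg _)),
        ins_zero_left (slot_multiLin hφ y)]
    have hc : cupR (0 : (B →ₗ[k] k) →ₗ[k] B →ₗ[k] (B →ₗ[k] k)) (slot k φ y) (pr γ) x = 0 :=
      splits_eq_zero fun _ _ _ => by simp
    rw [bar_ins _ (slot_multiLin hφ y), hz, hc, pr_pr]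
    abel
  have h3 : slot k (fun l => -bar (0 : k →ₗ[k] B →ₗ[k] k) φ l) y = mergings (slot k φ) y :=
    funext fun x => (mergings_slot hφ y x).symm
  have h4 : mergings (slot k φ) y = fun x => -bar (dualR k k) (fun y => slot k φ y x) y +
      sgn y.length • (lmulDual (slot k φ y) x +
        bar (0 : (B →ₗ[k] k) →ₗ[k] B →ₗ[k] (B →ₗ[k] k)) (slot k φ y) x) := rfl
  rw [insBehind, h3, ← hγ, h4, ins_add, ins_neg, ins_zsmul, ins_add, h1, h2, ins_lmulDual,
    mergings, h0]
  simp only [smul_add]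
  abel

/-- The rotation sum of `τ (g v * F _)` over the words in which `a₀` is an argument of `F`. -/
def halfRot (g F : List B → B) (l : List B) (a : B) : k :=
  splits (fun x w => splits (fun v y => sgn ((v.length + y.length) * (x.length + 1)) •
    S.τ (g v * F (y ++ a :: x))) w) l

/-- In the rotation sum of the product of `g` and `F`, the letter `a₀` is an argument of `F` or of
`g`. -/
lemma rot_tr_conc {p q : ℕ} {F g : List B → B} (hF : MultiLin k F) (hg : MultiLin k g)
    (hF' : Homog p F) (hg' : Homog q g) (l : List B) (a : B) :
    rot k (fun l => S.τ (conc g F l)) l a =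
      halfRot S g F l a + sgn (p * q) • halfRot S F g l a := by
  have h1 : ∀ Ψ : List B → List B → B, ∀ l, S.τ (splits Ψ l) = splits (fun x y => S.τ (Ψ x y)) l :=
    fun Ψ l => map_splits S.τ Ψ l
  rw [rot_apply ((hg.conc hF).comp S.τ)]
  simp only [conc, splits_append, map_add, h1, smul_add, splits_add]
  congr 1
  · refine splits_congr fun x w _ => ?_
    rw [← splits_smul]
    refine splits_congr fun v y h => ?_
    rw [← h, List.length_append]
  -- Where `a₀` is an argument of `g`, the symmetry of the trace exchanges the two factors.
  · have h4 : splits (fun x y => splits (fun x1 x2 => sgn (y.length * (x.length + 1)) •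
        S.τ (g (y ++ a :: x1) * F x2)) x) l =
        splits (fun x y => splits (fun x1 x2 => sgn (y.length * ((x1 ++ x2).length + 1)) •
        S.τ (g (y ++ a :: x1) * F x2)) x) l :=
      splits_congr fun x y _ => splits_congr fun x1 x2 h => by rw [h]
    simp only [← splits_smul, halfRot] at h4 ⊢
    rw [h4, ← splits_assoc]
    refine splits_congr fun x1 t _ => splits_congr fun x2 y _ => ?_
    by_cases h2 : x2.length = p
    · by_cases h3 : (y ++ a :: x1).length = q
      · rw [smul_smul, S.τ_comm, sgn, sgn, sgn, ← pow_add]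
        congr 1
        apply sgn_congr
        rw [← h2, ← h3]
        simp only [List.length_append, List.length_cons]
        exact ⟨y.length * (x1.length + 1) + x2.length * (y.length + x1.length + 1), by ring⟩
      · rw [hg' _ h3]; simp
    · rw [hF' _ h2]; simp

lemma zsmul_head {F : List B → k} (hF : MultiLin k F) (x y : List B) (c : ℤ) (b : B) :
    F (x ++ (c • b) :: y) = c • F (x ++ b :: y) := (hF x y).mk'.map_smul_of_tower c b

lemma rotSum_apply (Ψ : List B → List B → (B →ₗ[k] k)) (l : List B) (a : B) :
    rotSum Ψ l a = splits (fun x y => sgn (y.length * (x.length + 1)) • Ψ y x a) l :=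
  map_splits (LinearMap.applyₗ (R := k) (M₂ := k) a).toAddMonoidHom
    (fun x y => sgn (y.length * (x.length + 1)) • Ψ y x) l

lemma rotSum_insBehind {q : ℕ} {φ : List B → k} (hφ : MultiLin k φ) {g : List B → B}
    (hg' : Homog q g) (l : List B) (a : B) :
    rotSum (insBehind φ g) l a = splits (fun x t => splits (fun v s => splits (fun z y =>
      sgn (y.length * (x.length + v.length + z.length + 1) +
        (x.length + y.length + 1) * (q + 1)) • φ (y ++ a :: x ++ g v :: z)) s) t) l := by
  have h1 : ∀ x y, insBehind φ g y x a = splits (fun x w => splits (fun v z =>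
      sgn ((x.length + y.length + 1) * (q + 1)) • φ (y ++ a :: x ++ g v :: z)) w) x := by
    intro x y
    have := ins_map (LinearMap.applyₗ (R := k) (M₂ := k) a).toAddMonoidHom
      (prn (y.length + 1) g) (slot k φ y) x
    refine this.symm.trans ?_
    rw [ins_eq_splits]
    refine splits_congr fun x w _ => splits_congr fun v z _ => ?_
    change slot k φ y _ a = _
    rw [slot_apply hφ, prn, prn, smul_smul]
    have e := zsmul_head hφ (y ++ a :: x) z
    by_cases hv : v.length = q
    · simp only [List.append_assoc, List.cons_append] at e ⊢
      rw [e, hv, sgn, sgn, sgn, ← pow_add]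
      congr 2
      ring
    · simp only [List.append_assoc, List.cons_append] at e ⊢
      rw [e, hg' v hv]
      have := (hφ (y ++ a :: x) z).map_zero
      simp only [List.append_assoc, List.cons_append] at this
      rw [this]; simp
  rw [rotSum_apply]
  simp only [h1, ← splits_smul, smul_smul]
  have h2 : splits (fun x y => splits (fun x1 w => splits (fun v z =>
      (sgn (y.length * (x.length + 1)) * sgn ((x1.length + y.length + 1) * (q + 1))) •
        φ (y ++ a :: x1 ++ g v :: z)) w) x) l =
      splits (fun x y => splits (fun x1 w => splits (fun v z =>
      (sgn (y.length * (x1.length + v.length + z.length + 1) +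
        (x1.length + y.length + 1) * (q + 1))) •
        φ (y ++ a :: x1 ++ g v :: z)) w) x) l := by
    refine splits_congr fun x y _ => splits_congr fun x1 w h => splits_congr fun v z h' => ?_
    rw [← h, ← h', sgn, sgn, sgn, ← pow_add, List.length_append, List.length_append]
    congr 2
    ring
  rw [h2, ← splits_assoc]
  refine splits_congr fun x t _ => ?_
  rw [← splits_assoc]

/-- The homotopy for the bracket: for cocycles `F` and `g`, the insertion of `g` in `F`, the
product of `g` and `Δ F`, and half of the rotation sum of the product of `g` and `F` add up to a
coboundary. -/
lemma dualCob_insBehind {q : ℕ} {F g : List B → B} (hF : MultiLin k F)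
    (hF0 : ∀ l, cob k F l = 0)
    (hg' : Homog q g) (hg0 : ∀ l, cob k g l = 0) (l : List B) (a : B) :
    dualCob (rotSum (insBehind (fun l => S.τ (F l)) (pr g))) l a =
      sgn (q + 1) • S.T (ins g F l - conc g (bv S F) l) a - halfRot S g F l a := by
  have hφ := hF.comp S.τ
  have hω := firstTr_multiLin (S := S) hF
  have hω' := lastTr_multiLin (S := S) hF
  have hm := (hφ.bar (0 : k →ₗ[k] B →ₗ[k] k)).neg
  -- Since `F` is a cocycle, the coboundary of `τ ∘ F` is a difference of the traces of products
  -- with the first and with the last letter: only the boundary terms of telescoping sums survive.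
  have e1 : rotSum (insBehind
      (fun l => -bar (0 : k →ₗ[k] B →ₗ[k] k) (fun l => S.τ (F l)) l) g) l a =
      sgn (q + 1) • S.T (ins g F l) a - halfRot S g F l a := by
    rw [rotSum_insBehind hm hg']
    simp only [neg_bar_tr, hF0, map_zero, neg_zero, add_zero, ← sub_eq_add_neg, smul_sub]
    -- The summands with `firstTr` and with `lastTr` telescope along the splittings of `s`.
    have tel : ∀ x v s, splits (fun z y =>
        sgn (y.length * (x.length + v.length + z.length + 1) +
            (x.length + y.length + 1) * (q + 1)) •
          firstTr S F (y ++ a :: x ++ g v :: z) -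
        sgn (y.length * (x.length + v.length + z.length + 1) +
            (x.length + y.length + 1) * (q + 1)) •
          lastTr S F (y ++ a :: x ++ g v :: z)) s =
        sgn (q + 1) • sgn (x.length * (q + 1)) • S.τ (F (x ++ g v :: s) * a) -
        sgn ((v.length + s.length) * (x.length + 1)) • S.τ (g v * F (s ++ a :: x)) := by
      intro x v s
      by_cases hv : v.length = q
      · have hP := splits_telescope (P := fun z y : List B =>
          sgn (y.length * (x.length + v.length + z.length + 1) +
            (x.length + y.length + 1) * (q + 1)) • firstTr S F (y ++ a :: x ++ g v :: z))
          (Q := fun z y : List B => sgn (y.length * (x.length + v.length + z.length + 1) +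
            (x.length + y.length + 1) * (q + 1)) • lastTr S F (y ++ a :: x ++ g v :: z))
          (fun z d y => by
            have h := lastTr_append S F (y ++ a :: x ++ g v :: z) d
            simp only [List.append_assoc, List.cons_append] at h ⊢
            rw [h, smul_smul, sgn, sgn, sgn, ← pow_add]
            simp only [List.length_cons, List.length_append, List.length_nil, hv]
            congr 1
            apply sgn_congr
            exact ⟨(y.length + 1) * (x.length + q + z.length + 1) +
              (x.length + y.length + 1) * (q + 1) + y.length + 1, by ring⟩) s
        refine hP.trans ?_
        have h := lastTr_append S F (s ++ a :: x) (g v)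
        rw [h, S.τ_comm _ a]
        congr 1
        · rw [smul_smul, sgn, sgn, sgn, ← pow_add]
          congr 1
          apply sgn_congr
          simp only [List.length_nil]
          exact ⟨(x.length + 1) * (q + 1), by ring⟩
        · rw [smul_smul, sgn, sgn, sgn, ← pow_add]
          change _ • S.τ (g v * F (s ++ a :: x)) = _
          congr 1
          apply sgn_congr
          simp only [List.length_append, List.length_cons, List.length_nil, hv]
          exact ⟨s.length * (x.length + q + 1) + s.length + x.length * q + q + x.length + 1,
            by ring⟩
      · have z1 := fun (z y : List B) => (hω (y ++ a :: x) z).map_zero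
        have z2 := fun (z y : List B) => (hω' (y ++ a :: x) z).map_zero
        have z3 := (hF x s).map_zero
        simp only [hg' v hv, z1, z2, z3, smul_zero, sub_zero, splits_zero, zero_mul, map_zero]
    simp only [tel, splits_sub]
    congr 1
    have hf : MultiLin k fun l => S.τ (F l * a) := hF.comp (S.τ ∘ₗ LinearMap.mulRight k a)
    have h1 : S.T (ins g F l) a = ins g (fun l => S.τ (F l * a)) l := by
      rw [S.T_apply]
      exact (ins_map (S.τ ∘ₗ LinearMap.mulRight k a).toAddMonoidHom g F l).symm
    rw [h1, ins_eq_splits, ← splits_smul]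
    refine splits_congr fun x t _ => ?_
    rw [insHead, ← splits_smul]
    refine splits_congr fun v s _ => ?_
    rw [hg'.prn_eq]
    congr 1
    exact (zsmul_head hf x s _ (g v)).symm
  -- The terms in which `a₀` is merged with the value of `g` give the product of `g` and `Δ F`.
  have e2 : rotSum (fun y x => sgn y.length • splits (fun v z =>
      slot k (fun l => S.τ (F l)) y z ∘ₗ LinearMap.mulRight k (prn (y.length + 1) g v)) x) l a =
      sgn (q + 1) • S.T (conc g (bv S F) l) a := by
    have h1 : S.T (conc g (bv S F) l) a = splits (fun v t => splits (fun z y =>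
        sgn (y.length * (z.length + 1)) • S.τ (F (y ++ (a * g v) :: z))) t) l := by
      rw [S.T_apply]
      refine (map_splits (S.τ ∘ₗ LinearMap.mulRight k a) _ l).trans ?_
      refine splits_congr fun v t _ => ?_
      change S.τ (g v * bv S F t * a) = _
      rw [mul_assoc, S.τ_comm, mul_assoc, ← S.T_apply, T_bv, rot_apply hφ]
    have h2 : ∀ x y, splits (fun v z => slot k (fun l => S.τ (F l)) y z ∘ₗ
        LinearMap.mulRight k (prn (y.length + 1) g v)) x a = splits (fun v z =>
        sgn ((y.length + 1) * (q + 1)) • S.τ (F (y ++ (a * g v) :: z))) x := by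
      intro x y
      refine (map_splits (LinearMap.applyₗ (R := k) (M₂ := k) a).toAddMonoidHom _ x).trans ?_
      refine splits_congr fun v z _ => ?_
      change slot k (fun l => S.τ (F l)) y z (a * prn (y.length + 1) g v) = _
      rw [slot_apply hφ, hg'.prn_eq, mul_smul_comm, zsmul_head hφ]
    rw [rotSum_apply, h1]
    simp only [LinearMap.smul_apply, h2]
    simp only [smul_smul, ← splits_smul]
    rw [splits_assoc]
    refine splits_congr fun x y hxy => splits_congr fun v z h => ?_
    by_cases hv : v.length = q
    · rw [← h, List.length_append, hv, sgn, sgn, sgn, sgn, sgn, ← pow_add, ← pow_add, ← pow_add]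
      congr 1
      apply sgn_congr
      exact ⟨y.length * (q + z.length + 2) + q + 1, by ring⟩
    · have z1 : S.τ (F (y ++ 0 :: z)) = 0 := (hφ y z).map_zero
      rw [hg' v hv, mul_zero, z1, smul_zero, smul_zero]
  have e3 : rotSum (insBehind
      (fun l => -bar (0 : k →ₗ[k] B →ₗ[k] k) (fun l => S.τ (F l)) l) g) l a =
      rotSum (mergings (insBehind (fun l => S.τ (F l)) (pr g))) l a +
      rotSum (fun y x => sgn y.length • splits (fun v z =>
      slot k (fun l => S.τ (F l)) y z ∘ₗ LinearMap.mulRight k (prn (y.length + 1) g v)) x) l a := by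
    simp only [rotSum_apply, mergings_insBehind hφ hg0, LinearMap.add_apply, smul_add, splits_add]
  rw [dualCob_rotSum, map_sub, LinearMap.sub_apply, smul_sub, ← e2, eq_sub_of_add_eq e3.symm, e1]
  abel

/-- The part of the Connes operator in which the unit is not in front of the word. -/
def unitTr (F : List B → B) (l : List B) : k := S.τ (lmul (fun l => F (1 :: l)) l)

variable {S} in
lemma unitTr_multiLin {F : List B → B} (hF : MultiLin k F) : MultiLin k (unitTr S F) :=
  firstTr_multiLin (hF.cons 1)

/-- The operator `Δ` that is dual to Connes' boundary operator `(1 - t) s N` for the signed rotation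
`t`, up to sign. Its second summand, from `t s N`, vanishes on normalized cochains. -/
noncomputable def bvConnes (F : List B → B) (l : List B) : B :=
  S.T.symm (rot k (fun l => S.τ (F l) + unitTr S F l) l)

lemma T_bvConnes {F : List B → B} (hF : MultiLin k F) (l : List B) : S.T (bvConnes S F l) =
    rot k (fun l => S.τ (F l)) l + rot k (unitTr S F) l := by
  rw [← rot_add (hF.comp S.τ) (unitTr_multiLin hF)]
  exact S.T.apply_symm_apply _

lemma MultiLin.rot {φ : List B → k} (hφ : MultiLin k φ) : MultiLin k (rot k φ) :=
  MultiLin.splits (fun y x z => by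
    have : (fun u => sgn (y.length * ((x ++ u :: z).length + 1)) • slot k φ y (x ++ u :: z)) =
      fun u => sgn (y.length * (x.length + (z.length + 1) + 1)) • slot k φ y (x ++ u :: z) := by
      funext u; simp
    rw [this]
    exact isLinearMap_zsmul _ (slot_multiLin hφ y x z)) fun x y z => by
    have : (fun u => sgn ((y ++ u :: z).length * (x.length + 1)) • slot k φ (y ++ u :: z) x) =
      fun u => sgn ((y.length + (z.length + 1)) * (x.length + 1)) • slot k φ (y ++ u :: z) x := by
      funext u; simp
    rw [this]
    refine isLinearMap_zsmul _ ⟨fun u v => ?_, fun c u => ?_⟩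
    · ext a
      have := (hφ y (z ++ a :: x)).map_add u v
      simpa [slot_apply hφ] using this
    · ext a
      have := (hφ y (z ++ a :: x)).map_smul c u
      simpa [slot_apply hφ] using this

lemma MultiLin.bv {F : List B → B} (hF : MultiLin k F) : MultiLin k (bv S F) :=
  (hF.comp S.τ).rot.comp S.T.symm.toLinearMap

lemma MultiLin.bvConnes {F : List B → B} (hF : MultiLin k F) : MultiLin k (bvConnes S F) :=
  ((hF.comp S.τ).add (unitTr_multiLin hF)).rot.comp S.T.symm.toLinearMap

/-- The square of the operator vanishes because rotation sums do not change under signed rotations,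
so that the factor `1 - t` kills them. -/
lemma bvConnes_bvConnes {F : List B → B} (hF : MultiLin k F) (l : List B) :
    bvConnes S (bvConnes S F) l = 0 := by
  apply S.T.injective
  have hG := hF.bvConnes S
  have h1 := unitTr_multiLin (S := S) hG
  rw [T_bvConnes S hG, map_zero, rot_congr h1.neg (hG.comp S.τ), rot_neg h1, neg_add_cancel]
  intro w d
  change S.τ (Word.bvConnes S F (w ++ [d])) = sgn w.length • -S.τ (d * Word.bvConnes S F (1 :: w))
  have h2 : ∀ l, S.T (Word.bvConnes S F l) = rot k (fun l => S.τ (F l) + unitTr S F l) l := fun l =>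
    S.T.apply_symm_apply _
  rw [S.τ_comm, ← S.T_apply, ← mul_one (Word.bvConnes S F (w ++ [d])), ← S.T_apply, h2, h2,
    rot_cons ((hF.comp S.τ).add (unitTr_multiLin hF)), sgn_succ, neg_smul, neg_neg, smul_smul,
    sgn, ← mul_pow]
  simp

/-- For cocycles, the part of the Connes operator in which the unit is not in front of the word
is a coboundary: the cocycle condition on words `1 :: 1 :: l` expresses `F (1 :: l)` by
`F (1 :: 1 :: _)`. -/
lemma rot_unitTr {F : List B → B} (hF : MultiLin k F) (hF0 : ∀ l, cob k F l = 0) (l : List B) :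
    rot k (unitTr S F) l = S.T (cob k (fun l => -bv S (lmul fun l => F (1 :: 1 :: l)) l) l) := by
  set G : List B → B := fun l => F (1 :: 1 :: l) with hG
  have hGm : MultiLin k G := (hF.cons 1).cons 1
  have h1 : ∀ u, F (1 :: u) = -bar (LinearMap.mul k B) G u := by
    intro u
    have h := hF0 (1 :: 1 :: u)
    have h' : bar (LinearMap.mul k B) F (1 :: 1 :: u) = -F (1 :: u) -
        bar (LinearMap.mul k B) (fun l => F (1 :: l)) (1 :: u) := by
      rw [bar_cons, one_mul]
    rw [cob_cons, h', bar_tail, one_mul] at h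
    cases u with
    | nil =>
      have h2 : F [1] = 0 := by simpa [mergeFirst] using h
      simp [h2]
    | cons c u =>
      simp only [mergeFirst, one_mul] at h
      rw [eq_neg_iff_add_eq_zero, ← h]
      abel
  have h2 : unitTr S F = fun l => S.τ (cob k (lmul G) l) := by
    funext l
    rw [unitTr, cob_eq, bar_lmul]
    cases l with
    | nil => simp [lmul]
    | cons a l => simp [lmul, h1]; abel
  have h3 : bar (LinearMap.mul k B) (fun l => -bv S (lmul G) l) l =
      -bar (LinearMap.mul k B) (bv S (lmul G)) l := bar_neg _ _ _
  have h4 : lmul (fun l => -bv S (lmul G) l) l = -lmul (bv S (lmul G)) l := by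
    cases l <;> simp [lmul]
  rw [h2, cob_eq, h3, h4, ← neg_add, ← cob_eq, cob_bv S hGm.lmul, neg_neg, T_bv]

end Symmetric
end Word
end HomAssoc

namespace HomAssoc

namespace Word

/-! ### Equivariance and truncation -/

section Equivariant

variable {k B M N : Type*} [CommRing k] [Ring B] [Algebra k B] [AddCommGroup M] [Module k M]
  [AddCommGroup N] [Module k N]

/-- `F` commutes with the automorphism `σ`, acting on words letter by letter. -/
def Equivariant (σ : B ≃ₐ[k] B) (F : List B → B) : Prop := ∀ l, σ (F l) = F (l.map σ)

lemma map_splits_map (f : M →+ N) (σ : B → B) {Ψ : List B → List B → M} {Ψ' : List B → List B → N}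
    (h : ∀ x y, f (Ψ x y) = Ψ' (x.map σ) (y.map σ)) (l : List B) :
    f (splits Ψ l) = splits Ψ' (l.map σ) := by
  rw [map_splits, splits_map]
  exact splits_congr fun x y _ => h x y

lemma map_ins_map (σ : B ≃ₐ[k] B) (f : M →+ N) {F : List B → M} {F' : List B → N}
    (hF : ∀ l, f (F l) = F' (l.map σ)) {g : List B → B} (hg : Equivariant σ g) (l : List B) :
    f (ins g F l) = ins g F' (l.map σ) := by
  have head : ∀ {F : List B → M} {F' : List B → N}, (∀ l, f (F l) = F' (l.map σ)) →
      ∀ {g : List B → B}, Equivariant σ g → ∀ l, f (insHead g F l) = insHead g F' (l.map σ) :=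
    fun hF g hg l => map_splits_map f σ (fun v z => by rw [hF, List.map_cons, hg]) l
  induction l generalizing F F' g with
  | nil => exact head hF hg []
  | cons a l ih =>
    simp only [ins, map_add, List.map_cons]
    rw [head hF hg, ih (F' := fun l => F' (σ a :: l)) (fun l => by rw [hF, List.map_cons])]
    · rfl
    · intro l
      simp only [pr, map_zsmul, hg l, List.length_map]

lemma map_bar_map (σ : B ≃ₐ[k] B) {F : List B → B} (hF : Equivariant σ F) (l : List B) :
    σ (bar (LinearMap.mul k B) F l) = bar (LinearMap.mul k B) F (l.map σ) := by
  have : ∀ {F F' : List B → B}, (∀ l, σ (F l) = F' (l.map σ)) →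
      σ (bar (LinearMap.mul k B) F l) = bar (LinearMap.mul k B) F' (l.map σ) := by
    induction l with
    | nil => simp
    | cons a l ih =>
      intro F F' hF
      cases l with
      | nil => simp [hF]
      | cons b l =>
        simp only [bar_cons, List.map_cons, map_sub, map_neg, hF, map_mul] at ih ⊢
        rw [ih (F' := fun l => F' (σ a :: l)) fun l => by simp [hF]]
  exact this hF

variable {σ : B ≃ₐ[k] B} {F G g h : List B → B}

lemma Equivariant.add (hF : Equivariant σ F) (hG : Equivariant σ G) :
    Equivariant σ fun l => F l + G l := fun l => by rw [map_add, hF, hG]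

lemma Equivariant.length_smul (hF : Equivariant σ F) (s : ℕ → ℤ) :
    Equivariant σ fun l => s l.length • F l := fun l => by
  simp only [map_zsmul, hF l, List.length_map]

lemma Equivariant.pr (hF : Equivariant σ F) : Equivariant σ (pr F) :=
  hF.length_smul fun n => sgn (n + 1)

lemma Equivariant.prn (hF : Equivariant σ F) (n : ℕ) : Equivariant σ (prn n F) :=
  hF.length_smul fun m => sgn (n * (m + 1))

lemma Equivariant.lmul (hF : Equivariant σ F) : Equivariant σ (lmul F) := fun l => by
  cases l with
  | nil => exact map_zero σ
  | cons a l => simp [Word.lmul, hF l]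

lemma Equivariant.cons_one (hF : Equivariant σ F) : Equivariant σ fun l => F (1 :: l) :=
  fun l => by simp [hF (1 :: l)]

lemma Equivariant.cob (hF : Equivariant σ F) : Equivariant σ (cob k F) := fun l => by
  rw [cob_eq, cob_eq, map_add, hF.lmul, map_bar_map σ hF]

lemma Equivariant.conc (hF : Equivariant σ F) (hG : Equivariant σ G) :
    Equivariant σ (conc F G) := fun l =>
  map_splits_map (σ : B ≃+ B).toAddMonoidHom σ (Ψ := fun x y => F x * G y)
    (Ψ' := fun x y => F x * G y) (fun x y => by
      change σ (F x * G y) = _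
      rw [map_mul, hF, hG]) l

lemma Equivariant.ins (hF : Equivariant σ F) (hg : Equivariant σ g) : Equivariant σ (ins g F) :=
  fun l => map_ins_map σ (σ : B ≃+ B).toAddMonoidHom hF hg l

lemma Equivariant.ins₂ (hF : Equivariant σ F) (hg : Equivariant σ g) (hh : Equivariant σ h) :
    Equivariant σ (ins₂ g h F) := fun l => by
  have : ∀ {F F' : List B → B}, (∀ l, σ (F l) = F' (l.map σ)) → ∀ {g h : List B → B},
      Equivariant σ g → Equivariant σ h → σ (Word.ins₂ g h F l) = Word.ins₂ g h F' (l.map σ) := by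
    have tail : ∀ {F F' : List B → B}, (∀ l, σ (F l) = F' (l.map σ)) → ∀ {h : List B → B},
        Equivariant σ h → ∀ l, σ (Word.insTail h F l) = Word.insTail h F' (l.map σ) := by
      intro F F' hF h hh l
      cases l with
      | nil => exact map_zero σ
      | cons a l =>
        exact map_ins_map σ (σ : B ≃+ B).toAddMonoidHom (F' := fun l => F' (σ a :: l))
          (fun l => hF (a :: l)) hh.pr l
    have head : ∀ {F F' : List B → B}, (∀ l, σ (F l) = F' (l.map σ)) → ∀ {g : List B → B},
        Equivariant σ g → ∀ l, σ (insHead g F l) = insHead g F' (l.map σ) :=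
      fun hF g hg l => map_splits_map (σ : B ≃+ B).toAddMonoidHom σ
        (fun v z => (hF _).trans (by rw [List.map_cons, hg])) l
    induction l with
    | nil => exact fun hF g h hg hh => head (tail hF hh.pr) hg []
    | cons a l ih =>
      intro F F' hF g h hg hh
      rw [ins₂_cons, map_add, head (tail hF hh.pr) hg,
        ih (F' := fun l => F' (σ a :: l)) (fun l => hF (a :: l)) hg.pr hh.pr, List.map_cons,
        ins₂_cons]
  exact this hF hg hh

/-- The restriction of a function on words to the words of length less than `n`. -/
def trunc (n : ℕ) (F : List B → M) (l : List B) : M := if l.length < n then F l else 0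

lemma MultiLin.trunc {F : List B → M} (hF : MultiLin k F) (n : ℕ) : MultiLin k (trunc n F) := by
  intro x y
  by_cases h : x.length + (y.length + 1) < n
  · simpa [Word.trunc, h] using hF x y
  · simp only [Word.trunc, List.length_append, List.length_cons, h, if_false]
    exact (0 : B →ₗ[k] M).isLinear

lemma Equivariant.trunc (hF : Equivariant σ F) (n : ℕ) : Equivariant σ (trunc n F) := fun l => by
  simp only [Word.trunc, List.length_map]
  split_ifs
  · exact hF l
  · exact map_zero σ

lemma cob_congr {n : ℕ} (h : ∀ l, l.length = n → F l = G l) {l : List B}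
    (hl : l.length = n + 1) : cob k F l = cob k G l := by
  cases l with
  | nil => rfl
  | cons a l => rw [cob_cons, cob_cons, h l (by simpa using hl), bar_congr _ h hl]

end Equivariant

section EquivariantForm

variable {k B : Type*} [CommRing k] [Ring B] [Algebra k B] {S : SymmForm k B} {σ : B ≃ₐ[k] B}
  {F g : List B → B}

lemma map_T_symm (hS : ∀ b, S.τ (σ b) = S.τ b) {K : List B → (B →ₗ[k] k)}
    (hK : ∀ l a, K (l.map σ) (σ a) = K l a) : Equivariant σ fun l => S.T.symm (K l) := fun l => by
  apply S.T.injective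
  ext a
  obtain ⟨a, rfl⟩ := σ.surjective a
  rw [S.T.apply_symm_apply, hK, S.T_apply, ← map_mul, hS, ← S.T_apply, S.T.apply_symm_apply]

lemma rot_map {φ : List B → k} (hφ : MultiLin k φ) (hσ : ∀ l, φ (l.map σ) = φ l) (l : List B)
    (a : B) : rot k φ (l.map σ) (σ a) = rot k φ l a := by
  rw [rot_apply hφ, rot_apply hφ, splits_map]
  refine splits_congr fun x y _ => ?_
  rw [List.length_map, List.length_map, ← List.map_cons, ← List.map_append, hσ]

lemma Equivariant.bv (hF : Equivariant σ F) (hS : ∀ b, S.τ (σ b) = S.τ b)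
    (hF' : MultiLin k F) : Equivariant σ (bv S F) :=
  map_T_symm hS fun l a => rot_map (hF'.comp S.τ) (fun l => by rw [← hF, hS]) l a

lemma Equivariant.unitTr (hF : Equivariant σ F) (hS : ∀ b, S.τ (σ b) = S.τ b) (l : List B) :
    unitTr S F (l.map σ) = unitTr S F l := by
  rw [Word.unitTr, ← hF.cons_one.lmul, hS, Word.unitTr]

lemma Equivariant.bvConnes (hF : Equivariant σ F) (hS : ∀ b, S.τ (σ b) = S.τ b)
    (hF' : MultiLin k F) : Equivariant σ (bvConnes S F) :=
  map_T_symm hS fun l a => rot_map ((hF'.comp S.τ).add (unitTr_multiLin hF'))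
    (fun l => by rw [← hF, hS, hF.unitTr hS]) l a

/-- The cochain whose coboundary relates the insertion of `g` in `F` to the product of `g` and
`bv S F` and to half of the rotation sum of the product of `g` and `F`, by `dualCob_insBehind`. -/
noncomputable def bvHomotopy (S : SymmForm k B) (g F : List B → B) (l : List B) : B :=
  S.T.symm (rotSum (insBehind (fun l => S.τ (F l)) (pr g)) l)

lemma MultiLin.bvHomotopy (hF : MultiLin k F) (hg : MultiLin k g) :
    MultiLin k (Word.bvHomotopy S g F) := by
  have hφ := hF.comp S.τ
  refine MultiLin.comp (MultiLin.splits (fun y => ?_) fun x => ?_) S.T.symm.toLinearMap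
  · have h1 : MultiLin k (insBehind (fun l => S.τ (F l)) (Word.pr g) y) :=
      (slot_multiLin hφ y).ins (hg.pr.length_smul fun n => sgn ((y.length + 1) * (n + 1)))
    exact h1.length_smul fun n => sgn (y.length * (n + 1))
  · intro y z
    have hs : ∀ t, IsLinearMap k fun u => slot k (fun l => S.τ (F l)) (y ++ u :: z) t := fun t => by
      refine ⟨fun u v => ?_, fun c u => ?_⟩ <;> ext a <;>
        simp only [LinearMap.add_apply, LinearMap.smul_apply, slot_apply hφ, List.append_assoc,
          List.cons_append]
      · exact (hφ y (z ++ a :: t)).map_add u v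
      · exact (hφ y (z ++ a :: t)).map_smul c u
    have h2 := isLinearMap_zsmul (sgn ((y.length + (z.length + 1)) * (x.length + 1)))
      (isLinearMap_ins (Word.prn (y.length + (z.length + 1) + 1) (Word.pr g)) hs x)
    simpa only [insBehind, List.length_append, List.length_cons] using h2

lemma Equivariant.bvHomotopy (hF : Equivariant σ F) (hS : ∀ b, S.τ (σ b) = S.τ b)
    (hF' : MultiLin k F) (hg : Equivariant σ g) :
    Equivariant σ (bvHomotopy S g F) := by
  refine map_T_symm hS fun l a => ?_
  have h := map_splits_map (M := B →ₗ[k] k) (N := B →ₗ[k] k)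
    (LinearMap.lcomp k k σ.symm.toLinearMap).toAddMonoidHom σ
    (Ψ := fun x y => sgn (y.length * (x.length + 1)) •
      insBehind (fun l => S.τ (F l)) (Word.pr g) y x)
    (Ψ' := fun x y => sgn (y.length * (x.length + 1)) •
      insBehind (fun l => S.τ (F l)) (Word.pr g) y x) ?_ l
  · have h' := LinearMap.congr_fun h (σ a)
    refine h'.symm.trans ?_
    exact congrArg (rotSum (insBehind (fun l => S.τ (F l)) (Word.pr g)) l) (σ.symm_apply_apply a)
  · intro x y
    rw [map_zsmul]
    simp only [List.length_map]
    congr 1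
    rw [insBehind, insBehind, List.length_map]
    refine map_ins_map σ _ (fun z => ?_) (hg.pr.prn _) x
    ext b
    obtain ⟨b, rfl⟩ := σ.surjective b
    change slot k _ y z (σ.symm (σ b)) = _
    rw [σ.symm_apply_apply, slot_apply (hF'.comp S.τ), slot_apply (hF'.comp S.τ), ← hS, hF]
    simp

end EquivariantForm
end Word
end HomAssoc

namespace HomAssoc

namespace Word

/-! ### Hochschild cohomology as a quotient of functions on words -/

section Cohomology

variable {k B : Type*} [CommRing k] [Ring B] [Algebra k B]

lemma cob_add (F G : List B → B) (l : List B) :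
    cob k (fun l => F l + G l) l = cob k F l + cob k G l := by
  cases l with
  | nil => simp
  | cons a l => rw [cob_cons, cob_cons, cob_cons, bar_add, mul_add]; abel

lemma cob_smul (c : k) (F : List B → B) (l : List B) :
    cob k (fun l => c • F l) l = c • cob k F l := by
  have h := bar_map (ρ := LinearMap.mul k B) (ρ' := LinearMap.mul k B)
    (LinearMap.lsmul k B c).toAddMonoidHom (fun m a => smul_mul_assoc c m a |>.symm) F
  cases l with
  | nil => simp
  | cons a l =>
    rw [cob_cons, cob_cons, smul_add, mul_smul_comm]
    exact congrArg _ (h (a :: l))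

lemma cob_zsmul (c : ℤ) (F : List B → B) (l : List B) :
    cob k (fun l => c • F l) l = c • cob k F l := by
  cases l with
  | nil => simp
  | cons a l => rw [cob_cons, cob_cons, bar_zsmul, smul_add, mul_smul_comm]

variable (k B) in
/-- The Hochschild coboundary as a linear map. -/
def cobₗ : (List B → B) →ₗ[k] (List B → B) where
  toFun F := cob k F
  map_add' F G := funext (cob_add F G)
  map_smul' c F := funext (cob_smul c F)

/-- The multilinear functions on words that commute with `σ` and vanish on all long words. -/
def cochains (σ : B ≃ₐ[k] B) : Submodule k (List B → B) where
  carrier := {F | MultiLin k F ∧ Equivariant σ F ∧ ∃ N, ∀ l, N ≤ l.length → F l = 0}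
  add_mem' := by
    rintro F G ⟨h1, h2, N, h3⟩ ⟨h4, h5, N', h6⟩
    refine ⟨h1.add h4, h2.add h5, max N N', fun l hl => ?_⟩
    simp [h3 l (le_of_max_le_left hl), h6 l (le_of_max_le_right hl)]
  zero_mem' := ⟨fun _ _ => (0 : B →ₗ[k] B).isLinear, fun _ => map_zero σ, 0, fun _ _ => rfl⟩
  smul_mem' := by
    rintro c F ⟨h1, h2, N, h3⟩
    refine ⟨h1.comp (LinearMap.lsmul k B c), fun l => ?_, N, fun l hl => ?_⟩
    · simp [h2 l]
    · simp [h3 l hl]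

/-- The cocycles among the functions on words. -/
def cocycles (σ : B ≃ₐ[k] B) : Submodule k (List B → B) :=
  cochains σ ⊓ LinearMap.ker (cobₗ k B)

/-- The coboundaries among the functions on words. -/
def coboundaries (σ : B ≃ₐ[k] B) : Submodule k (List B → B) := (cochains σ).map (cobₗ k B)

variable {σ : B ≃ₐ[k] B} {F G E : List B → B}

lemma cob_eq_zero (hF : F ∈ cocycles σ) (l : List B) : cob k F l = 0 := congrFun hF.2 l

/-- The cochain property of a primitive `E` need only be checked up to its vanishing on long words,
since `E` can be truncated. -/
lemma mem_coboundaries (hF : F ∈ cochains σ) (h1 : MultiLin k E) (h2 : Equivariant σ E)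
    (h : ∀ l, F l = cob k E l) : F ∈ coboundaries σ := by
  obtain ⟨-, -, N, hN⟩ := hF
  refine ⟨trunc N E, ⟨h1.trunc N, h2.trunc N, N, fun l hl => if_neg (by omega)⟩,
    funext fun l => ?_⟩
  change cob k (trunc N E) l = F l
  cases l with
  | nil => exact (h []).symm
  | cons a l =>
    by_cases hl : l.length < N
    · rw [h,
        cob_congr (F := trunc N E) (G := E) (fun t ht => if_pos (by omega)) (n := l.length) rfl]
    · rw [hN (a :: l) (by simp; omega),
        cob_congr (F := trunc N E) (G := fun _ => 0) (n := l.length)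
          (fun t ht => if_neg (by omega)) rfl]
      simpa using cob_zsmul (k := k) 0 (trunc N E) (a :: l)

variable (σ) in
/-- Cocycles modulo coboundaries. -/
abbrev Coh : Type _ := cocycles σ ⧸ (coboundaries σ).submoduleOf (cocycles σ)

variable (σ) in
/-- The class of a cocycle. -/
def cls : cocycles σ →ₗ[k] Coh σ := ((coboundaries σ).submoduleOf (cocycles σ)).mkQ

lemma cls_surjective : Function.Surjective (cls σ) := Submodule.mkQ_surjective _

lemma cls_eq_zero {F : cocycles σ} : cls σ F = 0 ↔ F.1 ∈ coboundaries σ := by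
  rw [cls, Submodule.mkQ_apply, Submodule.Quotient.mk_eq_zero]; rfl

/-- A bilinear map on a module that vanishes if one argument lies in a submodule induces a bilinear
map on the quotient. -/
def liftQ₂ {Z W : Type*} [AddCommGroup Z] [Module k Z] [AddCommGroup W] [Module k W]
    (P : Submodule k Z) (b : Z →ₗ[k] Z →ₗ[k] W) (h1 : ∀ x ∈ P, ∀ y, b x y = 0)
    (h2 : ∀ x, ∀ y ∈ P, b x y = 0) : (Z ⧸ P) →ₗ[k] (Z ⧸ P) →ₗ[k] W :=
  P.liftQ (P.liftQ b.flip fun y hy => LinearMap.ext fun x => h2 x y hy).flip fun x hx =>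
    LinearMap.ext fun y => by
      obtain ⟨y, rfl⟩ := P.mkQ_surjective y
      exact h1 x hx y

lemma conc_add_right (F G G' : List B → B) : conc F (G + G') = conc F G + conc F G' := by
  funext l
  simp only [conc, Pi.add_apply, mul_add, splits_add]

lemma conc_smul_left (c : k) (F G : List B → B) : conc (c • F) G = c • conc F G := by
  funext l
  simp only [conc, Pi.smul_apply, smul_mul_assoc]
  exact (map_splits (LinearMap.lsmul k B c) _ l).symm

lemma conc_smul_right (c : k) (F G : List B → B) : conc F (c • G) = c • conc F G := by
  funext l
  simp only [conc, Pi.smul_apply, mul_smul_comm]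
  exact (map_splits (LinearMap.lsmul k B c) _ l).symm

lemma conc_mem_cochains (hF : F ∈ cochains σ) (hG : G ∈ cochains σ) : conc F G ∈ cochains σ := by
  obtain ⟨h1, h2, N, h3⟩ := hF
  obtain ⟨h4, h5, N', h6⟩ := hG
  refine ⟨h1.conc h4, h2.conc h5, N + N', fun l hl => splits_eq_zero fun x y hxy => ?_⟩
  rw [← hxy, List.length_append] at hl
  rcases le_or_gt N x.length with h | h
  · rw [h3 x h, zero_mul]
  · rw [h6 y (by omega), mul_zero]

lemma conc_zero_left (hF : ∀ l, F l = 0) (l : List B) : conc F G l = 0 :=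
  splits_eq_zero fun x y _ => by rw [hF, zero_mul]

lemma conc_zero_right (hG : ∀ l, G l = 0) (l : List B) : conc F G l = 0 :=
  splits_eq_zero fun x y _ => by rw [hG, mul_zero]

lemma pr_mem_cochains (hF : F ∈ cochains σ) : pr F ∈ cochains σ := by
  obtain ⟨h1, h2, N, h3⟩ := hF
  exact ⟨h1.pr, h2.pr, N, fun l hl => by rw [pr, h3 l hl, smul_zero]⟩

lemma conc_mem_cocycles (hF : F ∈ cocycles σ) (hG : G ∈ cocycles σ) : conc F G ∈ cocycles σ :=
  ⟨conc_mem_cochains hF.1 hG.1, funext fun l => by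
    change cob k (conc F G) l = 0
    rw [cob_conc, conc_zero_left (cob_eq_zero hF), conc_zero_right (cob_eq_zero hG),
      sub_zero]⟩

/-- The product `F ∪ G` of cocycles, in which `G` takes the first letters of the word. -/
def concₗ (σ : B ≃ₐ[k] B) : cocycles σ →ₗ[k] cocycles σ →ₗ[k] cocycles σ :=
  LinearMap.mk₂ k (fun F G => ⟨conc G.1 F.1, conc_mem_cocycles G.2 F.2⟩)
    (fun _ _ _ => Subtype.ext (conc_add_right _ _ _))
    (fun _ _ _ => Subtype.ext (conc_smul_right _ _ _))
    (fun _ _ _ => Subtype.ext (funext fun l => conc_add_left _ _ _ l))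
    (fun _ _ _ => Subtype.ext (conc_smul_left _ _ _))

/-- The product on cohomology. -/
def cupCoh (σ : B ≃ₐ[k] B) : Coh σ →ₗ[k] Coh σ →ₗ[k] Coh σ :=
  liftQ₂ _ ((concₗ σ).compr₂ (cls σ))
    (by
      rintro F ⟨E, hE, hEF⟩ G
      refine cls_eq_zero.2 ⟨-conc (pr G.1) E,
        neg_mem (conc_mem_cochains (pr_mem_cochains G.2.1) hE), funext fun l => ?_⟩
      rw [map_neg]
      change -cob k (conc (pr G.1) E) l = conc G.1 F.1 l
      rw [cob_conc, conc_zero_left (cob_pr_eq_zero (cob_eq_zero G.2)), pr_pr, zero_sub, neg_neg]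
      exact congrArg (conc G.1 · l) hEF)
    (by
      rintro F G ⟨E, hE, hEF⟩
      refine cls_eq_zero.2 ⟨conc E F.1, conc_mem_cochains hE F.2.1, funext fun l => ?_⟩
      change cob k (conc E F.1) l = conc G.1 F.1 l
      rw [cob_conc, conc_zero_right (cob_eq_zero F.2), sub_zero]
      exact congrArg (conc · F.1 l) hEF)

lemma cupCoh_cls (F G : cocycles σ) : cupCoh σ (cls σ F) (cls σ G) = cls σ (concₗ σ F G) := rfl

lemma cupCoh_assoc (x y z : Coh σ) :
    cupCoh σ (cupCoh σ x y) z = cupCoh σ x (cupCoh σ y z) := by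
  obtain ⟨F, rfl⟩ := cls_surjective x
  obtain ⟨G, rfl⟩ := cls_surjective y
  obtain ⟨H, rfl⟩ := cls_surjective z
  simp only [cupCoh_cls]
  congr 1
  exact Subtype.ext (conc_assoc H.1 G.1 F.1).symm

lemma cls_eq_zero_of_eq_cob (F : cocycles σ) (h1 : MultiLin k E)
    (h2 : Equivariant σ E) (h : ∀ l, F.1 l = cob k E l) : cls σ F = 0 :=
  cls_eq_zero.2 (mem_coboundaries F.2.1 h1 h2 h)

/-- On cohomology, the product is graded commutative; the homotopy is insertion. -/
lemma cupCoh_comm {p q : ℕ} (F G : cocycles σ) (hF : Homog p F.1) (hG : Homog q G.1) :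
    cupCoh σ (cls σ F) (cls σ G) = sgn (p * q) • cupCoh σ (cls σ G) (cls σ F) := by
  have h := cls_eq_zero_of_eq_cob (E := fun l => sgn q • ins G.1 F.1 l)
    (concₗ σ F G - sgn (p * q) • concₗ σ G F)
    ((F.2.1.1.ins G.2.1.1).length_smul fun _ => sgn q)
    ((F.2.1.2.1.ins G.2.1.2.1).length_smul fun _ => sgn q) fun l => by
      change conc G.1 F.1 l - sgn (p * q) • conc F.1 G.1 l = _
      have e1 : sgn q * sgn q = 1 := by rw [← pow_add]; exact sgn_congr (n := 0) ⟨q, by ring⟩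
      have e2 : sgn q * sgn (q * (p + 1)) = sgn (p * q) := by
        rw [← pow_add]; exact sgn_congr ⟨q + q * p, by ring⟩
      rw [cob_zsmul, cob_ins_cocycles F.2.1.1 hF (cob_eq_zero F.2) hG (cob_eq_zero G.2), smul_sub,
        smul_smul, smul_smul, e1, e2, one_smul]
  rwa [map_sub, map_zsmul, sub_eq_zero] at h

/-- The operator `pr`, the sign `(-1)^(n+1)` in degree `n`, on cocycles. -/
def prₗ (σ : B ≃ₐ[k] B) : cocycles σ →ₗ[k] cocycles σ where
  toFun F := ⟨pr F.1, pr_mem_cochains F.2.1, funext (cob_pr_eq_zero (cob_eq_zero F.2))⟩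
  map_add' _ _ := Subtype.ext (funext fun _ => smul_add _ _ _)
  map_smul' _ _ := Subtype.ext (funext fun _ => smul_comm _ _ _)

/-- The operator `pr`, the sign `(-1)^(n+1)` in degree `n`, on cohomology. -/
def prCoh (σ : B ≃ₐ[k] B) : Coh σ →ₗ[k] Coh σ :=
  Submodule.liftQ _ (cls σ ∘ₗ prₗ σ) fun F hF => by
    obtain ⟨E, hE, hEF⟩ := hF
    refine cls_eq_zero.2 ⟨-pr E, neg_mem (pr_mem_cochains hE), ?_⟩
    rw [map_neg]
    have h := pr_cob (k := k) E
    change -cob k (pr E) = pr F.1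
    rw [← show cob k E = F.1 from hEF, h]
    rfl

lemma prCoh_cls (F : cocycles σ) : prCoh σ (cls σ F) = cls σ (prₗ σ F) := rfl

lemma prCoh_homog {p : ℕ} (F : cocycles σ) (hF : Homog p F.1) :
    prCoh σ (cls σ F) = sgn (p + 1) • cls σ F := by
  rw [prCoh_cls, ← map_zsmul]
  congr 1
  exact Subtype.ext hF.pr_eq

end Cohomology

section BV

variable {k B : Type*} [CommRing k] [Ring B] [Algebra k B] {S : SymmForm k B} {σ : B ≃ₐ[k] B}
  {F G : List B → B}

lemma T_bv_apply (hF : MultiLin k F) (l : List B) (a : B) : S.T (bv S F l) a =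
    splits (fun x y => sgn (y.length * (x.length + 1)) • S.τ (F (y ++ a :: x))) l := by
  rw [T_bv, rot_apply (hF.comp S.τ)]

lemma bv_add (hF : MultiLin k F) (hG : MultiLin k G) (l : List B) :
    bv S (fun l => F l + G l) l = bv S F l + bv S G l := by
  apply S.T.injective
  ext a
  simp only [map_add, LinearMap.add_apply, T_bv_apply hF, T_bv_apply hG, T_bv_apply (hF.add hG),
    smul_add, splits_add]

lemma bv_smul (hF : MultiLin k F) (c : k) (l : List B) :
    bv S (fun l => c • F l) l = c • bv S F l := by
  apply S.T.injective
  ext a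
  have hF' : MultiLin k fun l => c • F l := hF.comp (LinearMap.lsmul k B c)
  rw [map_smul, LinearMap.smul_apply, T_bv_apply hF', T_bv_apply hF]
  refine Eq.trans ?_ (map_splits (LinearMap.lsmul k k c) _ l).symm
  refine splits_congr fun x y _ => ?_
  rw [map_smul, map_zsmul]
  rfl

lemma bv_pr (hF : MultiLin k F) : bv S (pr F) = fun l => -pr (bv S F) l := by
  funext l
  apply S.T.injective
  ext a
  rw [pr, map_neg, map_zsmul, LinearMap.neg_apply, LinearMap.smul_apply, T_bv_apply hF.pr,
    T_bv_apply hF, ← splits_smul, ← splits_neg]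
  refine splits_congr fun x y h => ?_
  rw [pr, map_zsmul, smul_comm, ← neg_smul, ← sgn_succ, ← h]
  congr 2
  simp only [List.length_append, List.length_cons]
  ring

lemma Homog.bv {n : ℕ} (hF : Homog n F) (hF' : MultiLin k F) (l : List B) (hl : l.length + 1 ≠ n) :
    bv S F l = 0 := by
  apply S.T.injective
  ext a
  rw [T_bv_apply hF', map_zero]
  refine splits_eq_zero fun x y h => ?_
  rw [hF _ ?_, map_zero, smul_zero]
  rw [← h] at hl
  simp only [List.length_append, List.length_cons] at hl ⊢
  omega

lemma Homog.bvConnes {n : ℕ} {F : List B → B} (hF : Homog (n + 1) F) (hF' : MultiLin k F) :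
    Homog n (bvConnes S F) := fun l hl => by
  have h1 : Homog (n + 1) fun l => F l + lmul (fun l => F (1 :: l)) l := fun l hl => by
    refine (congrArg (· + _) (hF l hl)).trans ((zero_add _).trans ?_)
    cases l with
    | nil => rfl
    | cons a l => rw [lmul, hF _ (by simpa using hl), mul_zero]
  refine Eq.trans ?_ (h1.bv (S := S) (hF'.add (hF'.cons 1).lmul) l (by omega))
  simp only [Word.bvConnes, Word.bv, unitTr, map_add]

lemma bv_mem_cochains (hS : ∀ b, S.τ (σ b) = S.τ b) (hF : F ∈ cochains σ) :
    bv S F ∈ cochains σ := by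
  obtain ⟨h1, h2, N, h3⟩ := hF
  refine ⟨h1.bv S, h2.bv hS h1, N, fun l hl => ?_⟩
  apply S.T.injective
  ext a
  rw [T_bv_apply h1, map_zero]
  refine splits_eq_zero fun x y h => ?_
  rw [h3 _ ?_, map_zero, smul_zero]
  rw [← h] at hl
  simp only [List.length_append, List.length_cons] at hl ⊢
  omega

lemma bv_zero (h : ∀ l, F l = 0) (l : List B) : bv S F l = 0 := by
  have hF : MultiLin k F := by
    rw [show F = fun _ => 0 from funext h]
    exact fun _ _ => (0 : B →ₗ[k] B).isLinear
  apply S.T.injective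
  ext a
  rw [T_bv_apply hF, map_zero]
  exact splits_eq_zero fun x y _ => by rw [h, map_zero, smul_zero]

lemma bv_mem_cocycles (hS : ∀ b, S.τ (σ b) = S.τ b) (hF : F ∈ cocycles σ) :
    bv S F ∈ cocycles σ :=
  ⟨bv_mem_cochains hS hF.1, funext fun l => by
    change cob k (bv S F) l = 0
    rw [cob_bv S hF.1.1, bv_zero (cob_eq_zero hF), neg_zero]⟩

/-- The operator `bv` on cocycles. -/
noncomputable def bvₗ (hS : ∀ b, S.τ (σ b) = S.τ b) : cocycles σ →ₗ[k] cocycles σ where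
  toFun F := ⟨bv S F.1, bv_mem_cocycles hS F.2⟩
  map_add' F G := Subtype.ext (funext (bv_add F.2.1.1 G.2.1.1))
  map_smul' c F := Subtype.ext (funext (bv_smul F.2.1.1 c))

lemma bvₗ_eq_zero (hS : ∀ b, S.τ (σ b) = S.τ b) {F : cocycles σ} (hF : Homog 0 F.1) :
    bvₗ hS F = 0 :=
  Subtype.ext (funext fun l => hF.bv F.2.1.1 l (Nat.succ_ne_zero _))

/-- The operator `bv` on cohomology. -/
noncomputable def bvCoh (hS : ∀ b, S.τ (σ b) = S.τ b) : Coh σ →ₗ[k] Coh σ :=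
  Submodule.liftQ _ (cls σ ∘ₗ bvₗ hS) fun F hF => by
    obtain ⟨E, hE, hEF⟩ := hF
    refine cls_eq_zero.2 ⟨-bv S E, neg_mem (bv_mem_cochains hS hE), funext fun l => ?_⟩
    rw [map_neg]
    change -cob k (bv S E) l = bv S F.1 l
    rw [cob_bv S hE.1, neg_neg, show cob k E = F.1 from hEF]

lemma bvCoh_cls (hS : ∀ b, S.τ (σ b) = S.τ b) (F : cocycles σ) :
    bvCoh hS (cls σ F) = cls σ (bvₗ hS F) := rfl

end BV
end Word
end HomAssoc

namespace HomAssoc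

namespace Word

/-! ### The Gerstenhaber bracket and the BV operator on cohomology -/

section Bracket

variable {k B : Type*} [CommRing k] [Ring B] [Algebra k B] {σ : B ≃ₐ[k] B}

lemma sgn_mul_sgn {a b c : ℕ} (h : Even (a + b + c)) : sgn a * sgn b = sgn c := by
  rw [← pow_add]; exact sgn_congr h

lemma ins_mem_cochains {p q : ℕ} {F g : List B → B} (hF : F ∈ cochains σ) (hF' : Homog p F)
    (hg : g ∈ cochains σ) (hg' : Homog q g) : ins g F ∈ cochains σ :=
  ⟨hF.1.ins hg.1, hF.2.1.ins hg.2.1, p + q, fun l hl => hF'.ins hF.1 hg' l (by omega)⟩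

/-- The Gerstenhaber bracket of homogeneous cocycles. -/
def gerst {p q : ℕ} (F G : cocycles σ) (hF : Homog p F.1) (hG : Homog q G.1) : cocycles σ :=
  ⟨fun l => ins G.1 F.1 l - sgn ((p + 1) * (q + 1)) • ins F.1 G.1 l,
    sub_mem (ins_mem_cochains F.2.1 hF G.2.1 hG)
      (zsmul_mem (ins_mem_cochains G.2.1 hG F.2.1 hF) _), by
    change cobₗ k B (ins G.1 F.1 - sgn ((p + 1) * (q + 1)) • ins F.1 G.1) = 0
    rw [map_sub, map_zsmul]
    funext l
    change cob k (ins G.1 F.1) l - sgn ((p + 1) * (q + 1)) • cob k (ins F.1 G.1) l = 0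
    have e1 : sgn ((p + 1) * (q + 1)) * sgn p = -sgn (q * (p + 1)) := by
      rw [← sgn_succ]; exact sgn_mul_sgn ⟨p * q + q + p + 1, by ring⟩
    have e2 : sgn ((p + 1) * (q + 1)) * sgn (p * (q + 1)) = -sgn q := by
      rw [← sgn_succ]; exact sgn_mul_sgn ⟨p * q + p + q + 1, by ring⟩
    rw [cob_ins_cocycles F.2.1.1 hF (cob_eq_zero F.2) hG (cob_eq_zero G.2),
      cob_ins_cocycles G.2.1.1 hG (cob_eq_zero G.2) hF (cob_eq_zero F.2), smul_sub, smul_smul,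
      smul_smul, e1, e2, neg_smul, neg_smul]
    abel⟩

/-- The Leibniz rule for the Gerstenhaber bracket and the product; the homotopy is the double
insertion. -/
lemma cls_gerst_conc {p q r : ℕ} (F G H : cocycles σ) (hF : Homog p F.1) (hG : Homog q G.1)
    (hH : Homog r H.1) (hGH : Homog (q + r) (concₗ σ G H).1) :
    cls σ (gerst F (concₗ σ G H) hF hGH) =
      cupCoh σ (cls σ (gerst F G hF hG)) (cls σ H) +
        sgn ((p + 1) * q) • cupCoh σ (cls σ G) (cls σ (gerst F H hF hH)) := by
  rw [cupCoh_cls, cupCoh_cls, ← map_zsmul, ← map_add, ← sub_eq_zero, ← map_sub]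
  refine cls_eq_zero_of_eq_cob (E := fun l => sgn (r + q) • ins₂ H.1 G.1 F.1 l) _
    ((F.2.1.1.ins₂ H.2.1.1 G.2.1.1).length_smul fun _ => sgn (r + q))
    ((F.2.1.2.1.ins₂ H.2.1.2.1 G.2.1.2.1).length_smul fun _ => sgn (r + q)) fun l => ?_
  rw [cob_zsmul, cob_ins₂_cocycles F.2.1.1 hF (cob_eq_zero F.2) hH (cob_eq_zero H.2) G.2.1.1 hG
    (cob_eq_zero G.2)]
  have h1 := ins_conc_homog G.2.1.1 hH hF l
  have h2 : ∀ c : ℤ, conc H.1 (fun l => ins G.1 F.1 l - c • ins F.1 G.1 l) l =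
      conc H.1 (ins G.1 F.1) l - c • conc H.1 (ins F.1 G.1) l := fun c => by
    simp only [conc, mul_sub, splits_sub, mul_smul_comm, splits_smul]
  have h3 : ∀ c : ℤ, conc (fun l => ins H.1 F.1 l - c • ins F.1 H.1 l) G.1 l =
      conc (ins H.1 F.1) G.1 l - c • conc (ins F.1 H.1) G.1 l := fun c => by
    simp only [conc, sub_mul, splits_sub, smul_mul_assoc, splits_smul]
  change (ins (conc H.1 G.1) F.1 l - sgn ((p + 1) * (q + r + 1)) • ins F.1 (conc H.1 G.1) l) -
    (conc H.1 (fun l => ins G.1 F.1 l - sgn ((p + 1) * (q + 1)) • ins F.1 G.1 l) l +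
      sgn ((p + 1) * q) •
        conc (fun l => ins H.1 F.1 l - sgn ((p + 1) * (r + 1)) • ins F.1 H.1 l) G.1 l) = _
  have e1 : sgn ((p + 1) * (q + r + 1)) * sgn (r * (p + 1)) = sgn ((p + 1) * (q + 1)) :=
    sgn_mul_sgn ⟨(p + 1) * (q + r + 1), by ring⟩
  have e2 : sgn ((p + 1) * q) * sgn ((p + 1) * (r + 1)) = sgn ((p + 1) * (q + r + 1)) :=
    sgn_mul_sgn ⟨(p + 1) * (q + r + 1), by ring⟩
  have e3 : sgn (q * (p + 1)) = sgn ((p + 1) * q) := by rw [mul_comm]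
  rw [h1, h2, h3, smul_add, smul_sub, smul_smul, smul_smul, e1, e2, e3]
  abel

end Bracket

section BV

variable {k B : Type*} [CommRing k] [Ring B] [Algebra k B] {S : SymmForm k B} {σ : B ≃ₐ[k] B}
  (hS : ∀ b, S.τ (σ b) = S.τ b)

lemma prCoh_bvCoh (x : Coh σ) : prCoh σ (bvCoh hS x) = -bvCoh hS (prCoh σ x) := by
  obtain ⟨F, rfl⟩ := cls_surjective x
  rw [bvCoh_cls, prCoh_cls, prCoh_cls, bvCoh_cls, ← map_neg]
  congr 1
  refine Subtype.ext ?_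
  change pr (bv S F.1) = -bv S (pr F.1)
  rw [bv_pr F.2.1.1]
  funext l
  simp

/-- On cocycles, the two forms of the BV operator agree up to a coboundary. -/
lemma exists_bvConnes (F : cocycles σ) :
    ∃ F' : cocycles σ, F'.1 = bvConnes S F.1 ∧ cls σ F' = bvCoh hS (cls σ F) := by
  set E : List B → B := fun l => -bv S (lmul fun l => F.1 (1 :: 1 :: l)) l with hE
  have hm : MultiLin k (lmul fun l => F.1 (1 :: 1 :: l)) := ((F.2.1.1.cons 1).cons 1).lmul
  have h1 : E ∈ cochains σ := by
    refine neg_mem (bv_mem_cochains hS ⟨hm, F.2.1.2.1.cons_one.cons_one.lmul, ?_⟩)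
    obtain ⟨N, hN⟩ := F.2.1.2.2
    refine ⟨N + 1, fun l hl => ?_⟩
    cases l with
    | nil => rfl
    | cons a l =>
      simp only [List.length_cons] at hl
      rw [lmul, hN _ (by simp; omega), mul_zero]
  have h2 : cobₗ k B E ∈ coboundaries σ := ⟨E, h1, rfl⟩
  have h3 : cobₗ k B E ∈ cocycles σ :=
    ⟨⟨h1.1.cob, h1.2.1.cob, by
      obtain ⟨N, hN⟩ := h1.2.2
      refine ⟨N + 1, fun l hl => ?_⟩
      change cob k E l = 0
      cases l with
      | nil => rfl
      | cons a l =>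
        rw [cob_congr (F := E) (G := fun _ => 0) (n := l.length)
          (fun t ht => hN t (by simp at hl; omega)) rfl]
        simpa using cob_zsmul (k := k) 0 E (a :: l)⟩, funext (cob_cob E)⟩
  refine ⟨bvₗ hS F + ⟨_, h3⟩, funext fun l => ?_, ?_⟩
  · change bv S F.1 l + cob k E l = bvConnes S F.1 l
    apply S.T.injective
    rw [map_add, T_bvConnes S F.2.1.1, T_bv, rot_unitTr S F.2.1.1 (cob_eq_zero F.2)]
  · rw [map_add, (cls_eq_zero (F := ⟨_, h3⟩)).2 h2, add_zero, bvCoh_cls]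

lemma bvCoh_bvCoh (x : Coh σ) : bvCoh hS (bvCoh hS x) = 0 := by
  obtain ⟨F, rfl⟩ := cls_surjective x
  obtain ⟨F', h1, h2⟩ := exists_bvConnes hS F
  obtain ⟨F'', h3, h4⟩ := exists_bvConnes hS F'
  rw [← h2, ← h4]
  refine (congrArg (cls σ) (Subtype.ext ?_)).trans (map_zero _)
  rw [h3, h1]
  exact funext (bvConnes_bvConnes S F.2.1.1)

/-- The BV operator `Δ` on cohomology. -/
noncomputable def deltaCoh : Coh σ →ₗ[k] Coh σ := prCoh σ ∘ₗ bvCoh hS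

lemma deltaCoh_deltaCoh (x : Coh σ) : deltaCoh hS (deltaCoh hS x) = 0 := by
  simp only [deltaCoh, LinearMap.comp_apply]
  rw [prCoh_bvCoh hS x, map_neg, bvCoh_bvCoh hS, neg_zero, map_zero]

lemma deltaCoh_homog {p : ℕ} (F : cocycles σ) (hF : Homog p F.1) :
    deltaCoh hS (cls σ F) = sgn p • bvCoh hS (cls σ F) := by
  rw [deltaCoh, LinearMap.comp_apply, prCoh_bvCoh, prCoh_homog _ hF, map_zsmul, ← neg_smul,
    sgn_succ, neg_neg]

/-- The bracket that is given by the BV formula. -/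
noncomputable def brCoh : Coh σ →ₗ[k] Coh σ →ₗ[k] Coh σ :=
  (cupCoh σ ∘ₗ prCoh σ).compr₂ (deltaCoh hS) - cupCoh σ ∘ₗ deltaCoh hS ∘ₗ prCoh σ +
    (cupCoh σ).compl₂ (deltaCoh hS)

lemma brCoh_apply (x y : Coh σ) : brCoh hS x y = deltaCoh hS (cupCoh σ (prCoh σ x) y) -
    cupCoh σ (deltaCoh hS (prCoh σ x)) y + cupCoh σ x (deltaCoh hS y) := rfl

/-- The Gerstenhaber bracket in terms of the operator `bv`: the trace of the product is the sum of
two half rotation sums, and by `bvHomotopy` each of them is an insertion minus a product, up to a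
coboundary. -/
lemma cls_gerst {p q : ℕ} (F G : cocycles σ) (hF : Homog p F.1) (hG : Homog q G.1) :
    cls σ (gerst F G hF hG) = sgn (q + 1) • bvCoh hS (cupCoh σ (cls σ F) (cls σ G)) +
      cupCoh σ (bvCoh hS (cls σ F)) (cls σ G) -
        sgn ((p + 1) * (q + 1)) • cupCoh σ (bvCoh hS (cls σ G)) (cls σ F) := by
  have half : ∀ {p q : ℕ} (F G : cocycles σ), Homog p F.1 → Homog q G.1 → ∀ l a,
      halfRot S G.1 F.1 l a = S.T (sgn (q + 1) • (ins G.1 F.1 l - conc G.1 (bv S F.1) l) -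
        cob k (bvHomotopy S G.1 F.1) l) a := fun F G hF hG l a => by
    have h := dualCob_insBehind S F.2.1.1 (cob_eq_zero F.2) hG (cob_eq_zero G.2) l a
    have h' := T_cob S (bvHomotopy S G.1 F.1) l
    simp only [bvHomotopy, S.T.apply_symm_apply] at h'
    rw [map_sub, map_zsmul, LinearMap.sub_apply, LinearMap.smul_apply]
    rw [h', h]
    abel
  have key : ∀ l, bv S (conc G.1 F.1) l =
      sgn (q + 1) • (ins G.1 F.1 l - conc G.1 (bv S F.1) l) - cob k (bvHomotopy S G.1 F.1) l +
      sgn (p * q) • (sgn (p + 1) • (ins F.1 G.1 l - conc F.1 (bv S G.1) l) -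
        cob k (bvHomotopy S F.1 G.1) l) := fun l => by
    apply S.T.injective
    ext a
    rw [T_bv, rot_tr_conc S F.2.1.1 G.2.1.1 hF hG, half F G hF hG, half G F hG hF, map_add,
      map_zsmul, LinearMap.add_apply, LinearMap.smul_apply]
  rw [bvCoh_cls, bvCoh_cls, cupCoh_cls, cupCoh_cls, cupCoh_cls, bvCoh_cls,
    ← map_zsmul (cls σ), ← map_zsmul (cls σ), ← map_add (cls σ), ← map_sub, ← sub_eq_zero,
    ← map_sub]
  have hE := (F.2.1.1.bvHomotopy (S := S) G.2.1.1).add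
    ((G.2.1.1.bvHomotopy (S := S) F.2.1.1).length_smul fun _ => sgn (p * q))
  have hE' := (F.2.1.2.1.bvHomotopy hS F.2.1.1 G.2.1.2.1).add
    ((G.2.1.2.1.bvHomotopy hS G.2.1.1 F.2.1.2.1).length_smul fun _ => sgn (p * q))
  refine cls_eq_zero_of_eq_cob (E := fun l => sgn (q + 1) • (bvHomotopy S G.1 F.1 l +
    sgn (p * q) • bvHomotopy S F.1 G.1 l)) _ (hE.length_smul fun _ => sgn (q + 1))
    (hE'.length_smul fun _ => sgn (q + 1)) fun l => ?_
  change (ins G.1 F.1 l - sgn ((p + 1) * (q + 1)) • ins F.1 G.1 l) -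
    (sgn (q + 1) • bv S (conc G.1 F.1) l + conc G.1 (bv S F.1) l -
      sgn ((p + 1) * (q + 1)) • conc F.1 (bv S G.1) l) = _
  have e1 : sgn (q + 1) * sgn (q + 1) = sgn 0 := sgn_mul_sgn ⟨q + 1, by ring⟩
  have e2 : sgn (q + 1) * (sgn (p * q) * sgn (p + 1)) = -sgn ((p + 1) * (q + 1)) := by
    rw [← sgn_succ, ← pow_add]; exact sgn_mul_sgn ⟨p * q + p + q + 2, by ring⟩
  rw [cob_zsmul, cob_add, cob_zsmul, key]
  simp only [smul_add, smul_sub, smul_smul, e1, e2, pow_zero, one_smul, neg_smul]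
  abel

/-- The Gerstenhaber bracket satisfies the BV formula. -/
lemma brCoh_eq {p q : ℕ} (F G : cocycles σ) (hF : Homog p F.1) (hG : Homog q G.1) :
    brCoh hS (cls σ F) (cls σ G) = cls σ (gerst F G hF hG) := by
  have hFG : Homog (p + q) (concₗ σ F G).1 := add_comm q p ▸ hG.conc hF
  have h1 : deltaCoh hS (cupCoh σ (cls σ F) (cls σ G)) =
      sgn (p + q) • bvCoh hS (cupCoh σ (cls σ F) (cls σ G)) := by
    rw [cupCoh_cls, deltaCoh_homog hS _ hFG]
  have h3 : cupCoh σ (cls σ F) (deltaCoh hS (cls σ G)) =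
      -(sgn ((p + 1) * (q + 1)) • cupCoh σ (bvCoh hS (cls σ G)) (cls σ F)) := by
    rw [deltaCoh_homog hS G hG, map_zsmul, bvCoh_cls]
    obtain rfl | ⟨m, rfl⟩ : q = 0 ∨ ∃ m, q = m + 1 := by cases q <;> simp
    · rw [bvₗ_eq_zero hS hG]
      simp
    · have hm : Homog m (bvₗ hS G).1 := fun l hl => hG.bv G.2.1.1 l (by omega)
      have e : sgn (m + 1) * sgn (p * m) = -sgn ((p + 1) * (m + 1 + 1)) := by
        rw [← sgn_succ]; exact sgn_mul_sgn ⟨p * m + m + p + 2, by ring⟩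
      rw [cupCoh_comm F (bvₗ hS G) hF hm, smul_smul, e, neg_smul]
  have e1 : sgn (p + 1) * sgn (p + q) = sgn (q + 1) := sgn_mul_sgn ⟨p + q + 1, by ring⟩
  have e2 : sgn (p + 1) * sgn p = -sgn 0 := by
    rw [← sgn_succ]; exact sgn_mul_sgn ⟨p + 1, by ring⟩
  rw [cls_gerst hS, brCoh_apply, prCoh_homog F hF, h3, map_zsmul, LinearMap.smul_apply, map_zsmul,
    h1, map_zsmul, deltaCoh_homog hS F hF, smul_smul, smul_smul, e1, e2]
  simp only [pow_zero, neg_smul, one_smul, map_neg, LinearMap.neg_apply]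
  abel

end BV
end Word
end HomAssoc

namespace HomAssoc

namespace RegularUnitalHomAssocAlgebra

open Word

/-! ### Untwisting a regular unital hom-associative algebra -/

section Untwist

variable {k A : Type*} [CommRing k] [AddCommGroup A] [Module k A]
  (R : RegularUnitalHomAssocAlgebra k A)

/-- The product `a * b = α⁻¹ (a · b)`. -/
noncomputable def untwistedMul : A →ₗ[k] A →ₗ[k] A := R.mul.compr₂ (R.tw ^ (-1 : ℤ)).toLinearMap

lemma untwistedMul_apply (a b : A) : R.untwistedMul a b = (R.tw ^ (-1 : ℤ)) (R.mul a b) := rfl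

lemma untwistedMul_assoc (a b c : A) : R.untwistedMul (R.untwistedMul a b) c =
    R.untwistedMul a (R.untwistedMul b c) := by
  have h := R.hom_assoc ((R.tw ^ (-1 : ℤ)) a) ((R.tw ^ (-1 : ℤ)) b) ((R.tw ^ (-1 : ℤ)) c)
  rw [← tw_zpow_α, ← tw_zpow_α, tw_zpow_α_add, tw_zpow_α_add] at h
  norm_num at h
  simp only [untwistedMul_apply]
  rw [tw_zpow_mul _ _ a b, tw_zpow_mul _ _ b c]
  norm_num
  rw [h]

lemma one_untwistedMul (a : A) : R.untwistedMul R.one a = a := by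
  rw [untwistedMul_apply, R.one_mul, tw_zpow_α_add]; simp

lemma untwistedMul_one (a : A) : R.untwistedMul a R.one = a := by
  rw [untwistedMul_apply, R.mul_one, tw_zpow_α_add]; simp

lemma α_untwistedMul (a b : A) :
    R.α (R.untwistedMul a b) = R.untwistedMul (R.α a) (R.α b) := by
  rw [untwistedMul_apply, untwistedMul_apply, ← tw_zpow_α, R.α_mul]

lemma α_untwistedMul_eq_mul (a b : A) : R.α (R.untwistedMul a b) = R.mul a b := by
  rw [untwistedMul_apply, ← tw_zpow_α, tw_zpow_α_add]; simp

/-- The underlying module of `R`, with the multiplication `a * b = α⁻¹ (a · b)`, for which it is an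
associative unital algebra. -/
def Untwisted (_ : RegularUnitalHomAssocAlgebra k A) : Type _ := A

instance : AddCommGroup R.Untwisted := inferInstanceAs (AddCommGroup A)

noncomputable instance : Ring R.Untwisted :=
  { (inferInstance : AddCommGroup R.Untwisted) with
    mul := fun a b => R.untwistedMul a b
    one := R.one
    mul_assoc := R.untwistedMul_assoc
    one_mul := R.one_untwistedMul
    mul_one := R.untwistedMul_one
    left_distrib := fun a b c => (R.untwistedMul a).map_add b c
    right_distrib := fun a b c => R.untwistedMul.map_add₂ a b c
    zero_mul := fun a => R.untwistedMul.map_zero₂ a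
    mul_zero := fun a => (R.untwistedMul a).map_zero }

instance : Module k R.Untwisted := inferInstanceAs (Module k A)

noncomputable instance : Algebra k R.Untwisted :=
  Algebra.ofModule (fun c a b => R.untwistedMul.map_smul₂ c a b)
    (fun c a b => (R.untwistedMul a).map_smul c b)

/-- An associative unital algebra `B` with an automorphism `σ` from which `R` arises by twisting:
`α = σ` and `a · b = σ (a b)`. -/
structure Untwisting (B : Type*) [Ring B] [Algebra k B] where
  e : A ≃ₗ[k] B
  σ : B ≃ₐ[k] B
  map_α : ∀ a, e (R.α a) = σ (e a)
  map_mul : ∀ a b, e (R.mul a b) = σ (e a * e b)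
  map_one : e R.one = 1

/-- The identification of `A` with the untwisted algebra. -/
def untwistEquiv : A ≃ₗ[k] R.Untwisted where
  toFun a := a
  invFun a := a
  map_add' _ _ := rfl
  map_smul' _ _ := rfl
  left_inv _ := rfl
  right_inv _ := rfl

/-- The untwisted algebra is an untwisting. -/
noncomputable def untwisting : R.Untwisting R.Untwisted where
  e := R.untwistEquiv
  σ := AlgEquiv.ofLinearEquiv (R.untwistEquiv.symm ≪≫ₗ R.tw ≪≫ₗ R.untwistEquiv) R.α_one
    R.α_untwistedMul
  map_α _ := rfl
  map_mul a b := (R.α_untwistedMul_eq_mul a b).symm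
  map_one := rfl

end Untwist

end RegularUnitalHomAssocAlgebra
end HomAssoc

namespace HomAssoc

namespace RegularUnitalHomAssocAlgebra

open Word

/-! ### Cochains as functions on words -/

namespace Untwisting

variable {k A B : Type*} [CommRing k] [AddCommGroup A] [Module k A] [Ring B] [Algebra k B]
  {R : RegularUnitalHomAssocAlgebra k A} (U : R.Untwisting B)

/-- The word in `B` that is given by a tuple in `A`. -/
def list {n : ℕ} (a : Fin n → A) : List B := List.ofFn fun i => U.e (a i)

@[simp] lemma length_list {n : ℕ} (a : Fin n → A) : (U.list a).length = n := List.length_ofFn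

lemma exists_list {n : ℕ} {l : List B} (hl : l.length = n) : ∃ a : Fin n → A, U.list a = l := by
  subst hl
  exact ⟨fun i => U.e.symm (l.get i), by simp [list]⟩

lemma map_list {n : ℕ} (a : Fin n → A) : (U.list a).map U.σ = U.list fun i => R.α (a i) := by
  simp [list, List.map_ofFn, Function.comp_def, U.map_α]

lemma e_tw_mul (z : ℤ) (a b : A) : U.e ((R.tw ^ z) (R.mul a b)) =
    U.e ((R.tw ^ (z + 1)) a) * U.e ((R.tw ^ (z + 1)) b) := by
  rw [tw_zpow_mul, U.map_mul, _root_.map_mul, ← U.map_α, ← U.map_α, ← tw_zpow_α, ← tw_zpow_α,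
    tw_zpow_α_add, tw_zpow_α_add]

/-- The function on words of length `n` that corresponds to a multilinear map: the values are
twisted by `α^(1-n)`, which turns the partial compositions into untwisted ones. -/
noncomputable def word {n : ℕ} (f : MultilinearMap k (fun _ : Fin n => A) A) (l : List B) : B :=
  if h : l.length = n then
    U.e ((R.tw ^ (1 - (n : ℤ))) (f fun i => U.e.symm (l.get (i.cast h.symm)))) else 0

lemma word_list {n : ℕ} (f : MultilinearMap k (fun _ : Fin n => A) A) (a : Fin n → A) :
    U.word f (U.list a) = U.e ((R.tw ^ (1 - (n : ℤ))) (f a)) := by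
  rw [word, dif_pos (U.length_list a)]
  simp only [list, List.get_ofFn, LinearEquiv.symm_apply_apply]
  rfl

lemma homog_word {n : ℕ} (f : MultilinearMap k (fun _ : Fin n => A) A) : Homog n (U.word f) :=
  fun _ h => dif_neg h

lemma list_update {n : ℕ} (a : Fin n → A) (s : Fin n) (x : A) :
    U.list (Function.update a s x) =
      (U.list a).take s ++ U.e x :: (U.list a).drop (s + 1) := by
  have h : s < (U.list a).length := by simp
  have h' := List.set_eq_take_append_cons_drop (l := U.list a) (i := s) (a := U.e x)
  rw [if_pos h] at h'
  rw [← h']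
  apply List.ext_getElem
  · simp
  · intro j h1 h2
    rw [List.getElem_set]
    simp only [list, List.getElem_ofFn, Function.update_apply, Fin.ext_iff]
    split_ifs <;> first | rfl | omega

lemma multiLin_word {n : ℕ} (f : MultilinearMap k (fun _ : Fin n => A) A) :
    MultiLin k (U.word f) := by
  intro x y
  by_cases hn : (x ++ (0 : B) :: y).length = n
  · obtain ⟨a, ha⟩ := U.exists_list hn
    have hs : x.length < n := by rw [← hn]; simp
    have key : ∀ u, U.word f (x ++ u :: y) =
        U.e ((R.tw ^ (1 - (n : ℤ))) (f.toLinearMap a ⟨x.length, hs⟩ (U.e.symm u))) := fun u => by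
      rw [MultilinearMap.toLinearMap_apply, ← word_list, list_update, ha]
      simp
    simp only [key]
    exact (U.e.toLinearMap ∘ₗ (R.tw ^ (1 - (n : ℤ))).toLinearMap ∘ₗ
      f.toLinearMap a ⟨x.length, hs⟩ ∘ₗ U.e.symm.toLinearMap).isLinear
  · have key : ∀ u, U.word f (x ++ u :: y) = 0 := fun u =>
      U.homog_word f _ (by simpa using hn)
    simp only [key]
    exact (0 : B →ₗ[k] B).isLinear

lemma equivariant_word {n : ℕ} (f : R.Cochain R.self n) :
    Equivariant U.σ (U.word f.1) := fun l => by
  by_cases hl : l.length = n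
  · obtain ⟨a, rfl⟩ := U.exists_list hl
    rw [map_list, word_list, word_list, ← U.map_α, ← tw_zpow_α]
    congr 2
    exact f.2 a
  · rw [U.homog_word f.1 _ hl, U.homog_word f.1 _ (by simpa using hl), map_zero]

lemma word_mem_cochains {n : ℕ} (f : R.Cochain R.self n) : U.word f.1 ∈ cochains U.σ :=
  ⟨U.multiLin_word f.1, U.equivariant_word f, n + 1, fun l hl => U.homog_word f.1 l (by omega)⟩

/-- The passage to functions on words as a linear map. -/
noncomputable def wordₗ (n : ℕ) : R.Cochain R.self n →ₗ[k] List B → B where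
  toFun f := U.word f.1
  map_add' f g := funext fun l => by
    by_cases hl : l.length = n
    · obtain ⟨a, rfl⟩ := U.exists_list hl
      change U.word (f.1 + g.1) _ = U.word f.1 _ + U.word g.1 _
      simp [word_list]
    · change U.word (f.1 + g.1) _ = U.word f.1 _ + U.word g.1 _
      simp only [U.homog_word _ _ hl, add_zero]
  map_smul' c f := funext fun l => by
    by_cases hl : l.length = n
    · obtain ⟨a, rfl⟩ := U.exists_list hl
      change U.word (c • f.1) _ = c • U.word f.1 _
      simp [word_list]
    · change U.word (c • f.1) _ = c • U.word f.1 _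
      simp only [U.homog_word _ _ hl, smul_zero]

lemma wordₗ_apply {n : ℕ} (f : R.Cochain R.self n) : U.wordₗ n f = U.word f.1 := rfl

lemma wordₗ_injective (n : ℕ) : Function.Injective (U.wordₗ n) := fun f g h => by
  refine Subtype.ext (MultilinearMap.ext fun a => ?_)
  have := congrFun h (U.list a)
  simpa only [wordₗ_apply, word_list, EmbeddingLike.apply_eq_iff_eq] using this

/-- The multilinear map that is given by a function on words. -/
noncomputable def unword (n : ℕ) {F : List B → B} (hF : MultiLin k F) :
    MultilinearMap k (fun _ : Fin n => A) A where
  toFun a := (R.tw ^ ((n : ℤ) - 1)) (U.e.symm (F (U.list a)))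
  map_update_add' {inst} a s x y := by
    rw [Subsingleton.elim inst (instDecidableEqFin n)]
    simp only [list_update, map_add, (hF _ _).map_add]
  map_update_smul' {inst} a s c x := by
    rw [Subsingleton.elim inst (instDecidableEqFin n)]
    simp only [list_update, map_smul, (hF _ _).map_smul]

/-- The cochain that is given by a function on words. -/
noncomputable def unwordCochain (n : ℕ) {F : List B → B} (hF : MultiLin k F)
    (hσ : Equivariant U.σ F) : R.Cochain R.self n :=
  ⟨U.unword n hF, fun a => by
    change R.α ((R.tw ^ ((n : ℤ) - 1)) (U.e.symm (F (U.list a)))) =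
      (R.tw ^ ((n : ℤ) - 1)) (U.e.symm (F (U.list fun i => R.α (a i))))
    rw [← map_list, ← hσ, ← tw_zpow_α]
    congr 1
    apply U.e.injective
    rw [U.map_α, U.e.apply_symm_apply, U.e.apply_symm_apply]⟩

lemma word_unwordCochain (n : ℕ) {F : List B → B} (hF : MultiLin k F)
    (hσ : Equivariant U.σ F) {l : List B} (hl : l.length = n) :
    U.word (U.unwordCochain n hF hσ).1 l = F l := by
  obtain ⟨a, rfl⟩ := U.exists_list hl
  rw [word_list]
  change U.e ((R.tw ^ (1 - (n : ℤ))) ((R.tw ^ ((n : ℤ) - 1)) (U.e.symm (F (U.list a))))) = _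
  rw [tw_zpow_add]
  simp

lemma word_unwordCochain_eq (n : ℕ) {F : List B → B} (hF : MultiLin k F)
    (hσ : Equivariant U.σ F) (hn : Homog n F) : U.word (U.unwordCochain n hF hσ).1 = F := by
  funext l
  by_cases hl : l.length = n
  · exact U.word_unwordCochain n hF hσ hl
  · rw [U.homog_word _ l hl, hn l hl]

lemma cochain_tw {n : ℕ} (f : R.Cochain R.self n) (z : ℤ) (a : Fin n → A) :
    f.1 (fun i => (R.tw ^ z) (a i)) = (R.tw ^ z) (f.1 a) := by
  have h : ∀ a, f.1 (fun i => R.tw (a i)) = R.tw (f.1 a) := fun a => (f.2 a).symm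
  induction z generalizing a with
  | zero => simp
  | succ n ih =>
    simp only [zpow_add_one, LinearEquiv.mul_apply]
    rw [ih fun i => R.tw (a i), h]
  | pred n ih =>
    have h' : ∀ a, f.1 (fun i => R.tw⁻¹ (a i)) = R.tw⁻¹ (f.1 a) := fun a => by
      apply R.tw.injective
      rw [← h]
      simp only [← LinearEquiv.mul_apply, mul_inv_cancel, LinearEquiv.coe_one, id_eq]
    simp only [zpow_sub_one, LinearEquiv.mul_apply]
    rw [ih fun i => R.tw⁻¹ (a i), h']

lemma list_compArgs {p q r : ℕ} (h : p + q = r + 1) (i : Fin p)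
    (g : MultilinearMap k (fun _ : Fin q => A) A) (a : Fin r → A) :
    (U.list fun j => (R.tw ^ (1 - (q : ℤ))) (R.compArgs h i g a j)) =
      (U.list a).take i ++ U.word g (((U.list a).drop i).take q) :: (U.list a).drop (i + q) := by
  have hm : ((U.list a).drop i).take q = U.list fun s : Fin q => a ⟨i + s, by omega⟩ := by
    apply List.ext_getElem
    · simp; omega
    · intro j h1 h2
      simp [list]
  rw [hm, word_list]
  apply List.ext_getElem
  · simp; omega
  · intro j h1 h2
    have hr : ((U.list a).take i).length = i := by simp; omega
    rw [length_list] at h1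
    rw [List.getElem_append]
    simp only [hr]
    simp only [list, List.getElem_ofFn, compArgs, Fin.ext_iff]
    rcases lt_trichotomy j i with hj | hj | hj
    · rw [dif_pos hj, dif_pos hj, tw_zpow_add]
      simp
    · subst hj
      simp
    · rw [dif_neg (by omega), dif_neg (by omega), dif_neg (by omega), tw_zpow_add]
      obtain ⟨m, hm⟩ : ∃ m, j - i = m + 1 := ⟨j - i - 1, by omega⟩
      have hm' : i + q + m = j + q - 1 := by omega
      simp [hm, hm']

lemma word_circ {p q r : ℕ} (h : p + q = r + 1) (f : R.Cochain R.self p) (i : Fin p)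
    (g : R.Cochain R.self q) {l : List B} (hl : l.length = r) :
    U.word (R.circ h f i g).1 l =
      U.word f.1 (l.take i ++ U.word g.1 ((l.drop i).take q) :: l.drop (i + q)) := by
  obtain ⟨a, rfl⟩ := U.exists_list hl
  rw [← list_compArgs U h i g.1 a, word_list, word_list, cochain_tw, tw_zpow_add,
    show 1 - (p : ℤ) + (1 - (q : ℤ)) = 1 - r by omega]
  rfl

end Untwisting
end RegularUnitalHomAssocAlgebra
end HomAssoc

namespace HomAssoc

namespace Word

/-! ### Insertions and products of homogeneous functions as finite sums -/

section

variable {k B : Type*} [CommRing k] [Ring B] [Algebra k B]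

/-- The insertions of a homogeneous `g` in a homogeneous `F` as a sum over the positions of the
arguments of `F`. -/
lemma ins_eq_sum {p q : ℕ} {F g : List B → B} (hF : MultiLin k F)
    (hg' : Homog q g) {l : List B} (hl : p + q = l.length + 1) :
    ins g F l = ∑ i : Fin p, sgn (i * (q + 1)) •
      F (l.take i ++ g ((l.drop i).take q) :: l.drop (i + q)) := by
  have hz : ∀ (x y : List B) (c : ℤ) (b : B), F (x ++ (c • b) :: y) = c • F (x ++ b :: y) :=
    fun x y c b => (hF x y).mk'.map_smul_of_tower c b
  have h1 : ∀ i ∈ Finset.range (l.length + 1), insHead (prn (l.take i).length g)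
      (fun z => F (l.take i ++ z)) (l.drop i) = if i < p then
        sgn (i * (q + 1)) • F (l.take i ++ g ((l.drop i).take q) :: l.drop (i + q)) else 0 := by
    intro i hi
    have hi' : i ≤ l.length := by simpa [Nat.lt_succ_iff] using hi
    rw [insHead, splits_eq_sum, hg'.prn_eq]
    simp only [hz, List.length_take, min_eq_left hi', List.length_drop, List.drop_drop]
    split_ifs with h
    · rw [Finset.sum_eq_single q]
      · intro j hj hjq
        have : ((l.drop i).take j).length ≠ q := by
          simp at hj ⊢; omega
        rw [hg' _ this, (hF _ _).map_zero, smul_zero]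
      · intro hq
        exact absurd (Finset.mem_range.2 (by omega)) hq
    · refine Finset.sum_eq_zero fun j hj => ?_
      have : ((l.drop i).take j).length ≠ q := by
        simp at hj ⊢; omega
      rw [hg' _ this, (hF _ _).map_zero, smul_zero]
  rw [ins_eq_splits, splits_eq_sum, Finset.sum_congr rfl h1, ← Finset.sum_filter,
    Fin.sum_univ_eq_sum_range (fun i => sgn (i * (q + 1)) •
      F (l.take i ++ g ((l.drop i).take q) :: l.drop (i + q))) p]
  refine Finset.sum_congr (Finset.ext fun i => ?_) fun _ _ => rfl
  simp only [Finset.mem_filter, Finset.mem_range]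
  omega

/-- Insertion of the multiplication of two letters. -/
lemma ins_mul {g : List B → B} (hg' : Homog 2 g) (hg : ∀ a b, g [a, b] = a * b)
    {F : List B → B} (hF : MultiLin k F) (l : List B) :
    ins g F l = -bar (0 : B →ₗ[k] B →ₗ[k] B) F l := by
  have hz : ∀ (x y : List B) (c : ℤ) (b : B), F (x ++ (c • b) :: y) = c • F (x ++ b :: y) :=
    fun x y c b => (hF x y).mk'.map_smul_of_tower c b
  have h0 : ∀ l : List B, l.length ≠ 2 → g l = 0 := hg'
  induction l generalizing F with
  | nil => simp [ins, insHead, h0 [] (by simp), hF.map_zero]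
  | cons a l ih =>
    have hp : pr g = fun l => (-1 : ℤ) • g l := by
      rw [hg'.pr_eq]; rfl
    rw [ins, hp, ins_zsmul_left (hF.cons a), ih (hF.cons a) fun x y c b => hz (a :: x) y c b]
    cases l with
    | nil => simp [insHead, splits_cons, h0 [] (by simp), h0 [a] (by simp), hF.map_zero]
    | cons b l =>
      have : insHead g F (a :: b :: l) = F (a * b :: l) := by
        rw [insHead, splits_cons, splits_cons, h0 [] (by simp), h0 [a] (by simp), hF.map_zero,
          hF.map_zero, zero_add, zero_add]
        cases l with
        | nil => simp [hg]
        | cons c l =>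
          rw [splits_cons, splits_eq_zero, hg, add_zero]
          intro x y _
          rw [h0 _ (by simp), hF.map_zero]
      rw [this, bar_cons]
      simp
      abel

lemma conc_eq_of_homog {q : ℕ} {F G : List B → B} (hF : Homog q F) {l : List B}
    (hl : q ≤ l.length) : conc F G l = F (l.take q) * G (l.drop q) := by
  rw [conc, splits_eq_sum, Finset.sum_eq_single q]
  · intro j hj hjq
    rw [hF _ (by simp at hj ⊢; omega), zero_mul]
  · intro hq
    exact absurd (Finset.mem_range.2 (by omega)) hq

lemma negOnePow_smul {V : Type*} [AddCommGroup V] {z : ℤ} {n : ℕ} (h : Even (z - n)) (x : V) :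
    z.negOnePow • x = sgn n • x := by
  rw [(Int.negOnePow_eq_iff z n).2 h, Int.negOnePow_def, zpow_natCast, Units.smul_def]
  simp [sgn]

end

end Word

namespace RegularUnitalHomAssocAlgebra

open Word

/-! ### Products, brackets and coboundaries on words -/

namespace Untwisting

variable {k A B : Type*} [CommRing k] [AddCommGroup A] [Module k A] [Ring B] [Algebra k B]
  {R : RegularUnitalHomAssocAlgebra k A} (U : R.Untwisting B)

lemma word_mulCochain (a b : B) : U.word R.mulCochain.1 [a, b] = a * b := by
  have : [a, b] = U.list ![U.e.symm a, U.e.symm b] := by simp [list]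
  rw [this, word_list]
  change U.e ((R.tw ^ (1 - ((2 : ℕ) : ℤ))) (R.mul (U.e.symm a) (U.e.symm b))) = _
  rw [e_tw_mul]
  simp

lemma word_cup {p q : ℕ} (f : R.Cochain R.self p) (g : R.Cochain R.self q) :
    U.word (R.cup f g).1 = conc (U.word g.1) (U.word f.1) := by
  funext l
  by_cases hl : l.length = p + q
  · rw [cup, word_circ U _ _ _ _ hl,
      word_circ U (by omega : 2 + p = (p + 1) + 1) R.mulCochain 1 f (by simp; omega),
      conc_eq_of_homog (U.homog_word g.1) (show q ≤ l.length by omega)]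
    have h3 : (l.drop q).take p = l.drop q := List.take_of_length_le (by simp; omega)
    have h2 : (l.drop q).drop p = [] := List.drop_of_length_le (by simp; omega)
    simp only [Fin.val_zero, Fin.val_one, List.take_zero, List.drop_zero, List.nil_append, zero_add,
      List.take_succ_cons, List.drop_succ_cons, Nat.add_comm 1 p, h2, h3, List.cons_append]
    exact U.word_mulCochain _ _
  · rw [U.homog_word _ _ hl, (U.homog_word g.1).conc (U.homog_word f.1) l (by omega)]

/-- The signed sum of the partial compositions of `f` and `g` is the insertion of `g` in `f`. -/
lemma wordₗ_circ_sum {p q r : ℕ} (h : p + q = r + 1) (f : R.Cochain R.self p)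
    (g : R.Cochain R.self q) {l : List B} (hl : l.length = r) (c : Fin p → ℤ)
    (hc : ∀ i, Even (c i - (i * (q + 1) : ℕ))) :
    U.wordₗ r (∑ i : Fin p, (c i).negOnePow • R.circ h f i g) l =
      ins (U.word g.1) (U.word f.1) l := by
  rw [ins_eq_sum (p := p) (U.multiLin_word f.1) (U.homog_word g.1) (hl.symm ▸ h), map_sum,
    Finset.sum_apply]
  refine Finset.sum_congr rfl fun i _ => ?_
  rw [negOnePow_smul (hc i), map_zsmul, ← word_circ U h f i g hl]
  rfl

lemma word_bracket {p q r : ℕ} (h : p + q = r + 1) (f : R.Cochain R.self p)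
    (g : R.Cochain R.self q) : U.word (R.bracket h f g).1 = fun l =>
      ins (U.word g.1) (U.word f.1) l -
        sgn ((p + 1) * (q + 1)) • ins (U.word f.1) (U.word g.1) l := by
  funext l
  by_cases hl : l.length = r
  · have h1 := wordₗ_circ_sum U h f g hl (fun i => ((q : ℤ) - 1) * i)
      fun i => ⟨-i, by push_cast; ring⟩
    have h2 := wordₗ_circ_sum U (by omega : q + p = r + 1) g f hl (fun i => ((p : ℤ) - 1) * i)
      fun i => ⟨-i, by push_cast; ring⟩
    rw [← wordₗ_apply, bracket, map_sub,
      negOnePow_smul (n := (p + 1) * (q + 1)) ⟨-p - q, by push_cast; ring⟩, map_zsmul,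
      ← h1, ← h2]
    rfl
  · rw [U.homog_word _ _ hl, (U.homog_word f.1).ins (U.multiLin_word f.1) (U.homog_word g.1) l
      (by omega), (U.homog_word g.1).ins (U.multiLin_word g.1) (U.homog_word f.1) l (by omega),
      smul_zero, sub_zero]

lemma list_cons {n : ℕ} (a : Fin (n + 1) → A) : U.list a = U.e (a 0) :: U.list (Fin.tail a) := by
  simp [list, List.ofFn_succ, Fin.tail]

lemma list_snoc {n : ℕ} (a : Fin (n + 1) → A) :
    U.list a = U.list (Fin.init a) ++ [U.e (a (Fin.last n))] := by
  simp only [list, List.ofFn_succ']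
  simp [Fin.init]

lemma word_coboundary {n : ℕ} (f : R.Cochain R.self n) :
    U.word (R.coboundary R.self n f).1 = cob k (U.word f.1) := by
  funext l
  by_cases hl : l.length = n + 1
  · obtain ⟨a, rfl⟩ := U.exists_list hl
    have h1 : U.word (R.leftTerm R.self f.1) (U.list a) = lmul (U.word f.1) (U.list a) := by
      rw [word_list, leftTerm_apply, list_cons, lmul, word_list]
      change U.e ((R.tw ^ _) (R.mul _ _)) = _
      rw [e_tw_mul, tw_zpow_add]
      congr 3
      · push_cast; simp
      · push_cast; ring_nf
    -- The middle terms are the insertion of the multiplication, which is the bar differential.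
    have h2 : U.wordₗ (n + 1) (∑ i : Fin n, ((i : ℤ) + 1).negOnePow •
        R.circ (rfl : n + 2 = (n + 1) + 1) f i R.mulCochain) (U.list a) =
          bar (0 : B →ₗ[k] B →ₗ[k] B) (U.word f.1) (U.list a) := by
      have := wordₗ_circ_sum U (rfl : n + 2 = (n + 1) + 1) f R.mulCochain hl (fun i => i)
        fun i => ⟨-i, by push_cast; ring⟩
      rw [ins_mul (U.homog_word _) U.word_mulCochain (U.multiLin_word _)] at this
      rw [← neg_eq_iff_eq_neg.2 this, ← Pi.neg_apply, ← map_neg, ← Finset.sum_neg_distrib]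
      refine congrFun (congrArg _ (Finset.sum_congr rfl fun i _ => ?_)) _
      rw [Int.negOnePow_succ, Units.smul_def, Units.smul_def, Units.val_neg, neg_smul]
    have h3 : U.word (R.rightTerm R.self f.1) (U.list a) =
        U.word f.1 (U.list (Fin.init a)) * U.e (a (Fin.last n)) := by
      rw [word_list, rightTerm_apply, word_list]
      change U.e ((R.tw ^ _) (R.mul _ _)) = _
      rw [e_tw_mul, tw_zpow_add]
      congr 3
      · push_cast; ring_nf
      · push_cast; simp
    have h4 : bar (LinearMap.mul k B) (U.word f.1) (U.list a) =
        bar (0 : B →ₗ[k] B →ₗ[k] B) (U.word f.1) (U.list a) + sgn (n + 1) •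
          (U.word f.1 (U.list (Fin.init a)) * U.e (a (Fin.last n))) := by
      rw [list_snoc, bar_append_last, length_list, sgn_succ, neg_smul, sub_eq_add_neg]
      rfl
    have h5 : ∀ g : MultilinearMap k (fun _ : Fin (n + 1) => A) A,
        U.word g (U.list a) = U.e ((R.tw ^ (1 - ((n + 1 : ℕ) : ℤ))) (g a)) :=
      fun g => U.word_list g a
    have h6 : (R.coboundary R.self n f).1 = R.leftTerm R.self f.1 +
        (∑ i : Fin n, ((i : ℤ) + 1).negOnePow •
          R.circ (rfl : n + 2 = (n + 1) + 1) f i R.mulCochain).1 +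
        sgn (n + 1) • R.rightTerm R.self f.1 := by
      have hs := map_sum (R.cochainSubmodule R.self (n + 1)).subtype
        (fun i : Fin n => ((i : ℤ) + 1).negOnePow •
          R.circ (rfl : n + 2 = (n + 1) + 1) f i R.mulCochain) Finset.univ
      refine Eq.trans ?_ (congrArg (fun x => R.leftTerm R.self f.1 + x +
        sgn (n + 1) • R.rightTerm R.self f.1) hs.symm)
      rw [← negOnePow_smul (z := (n : ℤ) + 1) ⟨0, by push_cast; ring⟩]
      rfl
    rw [cob_eq, h4, ← h1, ← h2, ← h3, h6, wordₗ_apply]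
    simp only [h5, add_apply, smul_apply, map_add, map_zsmul]
    abel
  · rw [U.homog_word _ _ hl, (U.homog_word f.1).cob l hl]

end Untwisting
end RegularUnitalHomAssocAlgebra
end HomAssoc

namespace HomAssoc

namespace RegularUnitalHomAssocAlgebra

open Word

/-! ### The symmetric form and the dual Connes operator on words -/

section Chains

variable {k A : Type*} [CommRing k] [AddCommGroup A] [Module k A]
  (R : RegularUnitalHomAssocAlgebra k A)

variable (k) in
/-- The elementary tensor in `A ⊗ A^{⊗ n}` of the first `n + 1` letters of a word. -/
noncomputable def tens (n : ℕ) (l : List A) : Chain k A n :=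
  PiTensorProduct.tprod k fun i : Fin (n + 1) => l.getD i 0

lemma cyc_tens {n : ℕ} (w : List A) (d : A) (hw : w.length = n) :
    cyc k A n (tens k n (w ++ [d])) = tens k n (d :: w) := by
  rw [tens, tens, cyc_tprod]
  congr 1
  funext i
  obtain ⟨i, rfl⟩ := (finRotate (n + 1)).surjective i
  rw [Equiv.symm_apply_apply]
  subst hw
  refine Fin.lastCases ?_ (fun j => ?_) i
  · simp
  · simp

lemma cyc_pow_tens {n : ℕ} (x y : List A) (h : x.length + y.length = n + 1) :
    (cyc k A n ^ y.length) (tens k n (x ++ y)) = tens k n (y ++ x) := by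
  induction y generalizing x with
  | nil => simp
  | cons d y ih =>
    rw [List.length_cons, pow_succ', Module.End.mul_apply]
    have := ih (x ++ [d]) (by simp at h ⊢; omega)
    rw [List.append_assoc] at this
    rw [show x ++ d :: y = x ++ ([d] ++ y) from rfl, this, ← List.append_assoc,
      cyc_tens _ _ (by simp at h ⊢; omega)]
    rfl

lemma appendOne_tens {n : ℕ} (l : List A) (hl : l.length = n + 1) :
    R.appendOne n (tens k n l) =
      tens k (n + 1) (l.map (fun a => (R.tw ^ (-1 : ℤ)) a) ++ [R.one]) := by
  rw [tens, tens, appendOne_tprod]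
  congr 1
  funext i
  refine Fin.lastCases ?_ (fun j => ?_) i
  · simp [hl]
  · have hj : (j : ℕ) < (l.map fun a => (R.tw ^ (-1 : ℤ)) a).length := by simp [hl]; omega
    have hj' : (j : ℕ) < l.length := by omega
    rw [Fin.snoc_castSucc, Fin.val_castSucc, List.getD_append _ _ _ _ hj]
    simp [hj']

/-- The Connes operator on an elementary tensor. -/
lemma connes_tens {n : ℕ} (c : A) (l : List A) (hl : l.length = n)
    (φ : Module.Dual k (Chain k A (n + 1))) :
    φ (R.connes n (tens k n (c :: l))) = splits (fun x y => sgn (y.length * n) •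
      (φ (tens k (n + 1) (R.one :: (y ++ c :: x).map fun a => (R.tw ^ (-1 : ℤ)) a)) -
        φ (cyc k A (n + 1) (tens k (n + 1)
          (R.one :: (y ++ c :: x).map fun a => (R.tw ^ (-1 : ℤ)) a))))) l := by
  rw [splits_eq_sum, connes, LinearMap.sum_apply, map_sum, hl, ← Finset.sum_range_reflect]
  refine Finset.sum_congr rfl fun i hi => ?_
  have hi' : i ≤ n := by simpa [Nat.lt_succ_iff] using hi
  have e : n + 1 - 1 - i = n - i := by omega
  have hd : (l.drop i).length = n - i := by simp [hl]
  have h1 := cyc_pow_tens (k := k) (n := n) (c :: l.take i) (l.drop i) (by simp; omega)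
  rw [hd, List.cons_append, List.take_append_drop] at h1
  rw [e, hd]
  simp only [LinearMap.smul_apply, LinearMap.comp_apply, LinearMap.sub_apply, LinearMap.id_apply,
    map_smul, map_sub]
  rw [h1, appendOne_tens _ _ (by simp; omega), cyc_tens _ _ (by simp; omega)]
  rw [← Int.cast_smul_eq_zsmul k]
  push_cast
  rfl

end Chains

namespace Untwisting

variable {k A B : Type*} [CommRing k] [AddCommGroup A] [Module k A] [Ring B] [Algebra k B]
  {R : RegularUnitalHomAssocAlgebra k A} (U : R.Untwisting B) (Θ : R.self.Iso R.dual)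

lemma iso_tw (z : ℤ) (a x : A) :
    Θ.toEquiv ((R.tw ^ z) a) ((R.tw ^ z) x) = Θ.toEquiv a x := by
  have h : ∀ a x, Θ.toEquiv (R.α a) (R.α x) = Θ.toEquiv a x := fun a x => by
    rw [show R.α a = R.self.β a from rfl, Θ.map_β]
    change Θ.toEquiv a ((R.tw ^ (-1 : ℤ)) (R.α x)) = _
    rw [tw_zpow_α_add]
    simp
  induction z with
  | zero => simp
  | succ n ih => rw [add_comm, ← tw_zpow_add, ← tw_zpow_add, zpow_one, tw_apply, tw_apply, h, ih]
  | pred n ih =>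
    rw [← ih, ← h]
    simp only [← tw_apply]
    congr 1
    · rw [← LinearEquiv.mul_apply, ← zpow_one_add]; congr 3; ring
    · rw [← LinearEquiv.mul_apply, ← zpow_one_add]; congr 2; ring

lemma e_mul_e (a b : A) : U.e a * U.e b = U.e ((R.tw ^ (-1 : ℤ)) (R.mul a b)) := by
  rw [e_tw_mul]
  simp

/-- The linear isomorphism from the untwisted algebra to its dual that is given by the isomorphism
`A ≃ A^*`. -/
noncomputable def formEquiv : B ≃ₗ[k] (B →ₗ[k] k) :=
  U.e.symm ≪≫ₗ Θ.toEquiv ≪≫ₗ (U.e.symm ≪≫ₗ (R.tw ^ (-1 : ℤ))).dualMap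

lemma formEquiv_apply (a x : A) :
    U.formEquiv Θ (U.e a) (U.e x) = Θ.toEquiv a ((R.tw ^ (-1 : ℤ)) x) := by
  simp only [formEquiv, LinearEquiv.trans_apply, LinearEquiv.symm_apply_apply,
    LinearEquiv.dualMap_apply]

/-- The symmetric form on the untwisted algebra that is given by the isomorphism `A ≃ A^*`. -/
noncomputable def form : SymmForm k B where
  T := U.formEquiv Θ
  mul_right b c x := by
    obtain ⟨b, rfl⟩ := U.e.surjective b
    obtain ⟨c, rfl⟩ := U.e.surjective c
    obtain ⟨x, rfl⟩ := U.e.surjective x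
    rw [e_mul_e, e_mul_e, formEquiv_apply, formEquiv_apply, iso_tw, tw_zpow_add,
      show R.mul b c = R.self.r b c from rfl, Θ.map_r]
    rfl
  mul_left b c x := by
    obtain ⟨b, rfl⟩ := U.e.surjective b
    obtain ⟨c, rfl⟩ := U.e.surjective c
    obtain ⟨x, rfl⟩ := U.e.surjective x
    rw [e_mul_e, e_mul_e, formEquiv_apply, formEquiv_apply, iso_tw, tw_zpow_add,
      show R.mul c b = R.self.l c b from rfl, Θ.map_l]
    rfl

lemma form_apply (a x : A) : (U.form Θ).T (U.e a) (U.e x) = Θ.toEquiv a ((R.tw ^ (-1 : ℤ)) x) :=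
  U.formEquiv_apply Θ a x

lemma form_σ (b : B) : (U.form Θ).τ (U.σ b) = (U.form Θ).τ b := by
  obtain ⟨b, rfl⟩ := U.e.surjective b
  rw [SymmForm.τ, ← U.map_one, ← U.map_α, form_apply, form_apply, tw_zpow_α]
  have := iso_tw Θ 1 R.one ((R.tw ^ (-1 : ℤ)) b)
  rw [zpow_one, tw_apply, tw_apply, R.α_one] at this
  exact this

/-- The functional on chains of a cochain with values in `A^*` in terms of words. -/
lemma functional_tens {n : ℕ} (f : R.Cochain R.self n) (c : A) (l : List A) (hl : l.length = n) :
    R.functionalEquiv n (R.mapCochain Θ f).1 (tens k n (c :: l)) =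
      (U.form Θ).T (U.word f.1 (l.map U.e)) (U.e c) := by
  have h1 : l.map U.e = U.list fun i : Fin n => l.getD i 0 := by
    subst hl
    apply List.ext_getElem <;> simp [list]
  rw [tens, functionalEquiv_tprod, h1, word_list, form_apply]
  have h2 := iso_tw Θ (1 - (n : ℤ)) (f.1 fun i : Fin n => l.getD i 0) ((R.tw ^ ((n : ℤ) - 2)) c)
  rw [tw_zpow_add, show (1 - (n : ℤ)) + ((n : ℤ) - 2) = -1 by ring] at h2
  rw [h2]
  change Θ.toEquiv (f.1 _) _ = _
  congr 2

/-- The dual Connes operator on words: in `B = ∑ ± (id - t) t (e • tⁱ)`, the summand `id` of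
`id - t` gives the operator `bv`, and the summand `t` gives `bvConnes - bv`, up to signs. As the
rotation in `id - t` has no sign, the result is not a multiple of `bvConnes`. -/
noncomputable def connesWord (n : ℕ) (F : List B → B) (l : List B) : B :=
  sgn (n + 1) • (bv (U.form Θ) F l - sgn n • (bvConnes (U.form Θ) F l - bv (U.form Θ) F l))

lemma multiLin_connesWord (n : ℕ) {F : List B → B} (hF : MultiLin k F) :
    MultiLin k (U.connesWord Θ n F) :=
  ((hF.bv _).sub (((hF.bvConnes _).sub (hF.bv _)).length_smul fun _ => sgn n)).length_smul
    fun _ => sgn (n + 1)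

lemma equivariant_connesWord (n : ℕ) {F : List B → B} (hF : MultiLin k F)
    (hσ : Equivariant U.σ F) : Equivariant U.σ (U.connesWord Θ n F) := fun l => by
  simp only [connesWord, map_zsmul, map_sub, hσ.bv (U.form_σ Θ) hF l,
    hσ.bvConnes (U.form_σ Θ) hF l]

lemma T_connesWord (n : ℕ) {F : List B → B} (hF : MultiLin k F) (l : List B) (a : B) :
    (U.form Θ).T (U.connesWord Θ n F l) a =
      sgn (n + 1) • (rot k (fun l => (U.form Θ).τ (F l)) l a -
        sgn n • rot k (unitTr (U.form Θ) F) l a) := by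
  rw [connesWord, map_zsmul, map_sub, map_zsmul, map_sub, T_bvConnes _ hF, T_bv,
    add_sub_cancel_left]
  rfl

lemma tr_map_tw {F : List B → B} (hσ : Equivariant U.σ F) (l : List A) :
    (U.form Θ).τ (F ((l.map fun a => (R.tw ^ (-1 : ℤ)) a).map U.e)) =
      (U.form Θ).τ (F (l.map U.e)) := by
  rw [← form_σ, hσ, List.map_map, List.map_map]
  congr 3
  funext a
  change U.σ (U.e ((R.tw ^ (-1 : ℤ)) a)) = U.e a
  rw [← U.map_α, ← tw_zpow_α, tw_zpow_α_add]
  simp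

/-- The value of the Connes operator on a functional that is given by a cochain. -/
lemma functional_connes {n : ℕ} (f : R.Cochain R.self (n + 1)) (c : A) (l : List A)
    (hl : l.length = n) :
    R.functionalEquiv (n + 1) (R.mapCochain Θ f).1 (R.connes n (tens k n (c :: l))) =
      rot k (fun l => (U.form Θ).τ (U.word f.1 l)) (l.map U.e) (U.e c) -
        sgn n • rot k (unitTr (U.form Θ) (U.word f.1)) (l.map U.e) (U.e c) := by
  set F := U.word f.1 with hF
  set S := U.form Θ with hS
  have hm : MultiLin k F := U.multiLin_word f.1
  have hσ : Equivariant U.σ F := U.equivariant_word f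
  have hu := unitTr_multiLin (S := S) hm
  have hl' := lastTr_multiLin (S := S) (hm.cons 1)
  rw [connes_tens _ _ _ hl, ← rot_congr hu hl' (lastTr_append S fun l => F (1 :: l)),
    rot_apply (hm.comp S.τ), rot_apply hl', splits_map, splits_map, ← splits_smul, ← splits_sub]
  refine splits_congr fun x y hxy => ?_
  have hlen : (y ++ c :: x).length = n + 1 := by
    rw [← hl, ← hxy]; simp; omega
  have hsgn : sgn (y.length * n) = sgn (y.length * (x.length + 1)) := by
    refine sgn_congr ?_
    rw [← hl, ← hxy, List.length_append]
    obtain ⟨m, hm⟩ := Nat.even_mul_succ_self y.length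
    exact ⟨y.length * x.length + m, by linear_combination hm⟩
  rw [List.length_map, List.length_map, smul_comm (sgn n), ← smul_sub, hsgn]
  congr 2
  -- The summand `id` of `id - t`: the unit stands in front of the chain.
  · rw [functional_tens U Θ _ _ _ (by simpa using hlen), U.map_one, SymmForm.T_apply,
      _root_.mul_one, tr_map_tw U Θ hσ]
    simp [hF, hS]
  -- The summand `t`: the unit is the first argument of `f`, and the last letter `d` is in front.
  · obtain ⟨w, d, hw⟩ : ∃ w d, y ++ c :: x = w ++ [d] :=
      ⟨_, _, (List.dropLast_append_getLast (l := y ++ c :: x) (by simp)).symm⟩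
    have hwn : w.length = n := by rw [hw] at hlen; simpa using hlen
    have e1 : y.map U.e ++ U.e c :: x.map U.e = w.map U.e ++ [U.e d] := by
      rw [← List.map_cons, ← List.map_append, hw]
      simp
    have e2 : sgn n * sgn n = 1 := sgn_mul_sgn (c := 0) ⟨n, by ring⟩
    rw [e1, lastTr_append, List.length_map, hwn, smul_smul, e2, one_smul, hw,
      List.map_append, List.map_cons, List.map_nil, ← List.cons_append,
      cyc_tens _ _ (by simpa using hwn), functional_tens U Θ _ _ _ (by simpa using hwn)]
    have h1 := hσ.unitTr (U.form_σ Θ) (((d :: w).map fun a => (R.tw ^ (-1 : ℤ)) a).map U.e)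
    have h2 : (((d :: w).map fun a => (R.tw ^ (-1 : ℤ)) a).map U.e).map U.σ = (d :: w).map U.e := by
      rw [List.map_map, List.map_map]
      congr 1
      funext a
      change U.σ (U.e ((R.tw ^ (-1 : ℤ)) a)) = U.e a
      rw [← U.map_α, ← tw_zpow_α, tw_zpow_α_add]
      simp
    rw [h2] at h1
    change _ = unitTr S F ((d :: w).map U.e)
    rw [h1, SymmForm.T_apply, SymmForm.τ_comm, List.map_cons, U.map_one]
    rfl

/-- The dual Connes operator, transported to cochains with values in `A`. -/
lemma dualConnes_mapCochain {n : ℕ} (f : R.Cochain R.self (n + 1)) :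
    R.dualConnes n (R.mapCochain Θ f) = R.mapCochain Θ (U.unwordCochain n
      (U.multiLin_connesWord Θ n (U.multiLin_word f.1))
      (U.equivariant_connesWord Θ n (U.multiLin_word f.1) (U.equivariant_word f))) := by
  refine Subtype.ext ((R.functionalEquiv n).injective (PiTensorProduct.ext
    (MultilinearMap.ext fun a => ?_)))
  obtain ⟨c, l, hl, ha⟩ : ∃ (c : A) (l : List A), l.length = n ∧
      PiTensorProduct.tprod k a = tens k n (c :: l) := by
    refine ⟨a 0, List.ofFn (Fin.tail a), by simp, ?_⟩
    rw [tens]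
    congr 1
    funext i
    refine Fin.cases ?_ (fun j => ?_) i
    · simp
    · simp [Fin.tail]
  have h1 : R.functionalEquiv n (R.dualConnes n (R.mapCochain Θ f)).1 = (-1 : k) ^ (n + 1) •
      (R.functionalEquiv (n + 1) (R.mapCochain Θ f).1 ∘ₗ R.connes n) := by
    change R.functionalEquiv n ((-1 : k) ^ (n + 1) • (R.functionalEquiv n).symm _) = _
    rw [map_smul, LinearEquiv.apply_symm_apply]
    rfl
  rw [LinearMap.compMultilinearMap_apply, LinearMap.compMultilinearMap_apply, ha, h1,
    functional_tens U Θ _ _ _ hl, word_unwordCochain _ _ _ _ (by simpa using hl),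
    T_connesWord _ _ _ (U.multiLin_word f.1), LinearMap.smul_apply, LinearMap.comp_apply,
    functional_connes U Θ f c l hl, ← Int.cast_smul_eq_zsmul k (sgn (n + 1))]
  push_cast
  rfl

end Untwisting
end RegularUnitalHomAssocAlgebra
end HomAssoc

namespace HomAssoc

/-! ### From a BV operator to a Gerstenhaber algebra -/

section Formal

variable {k V : Type*} [CommRing k] [AddCommGroup V] [Module k V] {𝒢 : ℤ → Submodule k V}
  {cup br : V →ₗ[k] V →ₗ[k] V} {Δ : V →ₗ[k] V}

lemma negOnePow_eq_ite (n : ℤ) : n.negOnePow = if Even n then 1 else -1 := by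
  split_ifs with h
  · exact Int.negOnePow_even n h
  · exact Int.negOnePow_odd n (Int.not_even_iff_odd.1 h)

lemma even_odd_cases (n : ℤ) : (Even n ∧ ¬Odd n) ∨ (¬Even n ∧ Odd n) := by
  rcases Int.even_or_odd n with h | h
  · exact Or.inl ⟨h, Int.not_odd_iff_even.2 h⟩
  · exact Or.inr ⟨Int.not_even_iff_odd.2 h, h⟩

/-- A BV operator is a derivation of its bracket. -/
lemma IsBVGenerator.map_br (hΔ : IsBVGenerator 𝒢 cup br Δ) {p : ℤ} {f : V} (hf : f ∈ 𝒢 p)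
    (g : V) :
    Δ (br f g) = br (Δ f) g - p.negOnePow • br f (Δ g) := by
  rw [hΔ.br_eq g hf, hΔ.br_eq g (hΔ.mem hf), hΔ.br_eq (Δ g) hf]
  rcases even_odd_cases p with ⟨hp, hp'⟩ | ⟨hp, hp'⟩ <;>
    simp [negOnePow_eq_ite, hp, hp', hΔ.sq_zero] <;> abel

/-- The bracket of a BV operator is graded antisymmetric. -/
lemma IsBVGenerator.br_skew (hΔ : IsBVGenerator 𝒢 cup br Δ)
    (comm : ∀ {p q : ℤ} {f g : V}, f ∈ 𝒢 p → g ∈ 𝒢 q → cup f g = (p * q).negOnePow • cup g f)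
    {p q : ℤ} {f g : V} (hf : f ∈ 𝒢 p) (hg : g ∈ 𝒢 q) :
    br f g = -(((p - 1) * (q - 1)).negOnePow • br g f) := by
  rw [hΔ.br_eq g hf, hΔ.br_eq f hg, comm hf hg, comm (hΔ.mem hf) hg, comm hf (hΔ.mem hg)]
  rcases even_odd_cases p with ⟨hp, hp'⟩ | ⟨hp, hp'⟩ <;>
    rcases even_odd_cases q with ⟨hq, hq'⟩ | ⟨hq, hq'⟩ <;>
    simp [negOnePow_eq_ite, Int.even_mul, hp, hp', hq, hq'] <;> abel

/-- For a BV operator, the Jacobi identity follows from the Leibniz rule: expand `[g, h]`,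
`[[f, g], h]` and `[g, [f, h]]` by the BV formula, and use that `[f, ·]` is a derivation of the
product and that the operator is a derivation of the bracket. -/
lemma IsBVGenerator.jacobi (hΔ : IsBVGenerator 𝒢 cup br Δ)
    (br_mem : ∀ {p q : ℤ} {f g : V}, f ∈ 𝒢 p → g ∈ 𝒢 q → br f g ∈ 𝒢 (p + q - 1))
    (leibniz : ∀ {p q : ℤ} {f g : V} (h : V), f ∈ 𝒢 p → g ∈ 𝒢 q →
      br f (cup g h) = cup (br f g) h + ((p - 1) * q).negOnePow • cup g (br f h))
    {p q : ℤ} {f g : V} (h : V) (hf : f ∈ 𝒢 p) (hg : g ∈ 𝒢 q) :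
    br f (br g h) = br (br f g) h + ((p - 1) * (q - 1)).negOnePow • br g (br f h) := by
  have h1 := hΔ.map_br hf (cup g h)
  rw [leibniz h hf hg, leibniz h (hΔ.mem hf) hg] at h1
  rw [hΔ.br_eq h hg, hΔ.br_eq h (br_mem hf hg), hΔ.br_eq (br f h) hg, hΔ.map_br hf g,
    hΔ.map_br hf h]
  have h2 := leibniz h hf (hΔ.mem hg)
  have h3 := leibniz (Δ h) hf hg
  rcases even_odd_cases p with ⟨hp, hp'⟩ | ⟨hp, hp'⟩ <;>
    rcases even_odd_cases q with ⟨hq, hq'⟩ | ⟨hq, hq'⟩ <;>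
    simp [negOnePow_eq_ite, Int.odd_add,
      Int.even_mul, hp, hp', hq, hq'] at h1 h2 h3 ⊢ <;>
    rw [h2, h3]
  · linear_combination (norm := module) (-1 : ℤ) • h1
  · linear_combination (norm := module) (1 : ℤ) • h1
  · linear_combination (norm := module) (1 : ℤ) • h1
  · linear_combination (norm := module) (-1 : ℤ) • h1

/-- A BV operator on a graded commutative algebra, for the bracket of which the Leibniz rule holds,
makes it a Gerstenhaber algebra. -/
lemma IsBVGenerator.isGerstenhaberAlgebra (hΔ : IsBVGenerator 𝒢 cup br Δ)
    (internal : DirectSum.IsInternal 𝒢)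
    (cup_mem : ∀ {p q : ℤ} {f g : V}, f ∈ 𝒢 p → g ∈ 𝒢 q → cup f g ∈ 𝒢 (p + q))
    (assoc : ∀ f g h : V, cup (cup f g) h = cup f (cup g h))
    (comm : ∀ {p q : ℤ} {f g : V}, f ∈ 𝒢 p → g ∈ 𝒢 q → cup f g = (p * q).negOnePow • cup g f)
    (leibniz : ∀ {p q : ℤ} {f g : V} (h : V), f ∈ 𝒢 p → g ∈ 𝒢 q →
      br f (cup g h) = cup (br f g) h + ((p - 1) * q).negOnePow • cup g (br f h)) :
    IsGerstenhaberAlgebra 𝒢 cup br := by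
  have smul_mem : ∀ {i : ℤ} {x : V} (c : ℤˣ), x ∈ 𝒢 i → c • x ∈ 𝒢 i := fun c hx => by
    rw [Units.smul_def]
    exact zsmul_mem hx _
  have br_mem : ∀ {p q : ℤ} {f g : V}, f ∈ 𝒢 p → g ∈ 𝒢 q → br f g ∈ 𝒢 (p + q - 1) := by
    intro p q f g hf hg
    rw [hΔ.br_eq g hf]
    have h1 := cup_mem (hΔ.mem hf) hg
    have h2 := cup_mem hf (hΔ.mem hg)
    rw [show p - 1 + q = p + q - 1 by ring] at h1
    rw [show p + (q - 1) = p + q - 1 by ring] at h2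
    exact neg_mem (smul_mem _ (sub_mem (sub_mem (hΔ.mem (cup_mem hf hg)) h1) (smul_mem _ h2)))
  exact ⟨internal, cup_mem, br_mem, assoc, comm, hΔ.br_skew comm,
    fun h hf hg => hΔ.jacobi br_mem leibniz h hf hg, leibniz⟩

end Formal

end HomAssoc

namespace HomAssoc

namespace RegularUnitalHomAssocAlgebra

open Word

/-! ### The graded module of cohomology -/

section Graded

variable {k A M N : Type*} [CommRing k] [AddCommGroup A] [Module k A] [AddCommGroup M] [Module k M]
  [AddCommGroup N] [Module k N] (R : RegularUnitalHomAssocAlgebra k A)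
  {X : HomBimodule R.toHomAssocAlgebra M} {Y : HomBimodule R.toHomAssocAlgebra N}

lemma classOf_surjective (n : ℕ) : Function.Surjective (R.classOf X n) :=
  Submodule.mkQ_surjective _

lemma total_hom_ext {W : Type*} [AddCommGroup W] [Module k W] {φ ψ : R.TotalCohomology X →ₗ[k] W}
    (h : ∀ n (f : R.cocycles X n), φ (R.incl X n (R.classOf X n f)) =
      ψ (R.incl X n (R.classOf X n f))) : φ = ψ :=
  DirectSum.linearMap_ext k fun n => LinearMap.ext fun c => by
    obtain ⟨f, rfl⟩ := R.classOf_surjective n c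
    exact h n f

variable (X) in
/-- The component of degree `n` of a class. -/
noncomputable def proj (n : ℕ) : R.TotalCohomology X →ₗ[k] R.Cohomology X n :=
  DirectSum.component k ℕ (fun n => R.Cohomology X n) n

lemma proj_incl_self (n : ℕ) (c : R.Cohomology X n) : R.proj X n (R.incl X n c) = c :=
  DirectSum.component.lof_self _ _ _

lemma proj_incl_of_ne {m n : ℕ} (h : m ≠ n) (c : R.Cohomology X m) :
    R.proj X n (R.incl X m c) = 0 :=
  (DirectSum.component.of _ _ _ _).trans (dif_neg h)

lemma grading_natCast (n : ℕ) : R.grading X n = LinearMap.range (R.incl X n) := by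
  refine le_antisymm (iSup₂_le fun m hm => ?_) (le_iSup₂_of_le n rfl le_rfl)
  rw [Nat.cast_injective hm]

lemma grading_cases {i : ℤ} {x : R.TotalCohomology X} (hx : x ∈ R.grading X i) :
    x = 0 ∨ ∃ n : ℕ, i = n ∧ ∃ f : R.cocycles X n, x = R.incl X n (R.classOf X n f) := by
  by_cases hi : ∃ n : ℕ, i = n
  · obtain ⟨n, rfl⟩ := hi
    rw [grading_natCast] at hx
    obtain ⟨c, rfl⟩ := hx
    obtain ⟨f, rfl⟩ := R.classOf_surjective n c
    exact Or.inr ⟨n, rfl, f, rfl⟩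
  · left
    have : R.grading X i = ⊥ :=
      eq_bot_iff.2 (iSup₂_le fun n hn => absurd ⟨n, hn.symm⟩ hi)
    rwa [this, Submodule.mem_bot] at hx

lemma iSup_grading : ⨆ i, R.grading X i = ⊤ := by
  refine eq_top_iff.2 fun x _ => ?_
  induction x using DirectSum.induction_on with
  | zero => exact zero_mem _
  | of n c =>
    refine Submodule.mem_iSup_of_mem (n : ℤ) ?_
    rw [grading_natCast]
    exact ⟨c, rfl⟩
  | add x y hx hy => exact add_mem (hx trivial) (hy trivial)

lemma isInternal_grading : DirectSum.IsInternal (R.grading X) := by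
  refine DirectSum.isInternal_submodule_of_iSupIndep_of_iSup_eq_top (fun i => ?_) R.iSup_grading
  refine Submodule.disjoint_def.2 fun x hx hx' => ?_
  obtain h | ⟨n, rfl, f, rfl⟩ := R.grading_cases hx
  · exact h
  -- The component of degree `n` vanishes on all other degrees.
  have h : ⨆ j, ⨆ (_ : j ≠ (n : ℤ)), R.grading X j ≤ LinearMap.ker (R.proj X n) := by
    refine iSup₂_le fun j hj => iSup₂_le fun m hm => ?_
    rintro _ ⟨c, rfl⟩
    refine R.proj_incl_of_ne ?_ c
    rintro rfl
    exact hj hm.symm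
  have h0 := LinearMap.mem_ker.1 (h hx')
  rw [proj_incl_self] at h0
  rw [h0, map_zero]

lemma IsClassOf.mem_grading {n : ℕ} {x : R.TotalCohomology X} {f : R.Cochain X n}
    (h : R.IsClassOf X n x f) : x ∈ R.grading X n := by
  obtain ⟨hf, rfl⟩ := h
  rw [grading_natCast]
  exact ⟨_, rfl⟩

/-- The inverse of an isomorphism of hom-bimodules. -/
def _root_.HomAssoc.HomBimodule.Iso.symm {R : HomAssocAlgebra k A} {X : HomBimodule R M}
    {Y : HomBimodule R N} (Θ : X.Iso Y) : Y.Iso X where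
  toEquiv := Θ.toEquiv.symm
  map_β m := by
    obtain ⟨m, rfl⟩ := Θ.toEquiv.surjective m
    rw [← Θ.map_β, LinearEquiv.symm_apply_apply, LinearEquiv.symm_apply_apply]
  map_l a m := by
    obtain ⟨m, rfl⟩ := Θ.toEquiv.surjective m
    rw [← Θ.map_l, LinearEquiv.symm_apply_apply, LinearEquiv.symm_apply_apply]
  map_r m a := by
    obtain ⟨m, rfl⟩ := Θ.toEquiv.surjective m
    rw [← Θ.map_r, LinearEquiv.symm_apply_apply, LinearEquiv.symm_apply_apply]

variable {R}

lemma mapCochain_symm_mapCochain (Θ : X.Iso Y) {n : ℕ} (f : R.Cochain X n) :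
    R.mapCochain Θ.symm (R.mapCochain Θ f) = f :=
  Subtype.ext (MultilinearMap.ext fun a => Θ.toEquiv.symm_apply_apply (f.1 a))

lemma mapCochain_mapCochain_symm (Θ : X.Iso Y) {n : ℕ} (f : R.Cochain Y n) :
    R.mapCochain Θ (R.mapCochain Θ.symm f) = f :=
  Subtype.ext (MultilinearMap.ext fun a => Θ.toEquiv.apply_symm_apply (f.1 a))

lemma coboundary_apply {n : ℕ} (f : R.Cochain X n) (a : Fin (n + 1) → A) :
    (R.coboundary X n f).1 a = R.leftTerm X f.1 a +
      ∑ i : Fin n, ((i : ℤ) + 1).negOnePow •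
        R.comp (rfl : n + 2 = (n + 1) + 1) f.1 i R.mulMap a +
      ((n : ℤ) + 1).negOnePow • R.rightTerm X f.1 a := by
  change R.coboundaryAux X n f.1 a = _
  simp only [coboundaryAux, LinearMap.coe_mk, AddHom.coe_mk, add_apply, sum_apply, smul_apply]

lemma coboundary_mapCochain (Θ : X.Iso Y) {n : ℕ} (f : R.Cochain X n) :
    R.coboundary Y n (R.mapCochain Θ f) = R.mapCochain Θ (R.coboundary X n f) := by
  refine Subtype.ext (MultilinearMap.ext fun a => ?_)
  refine Eq.trans ?_ (congrArg Θ.toEquiv (coboundary_apply f a)).symm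
  rw [coboundary_apply]
  simp only [Units.smul_def, map_add, map_sum, map_zsmul, leftTerm_apply, rightTerm_apply,
    comp_apply, Θ.map_l, Θ.map_r]
  rfl

/-- The map on cocycles that is induced by an isomorphism of hom-bimodules. -/
noncomputable def mapCocycles (Θ : X.Iso Y) (n : ℕ) : R.cocycles X n →ₗ[k] R.cocycles Y n where
  toFun f := ⟨R.mapCochain Θ f.1, by
    rw [cocycles, LinearMap.mem_ker, coboundary_mapCochain, LinearMap.mem_ker.1 f.2]
    exact Subtype.ext (MultilinearMap.ext fun a => map_zero Θ.toEquiv)⟩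
  map_add' f g := Subtype.ext (Subtype.ext (MultilinearMap.ext fun a => map_add Θ.toEquiv _ _))
  map_smul' c f := Subtype.ext (Subtype.ext (MultilinearMap.ext fun a => map_smul Θ.toEquiv _ _))

/-- The map on cohomology that is induced by an isomorphism of hom-bimodules. -/
noncomputable def mapCohomology (Θ : X.Iso Y) (n : ℕ) : R.Cohomology X n →ₗ[k] R.Cohomology Y n :=
  Submodule.mapQ _ _ (mapCocycles Θ n) fun f hf => by
    cases n with
    | zero =>
      have : f = 0 := Subtype.ext hf
      rw [this]
      exact zero_mem _
    | succ n =>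
      obtain ⟨E, hE⟩ := hf
      exact ⟨R.mapCochain Θ E, (coboundary_mapCochain Θ E).trans (congrArg _ hE)⟩

/-- The map on the graded module of cohomology that is induced by an isomorphism of
hom-bimodules. -/
noncomputable def mapTotal (Θ : X.Iso Y) : R.TotalCohomology X →ₗ[k] R.TotalCohomology Y :=
  DirectSum.toModule k ℕ _ fun n => R.incl Y n ∘ₗ mapCohomology Θ n

lemma mapTotal_incl (Θ : X.Iso Y) {n : ℕ} (f : R.cocycles X n) :
    mapTotal Θ (R.incl X n (R.classOf X n f)) = R.incl Y n (R.classOf Y n (mapCocycles Θ n f)) :=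
  DirectSum.toModule_lof k n _

/-- The isomorphism on cohomology that is induced by an isomorphism of hom-bimodules. -/
noncomputable def totalEquiv (Θ : X.Iso Y) : R.TotalCohomology X ≃ₗ[k] R.TotalCohomology Y :=
  LinearEquiv.ofLinearMap (mapTotal Θ) (mapTotal Θ.symm)
    (R.total_hom_ext fun n f => by
      rw [LinearMap.comp_apply, mapTotal_incl, mapTotal_incl]
      exact congrArg (fun g => R.incl Y n (R.classOf Y n g))
        (Subtype.ext (mapCochain_mapCochain_symm Θ f.1)))
    (R.total_hom_ext fun n f => by
      rw [LinearMap.comp_apply, mapTotal_incl, mapTotal_incl]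
      exact congrArg (fun g => R.incl X n (R.classOf X n g))
        (Subtype.ext (mapCochain_symm_mapCochain Θ f.1)))

lemma IsClassOf.map (Θ : X.Iso Y) {n : ℕ} {x : R.TotalCohomology X} {f : R.Cochain X n}
    (h : R.IsClassOf X n x f) : R.IsClassOf Y n (totalEquiv Θ x) (R.mapCochain Θ f) := by
  obtain ⟨hf, rfl⟩ := h
  exact ⟨(mapCocycles Θ n ⟨f, hf⟩).2, mapTotal_incl Θ ⟨f, hf⟩⟩

end Graded
end RegularUnitalHomAssocAlgebra
end HomAssoc

namespace HomAssoc

namespace RegularUnitalHomAssocAlgebra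

open Word

namespace Untwisting

/-! ### Cohomology as a quotient of functions on words -/

section

variable {k A B : Type*} [CommRing k] [AddCommGroup A] [Module k A] [Ring B] [Algebra k B]
  {R : RegularUnitalHomAssocAlgebra k A} (U : R.Untwisting B)

lemma word_mem_cocycles {n : ℕ} {f : R.Cochain R.self n} :
    U.word f.1 ∈ Word.cocycles U.σ ↔ f ∈ R.cocycles R.self n := by
  constructor
  · intro h
    refine U.wordₗ_injective (n + 1) ?_
    rw [map_zero, wordₗ_apply, word_coboundary]
    exact h.2
  · intro h
    refine ⟨U.word_mem_cochains f, ?_⟩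
    change cob k (U.word f.1) = 0
    rw [← word_coboundary, ← wordₗ_apply, LinearMap.mem_ker.1 h, map_zero]

/-- The passage to functions on words on cocycles. -/
noncomputable def wordCocycles (n : ℕ) : R.cocycles R.self n →ₗ[k] Word.cocycles U.σ :=
  (U.wordₗ n).restrict fun _ hf => U.word_mem_cocycles.2 hf

/-- The map to the cohomology of functions on words in one degree. -/
noncomputable def wordCohomology (n : ℕ) : R.Cohomology R.self n →ₗ[k] Coh U.σ :=
  Submodule.mapQ _ _ (U.wordCocycles n) fun f hf => by
    cases n with
    | zero =>
      have : f = 0 := Subtype.ext hf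
      rw [this]
      exact zero_mem _
    | succ n =>
      obtain ⟨E, hE⟩ := hf
      refine ⟨U.word E.1, U.word_mem_cochains E, ?_⟩
      change cob k (U.word E.1) = U.word f.1.1
      rw [← word_coboundary, hE]
      rfl

/-- The map to the cohomology of functions on words. -/
noncomputable def toCoh : R.TotalCohomology R.self →ₗ[k] Coh U.σ :=
  DirectSum.toModule k ℕ _ U.wordCohomology

lemma toCoh_incl {n : ℕ} (f : R.cocycles R.self n) :
    U.toCoh (R.incl R.self n (R.classOf R.self n f)) = cls U.σ (U.wordCocycles n f) :=
  DirectSum.toModule_lof k n _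

/-- The restriction to words of length `n`, as a map from functions on words to cochains. -/
noncomputable def unwordCocycles (n : ℕ) : Word.cocycles U.σ →ₗ[k] R.cocycles R.self n where
  toFun F := ⟨U.unwordCochain n F.2.1.1 F.2.1.2.1, by
    refine U.wordₗ_injective (n + 1) ?_
    rw [map_zero, wordₗ_apply, word_coboundary]
    funext l
    by_cases hl : l.length = n + 1
    · rw [cob_congr (fun t ht => U.word_unwordCochain n F.2.1.1 F.2.1.2.1 ht) hl]
      exact cob_eq_zero F.2 l
    · exact (U.homog_word _).cob l hl⟩
  map_add' F G := Subtype.ext (Subtype.ext (MultilinearMap.ext fun a => by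
    change (R.tw ^ ((n : ℤ) - 1)) (U.e.symm (F.1 (U.list a) + G.1 (U.list a))) = _
    rw [map_add, map_add]
    rfl))
  map_smul' c F := Subtype.ext (Subtype.ext (MultilinearMap.ext fun a => by
    change (R.tw ^ ((n : ℤ) - 1)) (U.e.symm (c • F.1 (U.list a))) = _
    rw [map_smul, map_smul]
    rfl))

/-- The component of degree `n` of the cohomology of functions on words. -/
noncomputable def unwordCohomology (n : ℕ) : Coh U.σ →ₗ[k] R.Cohomology R.self n :=
  Submodule.mapQ _ _ (U.unwordCocycles n) fun F hF => by
    obtain ⟨E, hE, hEF⟩ := hF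
    have hF' : ∀ l, F.1 l = cob k E l := fun l => (congrFun hEF l).symm
    cases n with
    | zero =>
      have : U.unwordCocycles 0 F = 0 := Subtype.ext (Subtype.ext (MultilinearMap.ext fun a => by
        change (R.tw ^ ((0 : ℕ) - 1 : ℤ)) (U.e.symm (F.1 (U.list a))) = 0
        rw [hF', show U.list a = [] from List.length_eq_zero_iff.1 (U.length_list a)]
        exact (congrArg _ (map_zero U.e.symm)).trans (map_zero _)))
      rw [Submodule.mem_comap, this]
      exact zero_mem _
    | succ n =>
      refine ⟨U.unwordCochain n hE.1 hE.2.1, U.wordₗ_injective (n + 1) ?_⟩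
      rw [wordₗ_apply, word_coboundary]
      funext l
      by_cases hl : l.length = n + 1
      · rw [cob_congr (fun t ht => U.word_unwordCochain n hE.1 hE.2.1 ht) hl, ← hF']
        exact (U.word_unwordCochain (n + 1) F.2.1.1 F.2.1.2.1 hl).symm
      · rw [(U.homog_word _).cob l hl]
        exact (U.homog_word _ l hl).symm

lemma unwordCohomology_toCoh (n : ℕ) (x : R.TotalCohomology R.self) :
    U.unwordCohomology n (U.toCoh x) = R.proj R.self n x := by
  suffices h : U.unwordCohomology n ∘ₗ U.toCoh = R.proj R.self n from LinearMap.congr_fun h x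
  refine R.total_hom_ext fun m f => ?_
  rw [LinearMap.comp_apply, toCoh_incl]
  change R.classOf R.self n (U.unwordCocycles n (U.wordCocycles m f)) = _
  by_cases h : m = n
  · subst h
    rw [proj_incl_self]
    refine congrArg _ (Subtype.ext (U.wordₗ_injective _ ?_))
    exact U.word_unwordCochain_eq _ (U.multiLin_word _) (U.equivariant_word f.1) (U.homog_word _)
  · rw [R.proj_incl_of_ne h]
    refine (congrArg _ (Subtype.ext (U.wordₗ_injective _ ?_))).trans (map_zero _)
    rw [Submodule.coe_zero, map_zero]
    funext l
    by_cases hl : l.length = n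
    · refine (U.word_unwordCochain n (U.multiLin_word _) (U.equivariant_word f.1) hl).trans
        (U.homog_word f.1.1 l ?_)
      rintro rfl
      exact h hl
    · exact U.homog_word _ l hl

lemma toCoh_injective : Function.Injective U.toCoh := fun x y h => by
  refine DFinsupp.ext fun n => ?_
  have := congrArg (U.unwordCohomology n) h
  rwa [unwordCohomology_toCoh, unwordCohomology_toCoh] at this

lemma toCoh_surjective : Function.Surjective U.toCoh := fun y => by
  obtain ⟨F, rfl⟩ := cls_surjective y
  obtain ⟨N, hN⟩ := F.2.1.2.2
  refine ⟨∑ n ∈ Finset.range N,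
    R.incl R.self n (R.classOf R.self n (U.unwordCocycles n F)), ?_⟩
  simp only [map_sum, toCoh_incl]
  rw [← map_sum]
  congr 1
  refine Subtype.ext (funext fun l => ?_)
  rw [AddSubmonoidClass.coe_finsetSum, Finset.sum_apply]
  change ∑ n ∈ Finset.range N, U.word (U.unwordCochain n F.2.1.1 F.2.1.2.1).1 l = F.1 l
  by_cases hl : l.length < N
  · rw [Finset.sum_eq_single_of_mem l.length (Finset.mem_range.2 hl) fun n _ hn =>
      U.homog_word _ l hn.symm]
    exact U.word_unwordCochain _ _ _ rfl
  · rw [hN l (by omega)]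
    refine Finset.sum_eq_zero fun n hn => U.homog_word _ l ?_
    rw [Finset.mem_range] at hn
    omega

/-- The identification of cohomology with the cohomology of functions on words. -/
noncomputable def cohEquiv : R.TotalCohomology R.self ≃ₗ[k] Coh U.σ :=
  LinearEquiv.ofBijective U.toCoh ⟨U.toCoh_injective, U.toCoh_surjective⟩

lemma isClassOf_iff {n : ℕ} {x : R.TotalCohomology R.self} {f : R.Cochain R.self n} :
    R.IsClassOf R.self n x f ↔ ∃ hf, U.cohEquiv x = cls U.σ ⟨U.word f.1, hf⟩ := by
  constructor
  · rintro ⟨hf, rfl⟩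
    exact ⟨U.word_mem_cocycles.2 hf, U.toCoh_incl ⟨f, hf⟩⟩
  · rintro ⟨hf, h⟩
    exact ⟨U.word_mem_cocycles.1 hf, U.toCoh_injective
      (h.trans (U.toCoh_incl ⟨f, U.word_mem_cocycles.1 hf⟩).symm)⟩

lemma isClassOf_of_word {n : ℕ} {x : R.TotalCohomology R.self} {f : R.Cochain R.self n}
    {F : Word.cocycles U.σ} (hf : U.word f.1 = F.1) (h : U.cohEquiv x = cls U.σ F) :
    R.IsClassOf R.self n x f := by
  have : U.word f.1 ∈ Word.cocycles U.σ := hf ▸ F.2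
  refine U.isClassOf_iff.2 ⟨this, h.trans (congrArg _ (Subtype.ext hf.symm))⟩

lemma exists_cls {n : ℕ} {x : R.TotalCohomology R.self} {f : R.Cochain R.self n}
    (h : R.IsClassOf R.self n x f) :
    ∃ F : Word.cocycles U.σ, F.1 = U.word f.1 ∧ Homog n F.1 ∧ U.cohEquiv x = cls U.σ F := by
  obtain ⟨hf, h⟩ := U.isClassOf_iff.1 h
  exact ⟨⟨_, hf⟩, rfl, U.homog_word _, h⟩

lemma grading_cases {i : ℤ} {x : R.TotalCohomology R.self} (hx : x ∈ R.grading R.self i) :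
    x = 0 ∨ ∃ n : ℕ, i = n ∧
      ∃ F : Word.cocycles U.σ, Homog n F.1 ∧ U.cohEquiv x = cls U.σ F := by
  obtain h | ⟨n, hn, f, rfl⟩ := R.grading_cases hx
  · exact Or.inl h
  · exact Or.inr ⟨n, hn, U.wordCocycles n f, U.homog_word _, U.toCoh_incl f⟩

lemma mem_grading {n : ℕ} {x : R.TotalCohomology R.self} {F : Word.cocycles U.σ}
    (hF : Homog n F.1) (h : U.cohEquiv x = cls U.σ F) : x ∈ R.grading R.self n :=
  (U.isClassOf_of_word (U.word_unwordCochain_eq n F.2.1.1 F.2.1.2.1 hF) h).mem_grading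

/-! ### The BV structure on cohomology -/

/-- The cup product on cohomology. -/
noncomputable def cupH : R.TotalCohomology R.self →ₗ[k] R.TotalCohomology R.self →ₗ[k]
    R.TotalCohomology R.self :=
  ((cupCoh U.σ).compl₁₂ U.cohEquiv.toLinearMap U.cohEquiv.toLinearMap).compr₂
    U.cohEquiv.symm.toLinearMap

@[simp] lemma cohEquiv_cupH (x y : R.TotalCohomology R.self) :
    U.cohEquiv (U.cupH x y) = cupCoh U.σ (U.cohEquiv x) (U.cohEquiv y) :=
  U.cohEquiv.apply_symm_apply _

lemma inducesCup : R.InducesCup U.cupH := fun p q x y f g hf hg => by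
  obtain ⟨F, hF, -, hx⟩ := U.exists_cls hf
  obtain ⟨G, hG, -, hy⟩ := U.exists_cls hg
  refine U.isClassOf_of_word (F := concₗ U.σ F G) ?_ (by rw [cohEquiv_cupH, hx, hy, cupCoh_cls])
  rw [word_cup, ← hF, ← hG]
  rfl

end

section

variable {k A B : Type*} [CommRing k] [AddCommGroup A] [Module k A] [Ring B] [Algebra k B]
  {R : RegularUnitalHomAssocAlgebra k A} (U : R.Untwisting B) (Θ : R.self.Iso R.dual)

/-- The BV operator on cohomology. -/
noncomputable def deltaH : R.TotalCohomology R.self →ₗ[k] R.TotalCohomology R.self :=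
  U.cohEquiv.symm.toLinearMap ∘ₗ deltaCoh (U.form_σ Θ) ∘ₗ U.cohEquiv.toLinearMap

@[simp] lemma cohEquiv_deltaH (x : R.TotalCohomology R.self) :
    U.cohEquiv (U.deltaH Θ x) = deltaCoh (U.form_σ Θ) (U.cohEquiv x) :=
  U.cohEquiv.apply_symm_apply _

/-- The bracket on cohomology. -/
noncomputable def brH : R.TotalCohomology R.self →ₗ[k] R.TotalCohomology R.self →ₗ[k]
    R.TotalCohomology R.self :=
  ((brCoh (U.form_σ Θ)).compl₁₂ U.cohEquiv.toLinearMap U.cohEquiv.toLinearMap).compr₂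
    U.cohEquiv.symm.toLinearMap

@[simp] lemma cohEquiv_brH (x y : R.TotalCohomology R.self) :
    U.cohEquiv (U.brH Θ x y) = brCoh (U.form_σ Θ) (U.cohEquiv x) (U.cohEquiv y) :=
  U.cohEquiv.apply_symm_apply _

lemma inducesBracket : R.InducesBracket (U.brH Θ) := by
  refine ⟨fun p q r h x y f g hf hg => ?_, fun x y f g hf hg => ?_⟩
  · obtain ⟨F, hF, hF', hx⟩ := U.exists_cls hf
    obtain ⟨G, hG, hG', hy⟩ := U.exists_cls hg
    refine U.isClassOf_of_word (F := gerst F G hF' hG') ?_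
      (by rw [cohEquiv_brH, hx, hy, brCoh_eq _ F G hF' hG'])
    rw [word_bracket, ← hF, ← hG]
    rfl
  · obtain ⟨F, -, hF, hx⟩ := U.exists_cls hf
    obtain ⟨G, -, hG, hy⟩ := U.exists_cls hg
    have h0 : gerst F G hF hG = 0 := Subtype.ext (funext fun l => by
      change ins G.1 F.1 l - sgn _ • ins F.1 G.1 l = 0
      rw [hF.ins F.2.1.1 hG l (by omega), hG.ins G.2.1.1 hF l (by omega), smul_zero, sub_zero])
    apply U.cohEquiv.injective
    rw [cohEquiv_brH, hx, hy, brCoh_eq _ F G hF hG, h0, map_zero, map_zero]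

/-- The dual Connes operator on cocycles induces the operator `Δ`. -/
lemma isClassOf_connesWord {n : ℕ} {x : R.TotalCohomology R.self} {f : R.Cochain R.self (n + 1)}
    (h : R.IsClassOf R.self (n + 1) x f) :
    R.IsClassOf R.self n (U.deltaH Θ x) (U.unwordCochain n
      (U.multiLin_connesWord Θ n (U.multiLin_word f.1))
      (U.equivariant_connesWord Θ n (U.multiLin_word f.1) (U.equivariant_word f))) := by
  obtain ⟨F, hF, hF', hx⟩ := U.exists_cls h
  obtain ⟨F', h1, h2⟩ := exists_bvConnes (U.form_σ Θ) F
  have h3 : Homog n (bv (U.form Θ) F.1) := fun l hl => hF'.bv F.2.1.1 l (by omega)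
  have h4 : Homog n (bvConnes (U.form Θ) F.1) := hF'.bvConnes F.2.1.1
  refine U.isClassOf_of_word (F := sgn (n + 1) • (bvₗ (U.form_σ Θ) F -
    sgn n • (F' - bvₗ (U.form_σ Θ) F))) ?_ ?_
  · rw [word_unwordCochain_eq, ← hF]
    · funext l
      rw [connesWord, ← h1]
      rfl
    · intro l hl
      rw [connesWord, ← hF, h3 l hl, h4 l hl, sub_zero, smul_zero, sub_zero, smul_zero]
  · rw [cohEquiv_deltaH, hx, deltaCoh_homog _ F hF', map_zsmul, map_sub, map_zsmul, map_sub, h2,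
      bvCoh_cls, sub_self, smul_zero, sub_zero]

/-- The dual Connes operator on the cohomology with values in `A^*`. -/
noncomputable def dualConnesH : R.TotalCohomology R.dual →ₗ[k] R.TotalCohomology R.dual :=
  (totalEquiv Θ).toLinearMap ∘ₗ U.deltaH Θ ∘ₗ (totalEquiv Θ).symm.toLinearMap

lemma inducesDualConnes : R.InducesDualConnes (U.dualConnesH Θ) := by
  have key : ∀ {n : ℕ} {x : R.TotalCohomology R.dual} {m : R.Cochain R.dual n},
      R.IsClassOf R.dual n x m →
        R.IsClassOf R.self n ((totalEquiv Θ).symm x) (R.mapCochain Θ.symm m) :=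
    fun h => h.map Θ.symm
  refine ⟨fun n x m h => ?_, fun x m h => ?_⟩
  · rw [← mapCochain_mapCochain_symm Θ m, dualConnes_mapCochain U]
    exact (U.isClassOf_connesWord Θ (key h)).map Θ
  · obtain ⟨F, -, hF, hx⟩ := U.exists_cls (key h)
    have h0 : U.deltaH Θ ((totalEquiv Θ).symm x) = 0 := by
      apply U.cohEquiv.injective
      rw [cohEquiv_deltaH, hx, deltaCoh_homog _ F hF, bvCoh_cls, bvₗ_eq_zero _ hF, map_zero,
        smul_zero, map_zero]
    exact (congrArg (totalEquiv Θ) h0).trans (map_zero _)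

lemma isBVGenerator : IsBVGenerator (R.grading R.self) U.cupH (U.brH Θ) (U.deltaH Θ) where
  mem {p x} hx := by
    obtain rfl | ⟨n, rfl, F, hF, h⟩ := U.grading_cases hx
    · rw [map_zero]
      exact zero_mem _
    · cases n with
      | zero =>
        have h0 : U.deltaH Θ x = 0 := by
          apply U.cohEquiv.injective
          rw [cohEquiv_deltaH, h, deltaCoh_homog _ F hF, bvCoh_cls, bvₗ_eq_zero _ hF, map_zero,
            smul_zero, map_zero]
        rw [h0]
        exact zero_mem _
      | succ n =>
        have hn : ((n + 1 : ℕ) : ℤ) - 1 = n := by push_cast; ring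
        rw [hn]
        refine U.mem_grading (F := sgn (n + 1) • bvₗ (U.form_σ Θ) F) (fun l hl => ?_) ?_
        · change sgn (n + 1) • bv (U.form Θ) F.1 l = 0
          rw [hF.bv F.2.1.1 l (by omega), smul_zero]
        · rw [cohEquiv_deltaH, h, deltaCoh_homog _ F hF, map_zsmul, bvCoh_cls]
  sq_zero x := by
    apply U.cohEquiv.injective
    rw [cohEquiv_deltaH, cohEquiv_deltaH, deltaCoh_deltaCoh, map_zero]
  br_eq {p x} y hx := by
    apply U.cohEquiv.injective
    obtain rfl | ⟨n, rfl, F, hF, h⟩ := U.grading_cases hx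
    · simp
    · have e : sgn n * sgn n = 1 := sgn_mul_sgn (c := 0) ⟨n, by ring⟩
      have hs : ∀ x : R.TotalCohomology R.self, (n : ℤ).negOnePow • x = sgn n • x :=
        negOnePow_smul ⟨0, by ring⟩
      simp only [hs, map_neg, map_zsmul, map_sub, cohEquiv_brH, cohEquiv_cupH, cohEquiv_deltaH,
        brCoh_apply]
      rw [h, prCoh_homog F hF]
      simp only [sgn_succ, neg_smul, map_neg, map_zsmul, LinearMap.neg_apply, LinearMap.smul_apply,
        smul_sub, smul_smul, e, one_smul]
      abel

/-- By additivity in the last argument, it is enough to consider homogeneous classes. -/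
lemma leibnizH {p q : ℤ} {f g : R.TotalCohomology R.self} (h : R.TotalCohomology R.self)
    (hf : f ∈ R.grading R.self p) (hg : g ∈ R.grading R.self q) :
    U.brH Θ f (U.cupH g h) = U.cupH (U.brH Θ f g) h +
      ((p - 1) * q).negOnePow • U.cupH g (U.brH Θ f h) := by
  obtain rfl | ⟨p, rfl, F, hF, hfF⟩ := U.grading_cases hf
  · simp
  obtain rfl | ⟨q, rfl, G, hG, hgG⟩ := U.grading_cases hg
  · simp
  have hs : ∀ x : R.TotalCohomology R.self,
      (((p : ℤ) - 1) * q).negOnePow • x = sgn ((p + 1) * q) • x :=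
    negOnePow_smul ⟨-q, by push_cast; ring⟩
  rw [hs]
  have hh : h ∈ ⨆ i, R.grading R.self i := by
    rw [R.iSup_grading]
    trivial
  induction hh using Submodule.iSup_induction' with
  | mem i h hi =>
    obtain rfl | ⟨r, rfl, H, hH, hhH⟩ := U.grading_cases hi
    · simp
    apply U.cohEquiv.injective
    have hGH : Homog (q + r) (concₗ U.σ G H).1 := add_comm r q ▸ hH.conc hG
    simp only [map_add, map_zsmul, cohEquiv_brH, cohEquiv_cupH, hfF, hgG, hhH]
    rw [cupCoh_cls, brCoh_eq _ F _ hF hGH, brCoh_eq _ F G hF hG, brCoh_eq _ F H hF hH,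
      cls_gerst_conc]
  | zero => simp
  | add x y _ _ hx hy =>
    simp only [map_add, hx, hy, smul_add]
    abel

lemma isGerstenhaberAlgebra : IsGerstenhaberAlgebra (R.grading R.self) U.cupH (U.brH Θ) := by
  refine (U.isBVGenerator Θ).isGerstenhaberAlgebra R.isInternal_grading ?_ ?_ ?_ (U.leibnizH Θ)
  · intro p q f g hf hg
    obtain rfl | ⟨p, rfl, F, hF, hfF⟩ := U.grading_cases hf
    · simp
    obtain rfl | ⟨q, rfl, G, hG, hgG⟩ := U.grading_cases hg
    · simp
    have h : Homog (p + q) (concₗ U.σ F G).1 := add_comm q p ▸ hG.conc hF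
    have := U.mem_grading h (x := U.cupH f g) (by rw [cohEquiv_cupH, hfF, hgG, cupCoh_cls])
    rwa [Nat.cast_add] at this
  · intro f g h
    apply U.cohEquiv.injective
    simp only [cohEquiv_cupH, cupCoh_assoc]
  · intro p q f g hf hg
    obtain rfl | ⟨p, rfl, F, hF, hfF⟩ := U.grading_cases hf
    · simp
    obtain rfl | ⟨q, rfl, G, hG, hgG⟩ := U.grading_cases hg
    · simp
    rw [negOnePow_smul (n := p * q) ⟨0, by push_cast; ring⟩]
    apply U.cohEquiv.injective
    rw [map_zsmul, cohEquiv_cupH, cohEquiv_cupH, hfF, hgG, cupCoh_comm F G hF hG]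

end

end Untwisting
end RegularUnitalHomAssocAlgebra
end HomAssoc

theorem mainTheorem2 {k A : Type*} [CommRing k] [CharZero k] [AddCommGroup A] [Module k A]
    (R : HomAssoc.RegularUnitalHomAssocAlgebra k A) (Θ : R.self.Iso R.dual) :
    ∃ (cupH brH : R.TotalCohomology R.self →ₗ[k] R.TotalCohomology R.self →ₗ[k]
        R.TotalCohomology R.self)
      (BH : R.TotalCohomology R.dual →ₗ[k] R.TotalCohomology R.dual)
      (ΘH : R.TotalCohomology R.self ≃ₗ[k] R.TotalCohomology R.dual),
      R.InducesCup cupH ∧ R.InducesBracket brH ∧ R.InducesDualConnes BH ∧ R.InducesIso Θ ΘH ∧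
      HomAssoc.IsGerstenhaberAlgebra (R.grading R.self) cupH brH ∧
      HomAssoc.IsBVGenerator (R.grading R.self) cupH brH
        (ΘH.symm.toLinearMap ∘ₗ BH ∘ₗ ΘH.toLinearMap) := by
  let U := R.untwisting
  refine ⟨U.cupH, U.brH Θ, U.dualConnesH Θ, HomAssoc.RegularUnitalHomAssocAlgebra.totalEquiv Θ,
    U.inducesCup, U.inducesBracket Θ, U.inducesDualConnes Θ, fun n x f h => h.map Θ,
    U.isGerstenhaberAlgebra Θ, ?_⟩
  convert U.isBVGenerator Θ using 1
  ext x
  simp [HomAssoc.RegularUnitalHomAssocAlgebra.Untwisting.dualConnesH]
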